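/- Let $(\mathfrak g,(\cdot,\cdot),\mathfrak h)$ be an extended affine Lie algebra over $\mathbb C$: $(\cdot,\cdot)$ is a symmetric, non-degenerate, invariant bilinear form; $\mathfrak h$ is a finite-dimensional subalgebra with $\mathfrak g=\sum_{\alpha\in\mathfrak h^\star}\mathfrak g_\alpha$ and $\mathfrak g_0=\mathfrak h$, where $\mathfrak g_\alpha=\{x\mid [h,x]=\alpha(h)x\ \forall h\in\mathfrak h\}$; let $R=\{\alpha\mid\mathfrak g_\alpha\ne0\}$, let $t_\alpha\in\mathfrak h$ be given by $\alpha(h)=(h,t_\alpha)$, put $(\alpha,\beta)=(t_\alpha,t_\beta)$, and let $R^\times$, $R^0$ be the sets of roots with $(\alpha,\alpha)\neq0$, respectively $(\alpha,\alpha)=0$; it is required that $\operatorname{ad}x$ is locally nilpotent for $x\in\mathfrak g_\alpha$, $\alpha\in R^\times$, that $R$ is discrete in $\mathfrak h^\star$, that $R^\times$ is not a union of two non-empty mutually orthogonal subsets, and that for each $\delta\in R^0$ there is $\alpha\in R^\times$ with $\alpha+\delta\in R$. The core $\mathfrak g_c$ is the subalgebra generated by the $\mathfrak g_\alpha$, $\alpha\in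 R^\times$; put $\mathfrak h_c=\mathfrak h\cap\mathfrak g_c$. Let $m\ge1$, let $\omega$ be a primitive $m$-th root of unity, and let $\sigma$ be an automorphism of $\mathfrak g$ with $\sigma^m=\mathrm{id}$, $\sigma(\mathfrak h)=\mathfrak h$, $(\sigma x,\sigma y)=(x,y)$ and $C_{\mathfrak g^\sigma}(\mathfrak h^\sigma)=\mathfrak h^\sigma$. Let $\sigma$ act on $\mathfrak h^\star$ by $\sigma(\alpha)=\alpha\circ\sigma^{-1}$, let $\pi_j=\frac1m\sum_{i=0}^{m-1}\omega^{-ij}\sigma^i$ (on $\mathfrak g$, $\mathfrak h$ and $\mathfrak h^\star$), and $\pi=\pi_0$. Let $\mathfrak g^{\bar i}=\{x\mid\sigma x=\omega^ix\}$ and $$\tilde{\mathfrak g}=\mathrm{Aff}(\mathfrak g,\sigma)=\sum_{i\in\mathbb Z}(\mathfrak g^{\bar i}\otimes t^i)\oplus\mathbb Cc\oplus\mathbb Cd,\qquad \tilde{\mathfrak h}=\mathfrak h^\sigma\oplus\mathbb Cc\oplus\mathbb Cd,$$ with bracket $[x\otimes t^n+rc+sd,\,y\otimes t^{n'}+r'c+s'd]=[x,y]\otimes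 t^{n+n'}+n\delta_{n+n',0}(x,y)c+sn'y\otimes t^{n'}-s'n\,x\otimes t^n$ and form $(x\otimes t^n+rc+sd,\,y\otimes t^{n'}+r'c+s'd)=(x,y)\delta_{n+n',0}+rs'+r's$. Its root spaces $\tilde{\mathfrak g}_{\tilde\alpha}$ with respect to $\tilde{\mathfrak h}$, its non-isotropic roots $\tilde R^\times$ and its core $\tilde{\mathfrak g}_c$ are defined as for $\mathfrak g$. Elements of $\pi(\mathfrak h^\star)$ are regarded as functionals on $\tilde{\mathfrak h}$ vanishing on $c$ and $d$, and $\delta\in\tilde{\mathfrak h}^\star$ is the functional with $\delta(\mathfrak h^\sigma)=0$, $\delta(c)=0$, $\delta(d)=1$. Let $R_\pi^\times=\{\alpha\in R^\times\mid(\pi(\alpha),\pi(\alpha))\ne0\}$, assumed non-empty. The group $\langle\sigma\rangle$ acts on $R_\pi^\times$; we say that $\pi$ separates the orbits if $\pi(\alpha)=\pi(\beta)$ with $\alpha,\beta\in R_\pi^\times$ implies that $\alpha,\beta$ lie in the same orbit. Let $\mathcal O_\sigma$ be any complete set of orbit representatives. For $k\in\mathbb Z$ let $\mathcal O_{\sigma,k}=\{\alpha\in\mathcal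 O_\sigma\mid\pi_k(\alpha)\neq0\}$, $n_{\sigma,k}=|\mathcal O_{\sigma,k}|$ (possibly infinite), and $$A=\Big(C_{\mathfrak g}(\mathfrak h^\sigma)\cap\sum_{\mu\in R\setminus\{0\},\ \pi(\mu)=0}\pi_k(\mathfrak g_\mu)\Big)\otimes t^k .$$ Let $X=Y\pmod A$ mean $X+A=Y+A$. For every integer $k\ne0$ the following hold. (1) If $\alpha\in R$ and $r+s=k$ with $\pi(\alpha)+r\delta,\ -\pi(\alpha)+s\delta\in\tilde R^\times$, then $$[\tilde{\mathfrak g}_{\pi(\alpha)+r\delta},\tilde{\mathfrak g}_{-\pi(\alpha)+s\delta}]=\sum_{\beta\in R_\pi^\times,\ \pi(\beta)=\pi(\alpha)}\mathbb C\,\pi_k(t_\beta)\otimes t^k\pmod A .$$ (2) If $\pi$ separates the orbits, then for $\alpha,r,s$ as in (1) $$[\tilde{\mathfrak g}_{\pi(\alpha)+r\delta},\tilde{\mathfrak g}_{-\pi(\alpha)+s\delta}]=\mathbb C\,\pi_k(t_\alpha)\otimes t^k\pmod A,$$ and $$\tilde{\mathfrak g}_{k\delta}\cap\tilde{\mathfrak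 g}_c=\sum_{\alpha\in\mathcal O_\sigma}\mathbb C\,t_{\pi_k(\alpha)}\otimes t^k\pmod A .$$ (3) If $m$ is prime, then $A=\{0\}$ and $$\dim(\tilde{\mathfrak g}_{k\delta}\cap\tilde{\mathfrak g}_c)=\dim\sum_{\alpha\in\mathcal O_{\sigma,k}}\mathbb C\,\pi_k(\alpha)\le\min\big(\dim\pi_k(\mathfrak h_c),\tfrac12 n_{\sigma,k}\big).$$ -/

import Mathlib

open scoped TensorProduct

noncomputable section

namespace ExtAff

/-! ### Roots, root spaces and the core of a Lie algebra with a form and a chosen subalgebra -/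

section Generic

variable {L : Type*} [LieRing L] [LieAlgebra ℂ L]

/-- The root space `L_α = {x | [h, x] = α(h) x for all h ∈ H}`. -/
def rootSpace (H : LieSubalgebra ℂ L) (α : Module.Dual ℂ H) : Submodule ℂ L where
  carrier := {x | ∀ h : H, ⁅(h : L), x⁆ = α h • x}
  zero_mem' := by intro h; simp
  add_mem' := by
    intro a b ha hb h
    rw [lie_add, ha h, hb h, smul_add]
  smul_mem' := by
    intro c x hx h
    rw [lie_smul, hx h, smul_comm]

/-- The set of roots `R = {α ∈ H* | L_α ≠ 0}`; it contains `0` when `L_0 ≠ 0`. -/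
def roots (H : LieSubalgebra ℂ L) : Set (Module.Dual ℂ H) := {α | rootSpace H α ≠ ⊥}

/-- The element `t_α ∈ H` with `α(h) = (h, t_α)` for all `h ∈ H`. It exists and is unique as soon
as `H` is finite dimensional and the form is non-degenerate on `H`. -/
def dualVec (B : LinearMap.BilinForm ℂ L) (H : LieSubalgebra ℂ L) (α : Module.Dual ℂ H) : H :=
  Classical.epsilon fun t : H => ∀ h : H, α h = B (h : L) (t : L)

/-- The transferred form `(α, β) = (t_α, t_β)` on `H*`. -/
def dualForm (B : LinearMap.BilinForm ℂ L) (H : LieSubalgebra ℂ L) (α β : Module.Dual ℂ H) : ℂ :=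
  B (dualVec B H α : L) (dualVec B H β : L)

/-- The non-isotropic roots `R^×`. -/
def nonisoRoots (B : LinearMap.BilinForm ℂ L) (H : LieSubalgebra ℂ L) :
    Set (Module.Dual ℂ H) := {α | α ∈ roots H ∧ dualForm B H α α ≠ 0}

/-- The isotropic roots `R^0`. -/
def isoRoots (B : LinearMap.BilinForm ℂ L) (H : LieSubalgebra ℂ L) :
    Set (Module.Dual ℂ H) := {α | α ∈ roots H ∧ dualForm B H α α = 0}

/-- The core: the subalgebra generated by the non-isotropic root spaces. -/
def core (B : LinearMap.BilinForm ℂ L) (H : LieSubalgebra ℂ L) : LieSubalgebra ℂ L :=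
  LieSubalgebra.lieSpan ℂ L {x | ∃ α ∈ nonisoRoots B H, x ∈ rootSpace H α}

/-- The subspace `[X, Y]` spanned by all brackets of elements of `X` and `Y`. -/
def bracketSpan (X Y : Submodule ℂ L) : Submodule ℂ L :=
  Submodule.span ℂ {z | ∃ x ∈ X, ∃ y ∈ Y, ⁅x, y⁆ = z}

/-- `(L, (·,·), H)` is an extended affine Lie algebra. -/
structure IsExtendedAffine (B : LinearMap.BilinForm ℂ L) (H : LieSubalgebra ℂ L) : Prop where
  symm : ∀ x y, B x y = B y x
  nondegenerate : ∀ x, (∀ y, B x y = 0) → x = 0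
  invariant : ∀ x y z, B ⁅x, y⁆ z = B x ⁅y, z⁆
  finite : Module.Finite ℂ H
  splitting : ⨆ α : Module.Dual ℂ H, rootSpace H α = ⊤
  rootSpace_zero : rootSpace H 0 = H.toSubmodule
  locally_nilpotent : ∀ α ∈ nonisoRoots B H, ∀ x ∈ rootSpace H α, ∀ y : L,
    ∃ n : ℕ, ((LieAlgebra.ad ℂ L x) ^ n) y = 0
  /-- `R` is discrete in `H*`; the natural topology of the finite dimensional space `H*` is that of
  pointwise convergence of functions `H → ℂ`. -/
  discrete : DiscreteTopology ((fun (α : Module.Dual ℂ H) (h : H) => α h) '' roots H)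
  connected : ¬ ∃ T₁ T₂ : Set (Module.Dual ℂ H), T₁.Nonempty ∧ T₂.Nonempty ∧
    nonisoRoots B H = T₁ ∪ T₂ ∧ ∀ α ∈ T₁, ∀ β ∈ T₂, dualForm B H α β = 0
  nonisolated : ∀ δ ∈ isoRoots B H, ∃ α ∈ nonisoRoots B H, α + δ ∈ roots H

/-- For an endomorphism `T` with `T ^ m = 1` and a primitive `m`-th root of unity `ω`, the
projection `π_j = (1/m) ∑_{i=0}^{m-1} ω^{-ij} T^i` onto the `ω^j`-eigenspace of `T`. -/
def cyclicProj {V : Type*} [AddCommGroup V] [Module ℂ V] (m : ℕ) (ω : ℂ) (T : Module.End ℂ V)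
    (j : ℤ) : Module.End ℂ V :=
  (m : ℂ)⁻¹ • ∑ i ∈ Finset.range m, ω ^ (-((i : ℤ) * j)) • T ^ i

end Generic

variable {𝔤 : Type*} [LieRing 𝔤] [LieAlgebra ℂ 𝔤]

/-! ### The loop algebra `𝔤 ⊗ ℂ[t, t⁻¹]` -/

/-- The loop algebra `𝔤 ⊗ ℂ[t, t⁻¹]`. -/
def Loop (𝔤 : Type*) [LieRing 𝔤] [LieAlgebra ℂ 𝔤] := LieAlgebra.loopAlgebra ℂ ℤ 𝔤

instance : LieRing (Loop 𝔤) := inferInstanceAs (LieRing (LieAlgebra.loopAlgebra ℂ ℤ 𝔤))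

instance : LieAlgebra ℂ (Loop 𝔤) :=
  inferInstanceAs (LieAlgebra ℂ (LieAlgebra.loopAlgebra ℂ ℤ 𝔤))

/-- The element `∑ x_n ⊗ t^n` of the loop algebra corresponds to the family of its
coefficients `x_n`. -/
def loopEquiv : Loop 𝔤 ≃ₗ[ℂ] (ℤ →₀ 𝔤) := LieAlgebra.LoopAlgebra.toFinsupp ℂ ℤ 𝔤

/-- The element `x ⊗ t^n` of the loop algebra. -/
def mono (n : ℤ) : 𝔤 →ₗ[ℂ] Loop 𝔤 :=
  TensorProduct.mk ℂ (AddMonoidAlgebra ℂ ℤ) 𝔤 (AddMonoidAlgebra.single n 1)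

theorem loopEquiv_mono (n : ℤ) (x : 𝔤) : loopEquiv (mono n x) = Finsupp.single n x :=
  LieAlgebra.LoopAlgebra.toFinsupp_single_tmul ℂ ℤ 𝔤 n x

theorem lie_mono (n k : ℤ) (x y : 𝔤) : ⁅mono n x, mono k y⁆ = mono (n + k) ⁅x, y⁆ := by
  have h : (⁅(AddMonoidAlgebra.single n 1 ⊗ₜ[ℂ] x : LieAlgebra.loopAlgebra ℂ ℤ 𝔤),
      (AddMonoidAlgebra.single k 1 ⊗ₜ[ℂ] y : LieAlgebra.loopAlgebra ℂ ℤ 𝔤)⁆) =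
      AddMonoidAlgebra.single (n + k) 1 ⊗ₜ[ℂ] ⁅x, y⁆ := by
    rw [LieAlgebra.ExtendScalars.bracket_tmul, AddMonoidAlgebra.single_mul_single, mul_one]
  exact h

/-- The coefficient of `t^n` of an element of the loop algebra. -/
def coeff (n : ℤ) : Loop 𝔤 →ₗ[ℂ] 𝔤 := Finsupp.lapply n ∘ₗ loopEquiv.toLinearMap

theorem coeff_mono (n k : ℤ) (x : 𝔤) : coeff k (mono n x) = if n = k then x else 0 := by
  simp [coeff, loopEquiv_mono, Finsupp.single_apply]

theorem loop_induction {P : Loop 𝔤 → Prop}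
    (h0 : P 0) (hm : ∀ n x, P (mono n x)) (ha : ∀ f g, P f → P g → P (f + g)) (f) : P f := by
  obtain ⟨F, rfl⟩ := loopEquiv.symm.surjective f
  induction F using Finsupp.induction_linear with
  | zero => simpa using h0
  | add f g hf hg => rw [map_add]; exact ha _ _ hf hg
  | single n x => rw [← loopEquiv_mono, LinearEquiv.symm_apply_apply]; exact hm n x

/-- The degree derivation `x ⊗ t^n ↦ n x ⊗ t^n` of the loop algebra. -/
def degree : Module.End ℂ (Loop 𝔤) :=
  (Finsupp.lsum ℂ fun n : ℤ => (n : ℂ) • mono n) ∘ₗ loopEquiv.toLinearMap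

theorem degree_mono (n : ℤ) (x : 𝔤) : degree (mono n x) = (n : ℂ) • mono n x := by
  simp [degree, loopEquiv_mono]

theorem degree_lie (f g : Loop 𝔤) :
    degree ⁅f, g⁆ = ⁅degree f, g⁆ + ⁅f, degree g⁆ := by
  induction f using loop_induction with
  | h0 => simp
  | ha f f' hf hf' => simp only [add_lie, map_add, hf, hf']; abel
  | hm n x =>
    induction g using loop_induction with
    | h0 => simp
    | ha f f' hf hf' => simp only [lie_add, map_add, hf, hf']; abel
    | hm k y =>
      simp only [lie_mono, degree_mono, smul_lie, lie_smul]
      push_cast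
      rw [add_smul]

/-- The form `(x ⊗ t^n, y ⊗ t^k) = (x, y) δ_{n+k,0}` on the loop algebra. -/
def loopForm (B : LinearMap.BilinForm ℂ 𝔤) :
    LinearMap.BilinForm ℂ (Loop 𝔤) :=
  (Finsupp.lsum ℂ fun n : ℤ => LinearMap.compl₂ B (coeff (-n))) ∘ₗ loopEquiv.toLinearMap

theorem loopForm_mono (B : LinearMap.BilinForm ℂ 𝔤) (n k : ℤ) (x y : 𝔤) :
    loopForm B (mono n x) (mono k y) = if n + k = 0 then B x y else 0 := by
  have h1 : loopForm B (mono n x) (mono k y) = B x (coeff (-n) (mono k y)) := by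
    simp [loopForm, loopEquiv_mono]
  rw [h1, coeff_mono]
  by_cases h : n + k = 0
  · rw [if_pos h, if_pos (by omega)]
  · rw [if_neg h, if_neg (by omega), map_zero]

theorem loopForm_symm (B : LinearMap.BilinForm ℂ 𝔤) (hB : ∀ x y, B x y = B y x)
    (f g : Loop 𝔤) : loopForm B f g = loopForm B g f := by
  induction f using loop_induction with
  | h0 => simp
  | ha f f' hf hf' => simp only [map_add, LinearMap.add_apply, hf, hf']
  | hm n x =>
    induction g using loop_induction with
    | h0 => simp
    | ha f f' hf hf' => simp only [map_add, LinearMap.add_apply, hf, hf']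
    | hm k y => rw [loopForm_mono, loopForm_mono, hB, add_comm]

theorem loopForm_invariant (B : LinearMap.BilinForm ℂ 𝔤)
    (hB : ∀ x y z, B ⁅x, y⁆ z = B x ⁅y, z⁆) (f g l : Loop 𝔤) :
    loopForm B ⁅f, g⁆ l = loopForm B f ⁅g, l⁆ := by
  induction f using loop_induction with
  | h0 => simp
  | ha f f' hf hf' => simp only [map_add, add_lie, LinearMap.add_apply, hf, hf']
  | hm n x =>
    induction g using loop_induction with
    | h0 => simp
    | ha f f' hf hf' => simp only [map_add, add_lie, lie_add, LinearMap.add_apply, hf, hf']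
    | hm k y =>
      induction l using loop_induction with
      | h0 => simp
      | ha f f' hf hf' => simp only [map_add, lie_add, hf, hf']
      | hm j z => rw [lie_mono, lie_mono, loopForm_mono, loopForm_mono, hB, add_assoc]

theorem loopForm_degree (B : LinearMap.BilinForm ℂ 𝔤) (f g : Loop 𝔤) :
    loopForm B (degree f) g = - loopForm B f (degree g) := by
  induction f using loop_induction with
  | h0 => simp
  | ha f f' hf hf' => simp only [map_add, LinearMap.add_apply, hf, hf']; ring
  | hm n x =>
    induction g using loop_induction with
    | h0 => simp
    | ha f f' hf hf' => simp only [map_add, hf, hf']; ring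
    | hm k y =>
      simp only [degree_mono, map_smul, LinearMap.smul_apply, loopForm_mono, smul_eq_mul]
      by_cases h : n + k = 0
      · have : (n : ℂ) = -k := by exact_mod_cast (eq_neg_of_add_eq_zero_left h)
        rw [if_pos h, this]; ring
      · simp [h]

theorem jacobi_loop {M : Type*} [LieRing M] [LieAlgebra ℂ M] (D : Module.End ℂ M)
    (hD : ∀ f g, D ⁅f, g⁆ = ⁅D f, g⁆ + ⁅f, D g⁆) (x y z : M) (a b c : ℂ) :
    ⁅x, ⁅y, z⁆ + b • D z - c • D y⁆ + a • D (⁅y, z⁆ + b • D z - c • D y) - (0 : ℂ) • D x =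
      (⁅⁅x, y⁆ + a • D y - b • D x, z⁆ + (0 : ℂ) • D z - c • D (⁅x, y⁆ + a • D y - b • D x)) +
      (⁅y, ⁅x, z⁆ + a • D z - c • D x⁆ + b • D (⁅x, z⁆ + a • D z - c • D x) - (0 : ℂ) • D y) := by
  simp only [map_add, map_sub, map_smul, hD, lie_add, lie_sub, add_lie, sub_lie, lie_smul,
    smul_lie, smul_add, smul_sub, zero_smul, leibniz_lie x y z]
  rw [← lie_skew (D x) y, smul_comm b a, smul_comm c a, smul_comm c b]
  simp only [smul_neg]
  abel

theorem jacobi_central {M : Type*} [LieRing M] [LieAlgebra ℂ M] (D : Module.End ℂ M)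
    (hD : ∀ f g, D ⁅f, g⁆ = ⁅D f, g⁆ + ⁅f, D g⁆) (F : LinearMap.BilinForm ℂ M)
    (hs : ∀ f g, F f g = F g f) (hi : ∀ f g h, F ⁅f, g⁆ h = F f ⁅g, h⁆)
    (hd : ∀ f g, F (D f) g = - F f (D g)) (x y z : M) (a b c : ℂ) :
    F (D x) (⁅y, z⁆ + b • D z - c • D y) =
      F (D (⁅x, y⁆ + a • D y - b • D x)) z + F (D y) (⁅x, z⁆ + a • D z - c • D x) := by
  have e2 : F ⁅x, D y⁆ z = - F (D y) ⁅x, z⁆ := by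
    rw [← lie_skew, map_neg, LinearMap.neg_apply, hi]
  simp only [map_add, map_sub, map_smul, hD, LinearMap.add_apply, LinearMap.sub_apply,
    LinearMap.smul_apply, smul_eq_mul, hi (D x) y z, e2, hd (D x) z, hd (D y) z, hs (D y) (D x)]
  ring

end ExtAff

open ExtAff

/-- An extended affine Lie algebra structure `(𝔤, (·,·), 𝔥)` on a complex Lie algebra `𝔤`. -/
structure EALA (𝔤 : Type*) [LieRing 𝔤] [LieAlgebra ℂ 𝔤] where
  form : LinearMap.BilinForm ℂ 𝔤
  cartan : LieSubalgebra ℂ 𝔤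
  isExtendedAffine : IsExtendedAffine form cartan

namespace EALA

variable {𝔤 : Type*} [LieRing 𝔤] [LieAlgebra ℂ 𝔤]

/-! ### The Lie algebra `(𝔤 ⊗ ℂ[t, t⁻¹]) ⊕ ℂc ⊕ ℂd` -/

/-- The space `(𝔤 ⊗ ℂ[t, t⁻¹]) ⊕ ℂc ⊕ ℂd`; the fields `c` and `d` are the coefficients of the
symbols `c` and `d`. -/
@[ext] structure Full (E : EALA 𝔤) where
  loop : Loop 𝔤
  c : ℂ
  d : ℂ

namespace Full

variable {E : EALA 𝔤}

/-- The underlying product. -/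
def equivProd : E.Full ≃ Loop 𝔤 × ℂ × ℂ where
  toFun X := (X.loop, X.c, X.d)
  invFun p := ⟨p.1, p.2.1, p.2.2⟩
  left_inv _ := rfl
  right_inv _ := rfl

instance : AddCommGroup E.Full := equivProd.addCommGroup

instance : Module ℂ E.Full := equivProd.module ℂ

@[simp] theorem zero_loop : (0 : E.Full).loop = 0 := rfl
@[simp] theorem zero_c : (0 : E.Full).c = 0 := rfl
@[simp] theorem zero_d : (0 : E.Full).d = 0 := rfl
@[simp] theorem add_loop (X Y : E.Full) : (X + Y).loop = X.loop + Y.loop := rfl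
@[simp] theorem add_c (X Y : E.Full) : (X + Y).c = X.c + Y.c := rfl
@[simp] theorem add_d (X Y : E.Full) : (X + Y).d = X.d + Y.d := rfl
@[simp] theorem smul_loop (a : ℂ) (X : E.Full) : (a • X).loop = a • X.loop := rfl
@[simp] theorem smul_c (a : ℂ) (X : E.Full) : (a • X).c = a * X.c := rfl
@[simp] theorem smul_d (a : ℂ) (X : E.Full) : (a • X).d = a * X.d := rfl

/-- The bracket
`[x⊗t^n + rc + sd, y⊗t^k + r'c + s'd]
  = [x,y]⊗t^(n+k) + n δ_{n+k,0} (x,y) c + s k y⊗t^k - s' n x⊗t^n`. -/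
instance : Bracket E.Full E.Full where
  bracket X Y :=
    { loop := ⁅X.loop, Y.loop⁆ + X.d • degree Y.loop - Y.d • degree X.loop
      c := loopForm E.form (degree X.loop) Y.loop
      d := 0 }

@[simp] theorem lie_loop (X Y : E.Full) : ⁅X, Y⁆.loop =
    ⁅X.loop, Y.loop⁆ + X.d • degree Y.loop - Y.d • degree X.loop := rfl
@[simp] theorem lie_c (X Y : E.Full) : ⁅X, Y⁆.c = loopForm E.form (degree X.loop) Y.loop := rfl
@[simp] theorem lie_d (X Y : E.Full) : ⁅X, Y⁆.d = 0 := rfl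

instance : LieRing E.Full where
  add_lie X Y Z := by
    ext1
    · simp only [lie_loop, add_loop, add_d, add_lie, add_smul, map_add, smul_add]; abel
    · simp
    · simp
  lie_add X Y Z := by
    ext1
    · simp only [lie_loop, add_loop, add_d, lie_add, add_smul, map_add, smul_add]; abel
    · simp
    · simp
  lie_self X := by
    ext1
    · simp
    · have h := loopForm_degree E.form X.loop X.loop
      rw [loopForm_symm E.form E.isExtendedAffine.symm X.loop (degree X.loop)] at h
      rw [lie_c, zero_c]
      linear_combination h / 2
    · simp
  leibniz_lie X Y Z := by
    ext1
    · exact jacobi_loop degree degree_lie X.loop Y.loop Z.loop X.d Y.d Z.d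
    · exact jacobi_central degree degree_lie (loopForm E.form)
        (loopForm_symm E.form E.isExtendedAffine.symm)
        (loopForm_invariant E.form E.isExtendedAffine.invariant) (loopForm_degree E.form)
        X.loop Y.loop Z.loop X.d Y.d Z.d
    · simp

instance : LieAlgebra ℂ E.Full where
  lie_smul a X Y := by
    ext1
    · simp only [lie_loop, smul_loop, smul_d, lie_smul, map_smul, smul_sub, smul_add, mul_smul,
        smul_comm X.d a]
    · simp
    · simp

/-- The element `x ⊗ t^k`. -/
def tens (E : EALA 𝔤) (k : ℤ) : 𝔤 →ₗ[ℂ] E.Full where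
  toFun x := ⟨mono k x, 0, 0⟩
  map_add' x y := by ext1 <;> simp
  map_smul' a x := by ext1 <;> simp

/-- The form `(x⊗t^n + rc + sd, y⊗t^k + r'c + s'd) = (x,y) δ_{n+k,0} + r s' + r' s`. -/
def form (E : EALA 𝔤) : LinearMap.BilinForm ℂ E.Full :=
  LinearMap.mk₂ ℂ (fun X Y => loopForm E.form X.loop Y.loop + X.c * Y.d + Y.c * X.d)
    (by intro X Y Z; simp only [add_loop, add_c, add_d, map_add, LinearMap.add_apply]; ring)
    (by intro a X Y
        simp only [smul_loop, smul_c, smul_d, map_smul, LinearMap.smul_apply, smul_eq_mul]; ring)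
    (by intro X Y Z; simp only [add_loop, add_c, add_d, map_add]; ring)
    (by intro a X Y; simp only [smul_loop, smul_c, smul_d, map_smul, smul_eq_mul]; ring)

end Full

/-! ### Automorphisms of finite order and the affinization -/

/-- An automorphism `σ` of `𝔤` with `σ^m = id` that stabilizes `𝔥` and the form and satisfies
`C_{𝔤^σ}(𝔥^σ) = 𝔥^σ`, together with a primitive `m`-th root of unity `ω`. -/
structure Twist (E : EALA 𝔤) (m : ℕ) (ω : ℂ) where
  pos : 0 < m
  primitive : IsPrimitiveRoot ω m
  σ : 𝔤 ≃ₗ⁅ℂ⁆ 𝔤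
  iterate_eq : ∀ x, σ^[m] x = x
  map_cartan : E.cartan.toSubmodule.map (σ.toLinearEquiv : 𝔤 →ₗ[ℂ] 𝔤) = E.cartan.toSubmodule
  form_eq : ∀ x y, E.form (σ x) (σ y) = E.form x y
  centralizer_eq : {x : 𝔤 | σ x = x ∧ ∀ h ∈ E.cartan, σ h = h → ⁅h, x⁆ = 0} =
    {x : 𝔤 | x ∈ E.cartan ∧ σ x = x}

namespace Twist

variable {E : EALA 𝔤} {m : ℕ} {ω : ℂ}

/-- `σ` as a linear endomorphism of `𝔤`. -/
def sigma (τ : E.Twist m ω) : Module.End ℂ 𝔤 := (τ.σ.toLinearEquiv : 𝔤 →ₗ[ℂ] 𝔤)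

/-- The restriction of `σ` to `𝔥`. -/
def cartanEquiv (τ : E.Twist m ω) : E.cartan.toSubmodule ≃ₗ[ℂ] E.cartan.toSubmodule :=
  τ.σ.toLinearEquiv.ofSubmodules E.cartan.toSubmodule E.cartan.toSubmodule τ.map_cartan

/-- The action `σ(α) = α ∘ σ⁻¹` of `σ` on `𝔥*`. -/
def dualSigma (τ : E.Twist m ω) : Module.End ℂ (Module.Dual ℂ E.cartan) where
  toFun α := α ∘ₗ (τ.cartanEquiv.symm : E.cartan.toSubmodule →ₗ[ℂ] E.cartan.toSubmodule)
  map_add' _ _ := rfl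
  map_smul' _ _ := rfl

/-- The projection `π_j : 𝔤 → 𝔤^j`; it restricts to the projections of `𝔥` and of `𝔥_c`. -/
def proj (τ : E.Twist m ω) (j : ℤ) : Module.End ℂ 𝔤 := cyclicProj m ω τ.sigma j

/-- The projection `π_j : 𝔥* → (𝔥*)^j`. -/
def dualProj (τ : E.Twist m ω) (j : ℤ) : Module.End ℂ (Module.Dual ℂ E.cartan) :=
  cyclicProj m ω τ.dualSigma j

/-- The twisted loop algebra `∑_i 𝔤^i ⊗ t^i`, where `𝔤^i = {x | σ(x) = ω^i x}`. -/
def twistedLoop (τ : E.Twist m ω) : LieSubalgebra ℂ (Loop 𝔤) where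
  toSubmodule := Submodule.span ℂ {f | ∃ (i : ℤ) (x : 𝔤), τ.σ x = ω ^ i • x ∧ f = mono i x}
  lie_mem' := by
    intro f g hf hg
    change f ∈ Submodule.span ℂ _ at hf
    change g ∈ Submodule.span ℂ _ at hg
    change ⁅f, g⁆ ∈ Submodule.span ℂ _
    induction hf using Submodule.span_induction with
    | zero => simp
    | add f f' _ _ h h' => rw [add_lie]; exact add_mem h h'
    | smul a f _ h => rw [smul_lie]; exact Submodule.smul_mem _ a h
    | mem f hf =>
      obtain ⟨i, x, hx, rfl⟩ := hf
      induction hg using Submodule.span_induction with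
      | zero => simp
      | add f f' _ _ h h' => rw [lie_add]; exact add_mem h h'
      | smul a f _ h => rw [lie_smul]; exact Submodule.smul_mem _ a h
      | mem g hg =>
        obtain ⟨j, y, hy, rfl⟩ := hg
        refine Submodule.subset_span ⟨i + j, ⁅x, y⁆, ?_, lie_mono _ _ _ _⟩
        have h0 : ω ≠ 0 := τ.primitive.ne_zero τ.pos.ne'
        rw [LieEquiv.map_lie, hx, hy, zpow_add₀ h0, smul_lie, lie_smul, smul_smul]

theorem degree_mem_twistedLoop (τ : E.Twist m ω) {f : Loop 𝔤}
    (hf : f ∈ τ.twistedLoop) : degree f ∈ τ.twistedLoop := by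
  change f ∈ Submodule.span ℂ _ at hf
  induction hf using Submodule.span_induction with
  | zero => simp
  | add f f' _ _ h h' => rw [map_add]; exact add_mem h h'
  | smul a f _ h => rw [map_smul]; exact Submodule.smul_mem τ.twistedLoop.toSubmodule a h
  | mem f hf =>
    obtain ⟨i, x, hx, rfl⟩ := hf
    rw [degree_mono]
    exact Submodule.smul_mem τ.twistedLoop.toSubmodule _ (Submodule.subset_span ⟨i, x, hx, rfl⟩)

/-- The affinization `Aff(𝔤, σ) = ∑_i (𝔤^i ⊗ t^i) ⊕ ℂc ⊕ ℂd`. -/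
def aff (τ : E.Twist m ω) : LieSubalgebra ℂ E.Full where
  carrier := {X | X.loop ∈ τ.twistedLoop}
  zero_mem' := by simp
  add_mem' := by
    intro X Y hX hY
    exact τ.twistedLoop.toSubmodule.add_mem hX hY
  smul_mem' := by intro a X hX; exact Submodule.smul_mem τ.twistedLoop.toSubmodule a hX
  lie_mem' := by
    intro X Y hX hY
    exact sub_mem (add_mem (τ.twistedLoop.lie_mem hX hY)
      (Submodule.smul_mem τ.twistedLoop.toSubmodule _ (τ.degree_mem_twistedLoop hY)))
      (Submodule.smul_mem τ.twistedLoop.toSubmodule _ (τ.degree_mem_twistedLoop hX))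

/-- The form of `Aff(𝔤, σ)`. -/
def affForm (τ : E.Twist m ω) : LinearMap.BilinForm ℂ τ.aff :=
  (Full.form E).restrict τ.aff.toSubmodule

/-- The subalgebra `𝔥^σ ⊕ ℂc ⊕ ℂd` of `Aff(𝔤, σ)`, where `h ∈ 𝔥^σ` is identified with `h ⊗ 1`. -/
def affCartan (τ : E.Twist m ω) : LieSubalgebra ℂ τ.aff where
  carrier := {X | ∃ h ∈ E.cartan, τ.σ h = h ∧ (X : E.Full).loop = mono 0 h}
  zero_mem' := ⟨0, zero_mem _, map_zero _, by simp⟩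
  add_mem' := by
    rintro X Y ⟨h, hh, hs, hX⟩ ⟨h', hh', hs', hY⟩
    exact ⟨h + h', add_mem hh hh', by rw [map_add, hs, hs'], by simp [hX, hY]⟩
  smul_mem' := by
    rintro a X ⟨h, hh, hs, hX⟩
    exact ⟨a • h, Submodule.smul_mem E.cartan.toSubmodule a hh, by rw [map_smul, hs],
      by simp [hX]⟩
  lie_mem' := by
    rintro X Y ⟨h, hh, hs, hX⟩ ⟨h', hh', hs', hY⟩
    refine ⟨⁅h, h'⁆, E.cartan.lie_mem hh hh', by rw [LieEquiv.map_lie, hs, hs'], ?_⟩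
    simp [hX, hY, lie_mono, degree_mono]

theorem coeff_mem_cartan (τ : E.Twist m ω) (X : τ.affCartan) :
    coeff 0 ((X : τ.aff) : E.Full).loop ∈ E.cartan := by
  obtain ⟨h, hh, -, hX⟩ := X.2
  rw [hX, coeff_mono, if_pos rfl]
  exact hh

/-- For `a ∈ 𝔥*` and `r ∈ ℤ`, the functional `h + xc + yd ↦ a(h) + r y` on `𝔥^σ ⊕ ℂc ⊕ ℂd`, that
is, `a + rδ` where `δ` is the functional with `δ(𝔥^σ) = 0`, `δ(c) = 0`, `δ(d) = 1`. -/
def affWeight (τ : E.Twist m ω) (a : Module.Dual ℂ E.cartan) (r : ℤ) :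
    Module.Dual ℂ τ.affCartan where
  toFun X := a ⟨coeff 0 ((X : τ.aff) : E.Full).loop, τ.coeff_mem_cartan X⟩ +
    (r : ℂ) * ((X : τ.aff) : E.Full).d
  map_add' X Y := by
    have : (⟨coeff 0 (((X + Y : τ.affCartan) : τ.aff) : E.Full).loop,
        τ.coeff_mem_cartan (X + Y)⟩ : E.cartan) =
        ⟨coeff 0 ((X : τ.aff) : E.Full).loop, τ.coeff_mem_cartan X⟩ +
        ⟨coeff 0 ((Y : τ.aff) : E.Full).loop, τ.coeff_mem_cartan Y⟩ := by
      ext; simp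
    have hd : (((X + Y : τ.affCartan) : τ.aff) : E.Full).d =
        ((X : τ.aff) : E.Full).d + ((Y : τ.aff) : E.Full).d := rfl
    rw [this, map_add, hd]
    ring
  map_smul' z X := by
    have : (⟨coeff 0 (((z • X : τ.affCartan) : τ.aff) : E.Full).loop,
        τ.coeff_mem_cartan (z • X)⟩ : E.cartan) =
        z • ⟨coeff 0 ((X : τ.aff) : E.Full).loop, τ.coeff_mem_cartan X⟩ := by
      ext; simp
    have hd : (((z • X : τ.affCartan) : τ.aff) : E.Full).d =
        z * ((X : τ.aff) : E.Full).d := rfl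
    rw [this, map_smul, hd, smul_eq_mul, smul_eq_mul, RingHom.id_apply]
    ring

/-- The root space of `Aff(𝔤, σ)` for `a + rδ`. -/
def affRootSpace (τ : E.Twist m ω) (a : Module.Dual ℂ E.cartan) (r : ℤ) : Submodule ℂ τ.aff :=
  rootSpace τ.affCartan (τ.affWeight a r)

/-- `R_π^×`: the non-isotropic roots `α` of `𝔤` with `(π(α), π(α)) ≠ 0`. -/
def piRoots (τ : E.Twist m ω) : Set (Module.Dual ℂ E.cartan) :=
  {α | α ∈ nonisoRoots E.form E.cartan ∧
    dualForm E.form E.cartan (τ.dualProj 0 α) (τ.dualProj 0 α) ≠ 0}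

/-- `α` and `β` lie in the same orbit of the (finite) cyclic group generated by `σ`. -/
def SameOrbit (τ : E.Twist m ω) (α β : Module.Dual ℂ E.cartan) : Prop :=
  ∃ i : ℕ, (τ.dualSigma ^ i) α = β

/-- `π` separates the `⟨σ⟩`-orbits on `R_π^×`. -/
def SeparatesOrbits (τ : E.Twist m ω) : Prop :=
  ∀ α ∈ τ.piRoots, ∀ β ∈ τ.piRoots, τ.dualProj 0 α = τ.dualProj 0 β → τ.SameOrbit α β

/-- `O` is a complete set of representatives of the `⟨σ⟩`-orbits on `R_π^×`. -/
def IsOrbitReps (τ : E.Twist m ω) (O : Set (Module.Dual ℂ E.cartan)) : Prop :=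
  O ⊆ τ.piRoots ∧ ∀ α ∈ τ.piRoots, ∃! β, β ∈ O ∧ τ.SameOrbit α β

/-- The centralizer `C_𝔤(𝔥^σ)`. -/
def centralizer (τ : E.Twist m ω) : Submodule ℂ 𝔤 where
  carrier := {x | ∀ h ∈ E.cartan, τ.σ h = h → ⁅h, x⁆ = 0}
  zero_mem' := by intro h _ _; simp
  add_mem' := by intro x y hx hy h hh hs; rw [lie_add, hx h hh hs, hy h hh hs, add_zero]
  smul_mem' := by intro a x hx h hh hs; rw [lie_smul, hx h hh hs, smul_zero]

/-- The subspace `A = (C_𝔤(𝔥^σ) ∩ ∑_{μ ∈ R \ {0}, π(μ) = 0} π_k(𝔤_μ)) ⊗ t^k`. -/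
def errorSpace (τ : E.Twist m ω) (k : ℤ) : Submodule ℂ E.Full :=
  (τ.centralizer ⊓ ⨆ μ ∈ {μ | μ ∈ roots E.cartan ∧ μ ≠ 0 ∧ τ.dualProj 0 μ = 0},
    (rootSpace E.cartan μ).map (τ.proj k)).map (Full.tens E k)

end Twist

end EALA

end

open ExtAff

noncomputable section

namespace ExtAff

section Generic

variable {L : Type*} [LieRing L] [LieAlgebra ℂ L]

/-! ### Root spaces -/

/-! The root space of `Aff(𝔤, σ)` for `π(α) + rδ`, with `α ∈ R_π^×`, is `t^r` tensored with a
simultaneous eigenspace `eigWeight` of `𝔥^σ` and `σ` in `𝔤`. Let `x ∈ 𝔤_β` and let `y` be an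
eigenvector of weight `-π(β)` and degree `s = k - r`. Then `[π_r x, y] = π_k [x, y]`; the
`𝔥`-component of `[x, y]` is `(x, y) t_β`, and its other components lie in root spaces `𝔤_μ` with `μ
≠ 0`, `π(μ) = 0`. So modulo `A` the bracket is `(x, y) π_k(t_β) ⊗ t^k` (`lie_proj_sub_mem`), which
gives one inclusion of (1).

For the other inclusion, a given non-zero `y` must pair non-trivially with `𝔤_β` for every `β` over
`π(α)`. It does so with some `𝔤_γ` over `π(α)`, and `y` is an eigenvector of `σ`, so it does so with
every root space in the orbit of `γ`. What is needed is that `π` separates the orbits on `R_π^×`,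
and this is always true (`separatesOrbits`). Then (2) follows from `π_k(σ^i α) = ω^{ki} π_k(α)`.

Separation has two ingredients. First, up to a scalar the form is positive semidefinite on sums of
roots (`rform_multiset_nonneg`), so two orbits with the same projection contain `β'`, `γ'` with
`(β', γ') > 0`, and then `[𝔤_{γ'}, 𝔤_{-β'}] ≠ 0`. Second, if `γ' ≠ β'`, the root `γ' - β'` restricts
to `0` on `𝔥^σ`, and root vectors of such non-zero roots annihilate all weight vectors over `R_π^×`
(`lie_eq_zero_of_sameRestriction_zero`); invariance of the form makes these two facts incompatible.
The second ingredient holds because the centralizer of `𝔥^σ` acts on such a weight space through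
commuting operators: each `σ`-eigenspace is at most a line, the occupied degrees form a coset of a
subgroup of `ℤ`, and homogeneous elements of the centralizer act as zero or as scalar multiples of
powers of one shift.

For the core, an isotropic plus a non-isotropic root of the affinization is non-isotropic, so the
part of weight `kδ` is spanned by brackets of two opposite non-isotropic root spaces
(`core_le_iSup_corePart`). For prime `m`, a root `μ ≠ 0` with `π(μ) = 0` would have `m` distinct
conjugates, against `C_{𝔤^σ}(𝔥^σ) = 𝔥^σ`; hence `A = 0`. The factor `1/2` comes from pairing each
orbit with the orbit of its negatives. -/

theorem lie_mem_rootSpace {H : LieSubalgebra ℂ L} {α β : Module.Dual ℂ H} {x y : L}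
    (hx : x ∈ rootSpace H α) (hy : y ∈ rootSpace H β) : ⁅x, y⁆ ∈ rootSpace H (α + β) := by
  intro h
  rw [leibniz_lie, hx h, hy h, smul_lie, lie_smul, LinearMap.add_apply, add_smul]

theorem mem_roots_of_ne_zero {H : LieSubalgebra ℂ L} {α : Module.Dual ℂ H} {x : L}
    (hx : x ∈ rootSpace H α) (h0 : x ≠ 0) : α ∈ roots H := by
  intro h
  rw [h, Submodule.mem_bot] at hx
  exact h0 hx

theorem exists_ne_zero_of_mem_roots {H : LieSubalgebra ℂ L} {α : Module.Dual ℂ H}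
    (hα : α ∈ roots H) : ∃ x ∈ rootSpace H α, x ≠ 0 :=
  (Submodule.ne_bot_iff _).1 hα

/-- Bracketing the relation with `h` and subtracting `η h` times the relation removes the `η`-term.
The term at `ξ` acquires the factor `ξ h - η h`, non-zero for a suitable `h`. -/
theorem eq_zero_of_sum_rootSpace {H : LieSubalgebra ℂ L} (s : Finset (Module.Dual ℂ H))
    (v : Module.Dual ℂ H → L) (hv : ∀ ξ ∈ s, v ξ ∈ rootSpace H ξ) (h0 : ∑ ξ ∈ s, v ξ = 0) :
    ∀ ξ ∈ s, v ξ = 0 := by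
  classical
  induction s using Finset.induction_on generalizing v with
  | empty => simp
  | insert η s hη ih =>
    rw [Finset.sum_insert hη] at h0
    have key : ∀ ξ ∈ s, v ξ = 0 := by
      intro ξ hξ
      have hne : ξ ≠ η := fun h => hη (h ▸ hξ)
      obtain ⟨h, hh⟩ : ∃ h, ξ h ≠ η h := by
        by_contra hc
        push Not at hc
        exact hne (LinearMap.ext hc)
      have h1 : ∑ ξ ∈ s, (ξ h - η h) • v ξ = 0 := by
        have h2 : ⁅(h : L), v η + ∑ ξ ∈ s, v ξ⁆ = 0 := by rw [h0, lie_zero]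
        rw [lie_add, lie_sum, hv η (Finset.mem_insert_self _ _) h,
          Finset.sum_congr rfl fun ξ hξ => hv ξ (Finset.mem_insert_of_mem hξ) h] at h2
        have h3 : η h • (v η + ∑ ξ ∈ s, v ξ) = 0 := by rw [h0, smul_zero]
        rw [smul_add, Finset.smul_sum] at h3
        simp only [sub_smul, Finset.sum_sub_distrib]
        rw [sub_eq_zero]
        exact add_left_cancel (h2.trans h3.symm)
      have := ih (fun ξ => (ξ h - η h) • v ξ)
        (fun ξ hξ => Submodule.smul_mem _ _ (hv ξ (Finset.mem_insert_of_mem hξ))) h1 ξ hξ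
      exact (smul_eq_zero.1 this).resolve_left (sub_ne_zero.2 hh)
    intro ξ hξ
    rcases Finset.mem_insert.1 hξ with rfl | hξ
    · rwa [Finset.sum_eq_zero key, add_zero] at h0
    · exact key ξ hξ

/-- A vector of weight `η` in a sum of subspaces of root spaces lies in the summand of weight
`η`. -/
theorem mem_of_mem_iSup_of_mem_rootSpace {H : LieSubalgebra ℂ L}
    (W : Module.Dual ℂ H → Submodule ℂ L) (hW : ∀ ξ, W ξ ≤ rootSpace H ξ)
    {η : Module.Dual ℂ H} {x : L} (hx : x ∈ ⨆ ξ, W ξ) (hη : x ∈ rootSpace H η) : x ∈ W η := by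
  classical
  obtain ⟨f, hf, rfl⟩ := (Submodule.mem_iSup_iff_exists_finsupp W x).1 hx
  -- The relation is `∑ f ξ - x = 0` with `x` placed in weight `η`; inserting `η` covers the case `f
  -- η = 0`.
  have h := eq_zero_of_sum_rootSpace (insert η f.support)
    (fun ξ => f ξ - if ξ = η then f.sum (fun _ y => y) else 0) ?_ ?_ η (Finset.mem_insert_self _ _)
  · simp only [if_pos, sub_eq_zero] at h
    rw [← h]
    exact hf η
  · intro ξ _
    split_ifs with h
    · subst h; exact sub_mem (hW _ (hf _)) hη
    · rw [sub_zero]; exact hW _ (hf _)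
  · rw [Finset.sum_sub_distrib, Finset.sum_ite_eq' , if_pos (Finset.mem_insert_self _ _),
      sub_eq_zero, Finsupp.sum]
    symm
    apply Finset.sum_subset (Finset.subset_insert _ _)
    intro ξ _ hξ
    simpa using hξ

/-! ### Representations of `sl₂` inside a Lie algebra -/

theorem ad_pow_succ_apply (e v : L) (n : ℕ) :
    ((LieAlgebra.ad ℂ L e) ^ (n + 1)) v = ⁅e, ((LieAlgebra.ad ℂ L e) ^ n) v⁆ := by
  rw [pow_succ']; rfl

theorem ad_pow_mem_rootSpace {H : LieSubalgebra ℂ L} {α β : Module.Dual ℂ H} {x y : L}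
    (hx : x ∈ rootSpace H α) (hy : y ∈ rootSpace H β) (n : ℕ) :
    ((LieAlgebra.ad ℂ L x) ^ n) y ∈ rootSpace H (β + n • α) := by
  induction n with
  | zero => simpa using hy
  | succ n ih =>
    rw [ad_pow_succ_apply]
    have := lie_mem_rootSpace hx ih
    rwa [show α + (β + n • α) = β + (n + 1) • α by rw [succ_nsmul]; abel] at this

theorem exists_last_ad_pow {e v : L} (hv : v ≠ 0)
    (hn : ∃ n, ((LieAlgebra.ad ℂ L e) ^ n) v = 0) :
    ∃ p, ((LieAlgebra.ad ℂ L e) ^ p) v ≠ 0 ∧ ⁅e, ((LieAlgebra.ad ℂ L e) ^ p) v⁆ = 0 := by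
  classical
  have h0 : Nat.find hn ≠ 0 := by
    intro h
    have := Nat.find_spec hn
    rw [h] at this
    exact hv (by simpa using this)
  refine ⟨Nat.find hn - 1, Nat.find_min hn (by omega), ?_⟩
  rw [← ad_pow_succ_apply, Nat.sub_add_cancel (Nat.pos_of_ne_zero h0)]
  exact Nat.find_spec hn

theorem lie_h_ad_pow {h e f v : L} (t : IsSl2Triple h e f) {c : ℂ} (hv : ⁅h, v⁆ = c • v) (n : ℕ) :
    ⁅h, ((LieAlgebra.ad ℂ L e) ^ n) v⁆ = (c + 2 * n) • ((LieAlgebra.ad ℂ L e) ^ n) v := by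
  induction n with
  | zero => simpa using hv
  | succ n ih =>
    rw [ad_pow_succ_apply, leibniz_lie, ih, t.lie_h_e_smul ℂ, smul_lie, lie_smul, ← add_smul]
    congr 1
    push_cast
    ring

/-- The usual `sl₂` formula for a lowest weight vector. It needs only `[e, [f, v]] = 0`, because
`[f, v]` enters the induction solely through `[e, [f, v]]`. -/
theorem lie_f_ad_pow {h e f v : L} (t : IsSl2Triple h e f) {c : ℂ} (hv : ⁅h, v⁆ = c • v)
    (hf : ⁅e, ⁅f, v⁆⁆ = 0) (n : ℕ) :
    ⁅f, ((LieAlgebra.ad ℂ L e) ^ (n + 1)) v⁆ =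
      (-((n + 1) * (c + n)) : ℂ) • ((LieAlgebra.ad ℂ L e) ^ n) v := by
  have hfe : ⁅f, e⁆ = -h := by rw [← lie_skew, t.lie_e_f]
  induction n with
  | zero =>
    rw [ad_pow_succ_apply, pow_zero, Module.End.one_apply, leibniz_lie, hf, hfe, neg_lie, hv]
    simp
  | succ n ih =>
    rw [ad_pow_succ_apply, leibniz_lie, ih, hfe, neg_lie, lie_h_ad_pow t hv, lie_smul,
      ← ad_pow_succ_apply, ← neg_smul, ← add_smul]
    congr 1
    push_cast
    ring

/-- For an `sl₂`-triple `(h, e, f)` with `ad e` nilpotent on `v`, the operator `(ad e)(ad f)` does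
not kill a non-zero vector `v` whose weight is positive. -/
theorem eq_zero_of_lie_lie_eq_zero {h e f v : L} (t : IsSl2Triple h e f) {c : ℂ}
    (hv : ⁅h, v⁆ = c • v) (hf : ⁅e, ⁅f, v⁆⁆ = 0) (hc : ∀ n : ℕ, c + n ≠ 0)
    (hn : ∃ n, ((LieAlgebra.ad ℂ L e) ^ n) v = 0) : v = 0 := by
  by_contra h0
  obtain ⟨p, hp, hp'⟩ := exists_last_ad_pow h0 hn
  have := lie_f_ad_pow t hv hf p
  rw [ad_pow_succ_apply, hp', lie_zero, eq_comm, smul_eq_zero, neg_eq_zero, mul_eq_zero] at this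
  rcases this with (h | h) | h
  · exact Nat.cast_add_one_ne_zero p h
  · exact hc p h
  · exact hp h

/-- Climb with `e` to a highest vector, of weight `c + 2p`, then descend with `f` as far as
possible. Comparing `e f^(k+1) = 0` with the `sl₂` formula forces the number `k` of steps to equal
that weight. -/
theorem exists_string {h e f v : L} (t : IsSl2Triple h e f) (h0 : v ≠ 0) {c : ℂ}
    (hv : ⁅h, v⁆ = c • v) (hn : ∃ n, ((LieAlgebra.ad ℂ L e) ^ n) v = 0)
    (hf : ∀ y : L, ∃ n, ((LieAlgebra.ad ℂ L f) ^ n) y = 0) :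
    ∃ p k : ℕ, c + 2 * p = k ∧ ∀ i ≤ k,
      ((LieAlgebra.ad ℂ L f) ^ i) (((LieAlgebra.ad ℂ L e) ^ p) v) ≠ 0 := by
  obtain ⟨p, hp, hp'⟩ := exists_last_ad_pow h0 hn
  obtain ⟨k, hk, hk'⟩ := exists_last_ad_pow hp (hf _)
  refine ⟨p, k, ?_, ?_⟩
  · have hw : ⁅-h, ((LieAlgebra.ad ℂ L e) ^ p) v⁆ =
        (-(c + 2 * p)) • ((LieAlgebra.ad ℂ L e) ^ p) v := by
      rw [neg_lie, lie_h_ad_pow t hv, neg_smul]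
    have := lie_f_ad_pow t.symm hw (by rw [hp', lie_zero]) k
    rw [ad_pow_succ_apply, hk', lie_zero, eq_comm, smul_eq_zero, neg_eq_zero, mul_eq_zero] at this
    rcases this with (h | h) | h
    · exact absurd h (Nat.cast_add_one_ne_zero k)
    · linear_combination -h
    · exact absurd h hk
  · intro i hi h
    apply hk
    obtain ⟨j, rfl⟩ := Nat.exists_eq_add_of_le' hi
    rw [pow_add, Module.End.mul_apply, h, map_zero]

end Generic

/-! ### Extended affine Lie algebras: the form on the dual of the Cartan subalgebra -/

namespace IsExtendedAffine

variable {L : Type*} [LieRing L] [LieAlgebra ℂ L] {B : LinearMap.BilinForm ℂ L}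
  {H : LieSubalgebra ℂ L}

theorem form_eq_zero (hE : IsExtendedAffine B H) {α β : Module.Dual ℂ H} {x y : L}
    (hx : x ∈ rootSpace H α) (hy : y ∈ rootSpace H β) (h : α + β ≠ 0) : B x y = 0 := by
  obtain ⟨k, hk⟩ : ∃ k, (α + β) k ≠ 0 := by
    by_contra hc
    push Not at hc
    exact h (LinearMap.ext hc)
  have h1 : B ⁅x, (k : L)⁆ y = B x ⁅(k : L), y⁆ := hE.invariant _ _ _
  rw [← lie_skew, hx k, hy k, map_neg, LinearMap.neg_apply, map_smul, LinearMap.smul_apply,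
    map_smul, smul_eq_mul, smul_eq_mul] at h1
  have h2 : (α + β) k * B x y = 0 := by
    rw [LinearMap.add_apply]
    linear_combination -h1
  exact (mul_eq_zero.1 h2).resolve_left hk

theorem eq_zero_of_forall_rootSpace (hE : IsExtendedAffine B H) {x : L}
    (h : ∀ α, ∀ y ∈ rootSpace H α, B x y = 0) : x = 0 := by
  refine hE.nondegenerate x fun y => ?_
  have hy : y ∈ ⨆ α : Module.Dual ℂ H, rootSpace H α := by rw [hE.splitting]; trivial
  induction hy using Submodule.iSup_induction' with
  | mem α y hy => exact h α y hy
  | zero => simp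
  | add y z _ _ hy hz => rw [map_add, hy, hz, add_zero]

theorem exists_form_ne_zero (hE : IsExtendedAffine B H) {α : Module.Dual ℂ H} {x : L}
    (hx : x ∈ rootSpace H α) (h0 : x ≠ 0) : ∃ y ∈ rootSpace H (-α), B x y ≠ 0 := by
  by_contra hc
  push Not at hc
  refine h0 (hE.eq_zero_of_forall_rootSpace fun β y hy => ?_)
  by_cases h : α + β = 0
  · rw [← neg_eq_iff_add_eq_zero] at h
    exact hc y (h ▸ hy)
  · exact hE.form_eq_zero hx hy h

theorem exists_form_eq (hE : IsExtendedAffine B H) {α : Module.Dual ℂ H} {x : L}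
    (hx : x ∈ rootSpace H α) (h0 : x ≠ 0) (c : ℂ) : ∃ y ∈ rootSpace H (-α), B x y = c := by
  obtain ⟨y, hy, hxy⟩ := hE.exists_form_ne_zero hx h0
  exact ⟨(c / B x y) • y, Submodule.smul_mem _ _ hy, by
    rw [map_smul, smul_eq_mul, div_mul_cancel₀ _ hxy]⟩

theorem neg_mem_roots (hE : IsExtendedAffine B H) {α : Module.Dual ℂ H} (hα : α ∈ roots H) :
    -α ∈ roots H := by
  obtain ⟨x, hx, h0⟩ := exists_ne_zero_of_mem_roots hα
  obtain ⟨y, hy, h1⟩ := hE.exists_form_eq hx h0 1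
  refine mem_roots_of_ne_zero hy ?_
  rintro rfl
  simp at h1

theorem mem_cartan_iff (hE : IsExtendedAffine B H) {x : L} : x ∈ rootSpace H 0 ↔ x ∈ H := by
  rw [hE.rootSpace_zero]; rfl

theorem eq_zero_of_mem_cartan (hE : IsExtendedAffine B H) {x : L} (hx : x ∈ H)
    (h : ∀ y ∈ H, B x y = 0) : x = 0 := by
  by_contra h0
  obtain ⟨y, hy, hxy⟩ := hE.exists_form_ne_zero (hE.mem_cartan_iff.2 hx) h0
  rw [neg_zero, hE.mem_cartan_iff] at hy
  exact hxy (h y hy)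

/-- As `𝔥 = 𝔤_0` is orthogonal to all other root spaces, the form stays non-degenerate on `𝔥`;
finite dimension turns injectivity of `𝔥 → 𝔥*` into surjectivity. -/
theorem exists_dualVec (hE : IsExtendedAffine B H) (α : Module.Dual ℂ H) :
    ∃ t : H, ∀ h : H, α h = B (h : L) (t : L) := by
  have := hE.finite
  let Φ : H →ₗ[ℂ] Module.Dual ℂ H := (B.restrict H.toSubmodule).flip
  have hΦ : ∀ t h : H, Φ t h = B (h : L) (t : L) := fun t h => rfl
  have hinj : Function.Injective Φ := by
    rw [← LinearMap.ker_eq_bot, LinearMap.ker_eq_bot']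
    intro t ht
    apply Subtype.ext
    refine hE.eq_zero_of_mem_cartan t.2 fun y hy => ?_
    rw [hE.symm]
    exact LinearMap.congr_fun ht ⟨y, hy⟩
  obtain ⟨t, ht⟩ := (LinearMap.injective_iff_surjective_of_finrank_eq_finrank
    (Subspace.dual_finrank_eq (K := ℂ) (V := H)).symm).1 hinj α
  exact ⟨t, fun h => by rw [← hΦ, ht]⟩

theorem apply_eq (hE : IsExtendedAffine B H) (α : Module.Dual ℂ H) (h : H) :
    α h = B (h : L) (dualVec B H α : L) :=
  Classical.epsilon_spec (hE.exists_dualVec α) h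

theorem dualVec_eq (hE : IsExtendedAffine B H) {α : Module.Dual ℂ H} {t : H}
    (ht : ∀ h : H, α h = B (h : L) (t : L)) : dualVec B H α = t := by
  apply Subtype.ext
  rw [← sub_eq_zero]
  refine hE.eq_zero_of_mem_cartan (sub_mem (dualVec B H α).2 t.2) fun y hy => ?_
  rw [hE.symm, map_sub, sub_eq_zero]
  exact (hE.apply_eq α ⟨y, hy⟩).symm.trans (ht ⟨y, hy⟩)

/-- The isomorphism `𝔥* → 𝔥`, `α ↦ t_α`, as a linear map into `𝔤`. -/
def dualVecLin (hE : IsExtendedAffine B H) : Module.Dual ℂ H →ₗ[ℂ] H where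
  toFun := dualVec B H
  map_add' α β := hE.dualVec_eq fun h => by
    rw [LinearMap.add_apply, hE.apply_eq α, hE.apply_eq β, ← map_add]; rfl
  map_smul' c α := hE.dualVec_eq fun h => by
    rw [LinearMap.smul_apply, hE.apply_eq α, RingHom.id_apply, ← map_smul]; rfl

theorem dualVecLin_apply (hE : IsExtendedAffine B H) (α : Module.Dual ℂ H) :
    hE.dualVecLin α = dualVec B H α := rfl

theorem dualVecLin_injective (hE : IsExtendedAffine B H) : Function.Injective hE.dualVecLin := by
  intro α β h
  ext x
  rw [hE.apply_eq α, hE.apply_eq β, ← dualVecLin_apply hE, h, dualVecLin_apply]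

/-- The transferred form on `𝔥*`, as a bilinear form. -/
def kform (hE : IsExtendedAffine B H) : LinearMap.BilinForm ℂ (Module.Dual ℂ H) :=
  (B.restrict H.toSubmodule).compl₁₂ hE.dualVecLin hE.dualVecLin

theorem kform_eq_apply (hE : IsExtendedAffine B H) (α β : Module.Dual ℂ H) :
    hE.kform α β = α (dualVec B H β) := by
  rw [hE.apply_eq α, hE.symm]; rfl

theorem kform_symm (hE : IsExtendedAffine B H) (α β : Module.Dual ℂ H) :
    hE.kform α β = hE.kform β α := hE.symm _ _

theorem mem_nonisoRoots_iff (hE : IsExtendedAffine B H) {α : Module.Dual ℂ H} :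
    α ∈ nonisoRoots B H ↔ α ∈ roots H ∧ hE.kform α α ≠ 0 := Iff.rfl

theorem neg_mem_nonisoRoots (hE : IsExtendedAffine B H) {α : Module.Dual ℂ H}
    (hα : α ∈ nonisoRoots B H) : -α ∈ nonisoRoots B H := by
  rw [hE.mem_nonisoRoots_iff] at hα ⊢
  exact ⟨hE.neg_mem_roots hα.1, by simpa using hα.2⟩

/-! ### `sl₂`-triples and root strings in `𝔤` -/

theorem lie_eq_smul_dualVec (hE : IsExtendedAffine B H) {α : Module.Dual ℂ H} {x y : L}
    (hx : x ∈ rootSpace H α) (hy : y ∈ rootSpace H (-α)) :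
    ⁅x, y⁆ = B x y • (dualVec B H α : L) := by
  have h1 : ⁅x, y⁆ ∈ H := by
    rw [← hE.mem_cartan_iff, ← add_neg_cancel α]
    exact lie_mem_rootSpace hx hy
  rw [← sub_eq_zero]
  refine hE.eq_zero_of_mem_cartan (sub_mem h1 (H.smul_mem _ (dualVec B H α).2)) fun k hk => ?_
  rw [hE.symm, map_sub, map_smul, ← hE.invariant, hx ⟨k, hk⟩, map_smul, LinearMap.smul_apply,
    hE.apply_eq α ⟨k, hk⟩, smul_eq_mul, smul_eq_mul, mul_comm, sub_self]

/-- A non-isotropic root vector is part of an `sl₂`-triple. -/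
theorem exists_sl2 (hE : IsExtendedAffine B H) {α : Module.Dual ℂ H} (hα : hE.kform α α ≠ 0)
    {x : L} (hx : x ∈ rootSpace H α) (h0 : x ≠ 0) : ∃ y ∈ rootSpace H (-α),
      IsSl2Triple ((2 / hE.kform α α) • (dualVec B H α : L)) x y := by
  obtain ⟨y, hy, hxy⟩ := hE.exists_form_eq hx h0 (2 / hE.kform α α)
  refine ⟨y, hy, ?_, ?_, ?_, ?_⟩
  · rw [Ne, smul_eq_zero, not_or]
    refine ⟨div_ne_zero two_ne_zero hα, fun h => hα ?_⟩
    rw [hE.kform_eq_apply, show dualVec B H α = 0 from Subtype.ext h, map_zero]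
  · rw [hE.lie_eq_smul_dualVec hx hy, hxy]
  · rw [smul_lie, hx, ← hE.kform_eq_apply, smul_smul, div_mul_cancel₀ _ hα, two_smul, two_smul]
  · rw [smul_lie, hy, LinearMap.neg_apply, ← hE.kform_eq_apply, smul_smul, mul_neg,
      div_mul_cancel₀ _ hα, neg_smul, two_smul, two_smul]

theorem lie_h_eq (hE : IsExtendedAffine B H) {α β : Module.Dual ℂ H} {v : L}
    (hv : v ∈ rootSpace H β) : ⁅(2 / hE.kform α α) • (dualVec B H α : L), v⁆ =
      (2 * hE.kform β α / hE.kform α α) • v := by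
  rw [smul_lie, hv, ← hE.kform_eq_apply, smul_smul]
  congr 1
  ring

/-- Root strings: if `α` is non-isotropic and `β` is a root, then the Cartan integer
`2(β,α)/(α,α)` is of the form `k - 2p` with `β + (p - i)α` a root for `0 ≤ i ≤ k`. -/
theorem exists_rootString (hE : IsExtendedAffine B H) {α β : Module.Dual ℂ H}
    (hα : α ∈ nonisoRoots B H) (hβ : β ∈ roots H) : ∃ p k : ℕ,
      2 * hE.kform β α = ((k : ℤ) - 2 * p : ℤ) * hE.kform α α ∧
      ∀ i ≤ k, β + ((p : ℤ) - i : ℤ) • α ∈ roots H := by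
  obtain ⟨x, hx, hx0⟩ := exists_ne_zero_of_mem_roots hα.1
  obtain ⟨v, hv, hv0⟩ := exists_ne_zero_of_mem_roots hβ
  obtain ⟨y, hy, t⟩ := hE.exists_sl2 hα.2 hx hx0
  obtain ⟨p, k, hpk, hi⟩ := exists_string t hv0 (hE.lie_h_eq hv)
    (hE.locally_nilpotent α hα x hx v)
    (hE.locally_nilpotent _ (hE.neg_mem_nonisoRoots hα) y hy)
  refine ⟨p, k, ?_, fun i hik => ?_⟩
  · have h0 : hE.kform α α ≠ 0 := hα.2
    field_simp at hpk
    push_cast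
    linear_combination hpk
  · have := mem_roots_of_ne_zero (ad_pow_mem_rootSpace hy (ad_pow_mem_rootSpace hx hv p) i)
      (hi i hik)
    rwa [show β + p • α + i • -α = β + ((p : ℤ) - i : ℤ) • α by
      rw [sub_smul, natCast_zsmul, natCast_zsmul, smul_neg]; abel] at this

/-- All roots between `β` and its reflection lie in the string. -/
theorem exists_cartanInt (hE : IsExtendedAffine B H) {α β : Module.Dual ℂ H}
    (hα : α ∈ nonisoRoots B H) (hβ : β ∈ roots H) : ∃ N : ℤ,
      2 * hE.kform β α = N * hE.kform α α ∧
      ∀ j : ℤ, (0 ≤ j ∧ j ≤ N) ∨ (N ≤ j ∧ j ≤ 0) → β - j • α ∈ roots H := by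
  obtain ⟨p, k, h1, h2⟩ := hE.exists_rootString hα hβ
  -- The first string serves `0 ≤ j ≤ N`; this one, built from `-α`, serves `N ≤ j ≤ 0`. Both yield
  -- the same Cartan integer.
  obtain ⟨p', k', h1', h2'⟩ := hE.exists_rootString (hE.neg_mem_nonisoRoots hα) hβ
  have h0 : hE.kform α α ≠ 0 := hα.2
  have hN : ((k : ℤ) - 2 * p : ℤ) = -((k' : ℤ) - 2 * p' : ℤ) := by
    simp only [map_neg, LinearMap.neg_apply, neg_neg, mul_neg] at h1'
    have : (((k : ℤ) - 2 * p : ℤ) : ℂ) = ((-((k' : ℤ) - 2 * p' : ℤ) : ℤ) : ℂ) := by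
      apply mul_right_cancel₀ h0
      rw [← h1, Int.cast_neg, neg_mul, ← h1', neg_neg]
    exact_mod_cast this
  refine ⟨_, h1, fun j hj => ?_⟩
  rcases hj with hj | hj
  · have := h2 (p + j).toNat (by omega)
    rwa [show ((p : ℤ) - ((p + j).toNat : ℤ)) = -j by omega, neg_smul, ← sub_eq_add_neg] at this
  · have := h2' (p' - j).toNat (by omega)
    rwa [show ((p' : ℤ) - ((p' - j).toNat : ℤ)) = j by omega, smul_neg, ← sub_eq_add_neg] at this

end IsExtendedAffine

end ExtAff

namespace ExtAff

namespace IsExtendedAffine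

variable {L : Type*} [LieRing L] [LieAlgebra ℂ L] {B : LinearMap.BilinForm ℂ L}
  {H : LieSubalgebra ℂ L}

/-! ### Isotropic roots are orthogonal to all roots -/

/-- With `c = (β, δ) ≠ 0` the norm of `β + nδ` is `(β, β) + 2nc`, which grows. But `2c` divided by
that norm is a non-zero integer whenever the norm is non-zero, so the norms are bounded by `2‖c‖`.
-/
theorem kform_eq_zero_of_forall_add_nsmul (hE : IsExtendedAffine B H) {β δ : Module.Dual ℂ H}
    (hδ : δ ∈ roots H) (h0 : hE.kform δ δ = 0) (h : ∀ n : ℕ, β + n • δ ∈ roots H) :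
    hE.kform β δ = 0 := by
  by_contra hc
  set c := hE.kform β δ with hcdef
  set K := hE.kform β β
  have hn : ∀ n : ℕ, hE.kform (β + n • δ) (β + n • δ) = K + 2 * n * c := by
    intro n
    simp only [map_add, map_nsmul, LinearMap.add_apply, LinearMap.smul_apply, h0,
      hE.kform_symm δ β, nsmul_eq_mul]
    simp only [K, hcdef]
    ring
  have hb : ∀ n : ℕ, ‖K + 2 * n * c‖ ≤ 2 * ‖c‖ := by
    intro n
    by_cases hz : K + 2 * n * c = 0
    · rw [hz, norm_zero]; positivity
    obtain ⟨N, hN, -⟩ := hE.exists_cartanInt (α := β + n • δ) (β := δ)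
      (hE.mem_nonisoRoots_iff.2 ⟨h n, by rwa [hn]⟩) hδ
    rw [hn, map_add, map_nsmul, h0, smul_zero, add_zero, hE.kform_symm δ β] at hN
    have hN0 : N ≠ 0 := by
      rintro rfl
      simp only [Int.cast_zero, zero_mul, mul_eq_zero, OfNat.ofNat_ne_zero, false_or] at hN
      exact hc hN
    have h1 : (1 : ℝ) ≤ ‖(N : ℂ)‖ := by
      rw [Complex.norm_intCast]
      exact_mod_cast Int.one_le_abs hN0
    have h2 : 2 * ‖c‖ = ‖(N : ℂ)‖ * ‖K + 2 * n * c‖ := by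
      rw [← norm_mul, ← hN, norm_mul, Complex.norm_ofNat]
    nlinarith [norm_nonneg (K + 2 * n * c)]
  have hcpos : 0 < ‖c‖ := norm_pos_iff.2 hc
  obtain ⟨n, hlt⟩ := exists_nat_gt ((‖K‖ + 2 * ‖c‖) / (2 * ‖c‖))
  rw [div_lt_iff₀ (by positivity)] at hlt
  have h3 : ‖(2 * n * c : ℂ)‖ = n * (2 * ‖c‖) := by
    rw [norm_mul, norm_mul, Complex.norm_natCast, Complex.norm_ofNat]; ring
  have h4 : ‖(2 * n * c : ℂ)‖ ≤ ‖K + 2 * n * c‖ + ‖K‖ := by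
    have := norm_sub_le (K + 2 * n * c) K
    rwa [add_sub_cancel_left] at this
  linarith [hb n]

/-- Here `x`, `y` and `[x, y] = t_δ` span a Heisenberg-type algebra, as `δ(t_δ) = 0`. Either `ad x`
never kills `v`, and the `δ`-string is infinite upwards; or it ends in some `w`, and `(β, δ) ≠ 0`
would make `(ad y)^n w` non-zero for all `n`, so that the string is infinite downwards. Infinite
strings were excluded unless `(β, δ) = 0`. -/
theorem kform_eq_zero_of_isotropic (hE : IsExtendedAffine B H) {β δ : Module.Dual ℂ H}
    (hδ : δ ∈ roots H) (h0 : hE.kform δ δ = 0) (hβ : β ∈ roots H) : hE.kform β δ = 0 := by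
  obtain ⟨x, hx, hx0⟩ := exists_ne_zero_of_mem_roots hδ
  obtain ⟨y, hy, hxy⟩ := hE.exists_form_eq hx hx0 1
  obtain ⟨v, hv, hv0⟩ := exists_ne_zero_of_mem_roots hβ
  have hxy' : ⁅x, y⁆ = (dualVec B H δ : L) := by
    rw [hE.lie_eq_smul_dualVec hx hy, hxy, one_smul]
  by_cases hall : ∃ n, ((LieAlgebra.ad ℂ L x) ^ n) v = 0
  · obtain ⟨p, hp, hp'⟩ := exists_last_ad_pow hv0 hall
    by_contra hc
    set w := ((LieAlgebra.ad ℂ L x) ^ p) v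
    have hw : w ∈ rootSpace H (β + p • δ) := ad_pow_mem_rootSpace hx hv p
    have hstep : ∀ n : ℕ, ⁅x, ((LieAlgebra.ad ℂ L y) ^ (n + 1)) w⁆ =
        ((n + 1) * hE.kform β δ) • ((LieAlgebra.ad ℂ L y) ^ n) w := by
      have ht : ∀ n : ℕ, ⁅⁅x, y⁆, ((LieAlgebra.ad ℂ L y) ^ n) w⁆ =
          hE.kform β δ • ((LieAlgebra.ad ℂ L y) ^ n) w := by
        intro n
        rw [hxy', ad_pow_mem_rootSpace hy hw n, ← hE.kform_eq_apply]
        simp [h0]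
      intro n
      induction n with
      | zero =>
        rw [ad_pow_succ_apply, leibniz_lie, ht]
        simp [hp']
      | succ n ih =>
        rw [ad_pow_succ_apply, leibniz_lie, ht, ih, lie_smul, ← ad_pow_succ_apply, ← add_smul]
        congr 1
        push_cast
        ring
    have hne : ∀ n : ℕ, ((LieAlgebra.ad ℂ L y) ^ n) w ≠ 0 := by
      intro n
      induction n with
      | zero => exact hp
      | succ n ih =>
        intro h
        have := hstep n
        rw [h, lie_zero, eq_comm, smul_eq_zero] at this
        exact this.elim (mul_ne_zero (Nat.cast_add_one_ne_zero n) hc) ih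
    have := hE.kform_eq_zero_of_forall_add_nsmul (β := β + p • δ) (hE.neg_mem_roots hδ)
      (by simpa using h0) fun n => mem_roots_of_ne_zero (ad_pow_mem_rootSpace hy hw n) (hne n)
    simp [h0] at this
    exact hc this
  · push Not at hall
    exact hE.kform_eq_zero_of_forall_add_nsmul hδ h0 fun n =>
      mem_roots_of_ne_zero (ad_pow_mem_rootSpace hx hv n) (hall n)

theorem mem_nonisoRoots_of_kform_ne_zero (hE : IsExtendedAffine B H) {α β : Module.Dual ℂ H}
    (hα : α ∈ roots H) (hβ : β ∈ roots H) (h : hE.kform α β ≠ 0) : β ∈ nonisoRoots B H :=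
  hE.mem_nonisoRoots_iff.2 ⟨hβ, fun h0 => h (hE.kform_eq_zero_of_isotropic hβ h0 hα)⟩

/-! ### Bounds for the Cartan integers -/

/-- For `N ≥ 5` the string contains `α - 2β`, of norm `(5 - 2N)(β, β) ≠ 0`. The Cartan integer of
`β` with respect to it is `(N - 4)/(5 - 2N)`, which lies strictly between `-1` and `0`. -/
theorem cartanInt_le_four (hE : IsExtendedAffine B H) {α β : Module.Dual ℂ H}
    (hα : α ∈ roots H) (hβ : β ∈ nonisoRoots B H)
    (hl : hE.kform α α = hE.kform β β) {N : ℤ} (hN : 2 * hE.kform α β = N * hE.kform β β) :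
    N ≤ 4 := by
  by_contra h
  push Not at h
  have h0 : hE.kform β β ≠ 0 := hβ.2
  obtain ⟨N', hN', hs⟩ := hE.exists_cartanInt hβ hα
  obtain rfl : N' = N := by
    have := mul_right_cancel₀ h0 (hN'.symm.trans hN)
    exact_mod_cast this
  have h2 := hs 2 (by omega)
  have hq : hE.kform (α - (2 : ℤ) • β) (α - (2 : ℤ) • β) = (5 - 2 * N' : ℤ) * hE.kform β β := by
    simp only [map_sub, LinearMap.sub_apply, two_smul, map_add, LinearMap.add_apply,
      hE.kform_symm β α]
    push_cast
    linear_combination hl - 2 * hN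
  have hq0 : hE.kform (α - (2 : ℤ) • β) (α - (2 : ℤ) • β) ≠ 0 := by
    rw [hq]
    exact mul_ne_zero (by exact_mod_cast (by omega : 5 - 2 * N' ≠ 0)) h0
  obtain ⟨M, hM, -⟩ := hE.exists_cartanInt (hE.mem_nonisoRoots_iff.2 ⟨h2, hq0⟩) hβ.1
  rw [hq, ← mul_assoc] at hM
  have h3 : 2 * hE.kform β (α - (2 : ℤ) • β) = (N' - 4 : ℤ) * hE.kform β β := by
    simp only [map_sub, two_smul, map_add, hE.kform_symm β α]
    push_cast
    linear_combination hN
  have h4 := mul_right_cancel₀ h0 (h3.symm.trans hM)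
  have h5 : N' - 4 = M * (5 - 2 * N') := by exact_mod_cast h4
  have h6 : M ≠ 0 := by rintro rfl; omega
  rcases lt_or_gt_of_ne h6 with h7 | h7 <;> nlinarith

/-- The negative of the reflection of `α` in `β` is `Nβ - α`. It has the length of `α`, and its
Cartan integer with `α` is `N² - 2`; the bound `4` gives `N² ≤ 6`. -/
theorem abs_cartanInt_le_two (hE : IsExtendedAffine B H) {α β : Module.Dual ℂ H}
    (hα : α ∈ roots H) (hβ : β ∈ nonisoRoots B H)
    (hl : hE.kform α α = hE.kform β β) {N : ℤ} (hN : 2 * hE.kform α β = N * hE.kform β β) :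
    -2 ≤ N ∧ N ≤ 2 := by
  have h0 : hE.kform β β ≠ 0 := hβ.2
  obtain ⟨N', hN', hs⟩ := hE.exists_cartanInt hβ hα
  obtain rfl : N' = N := by
    have := mul_right_cancel₀ h0 (hN'.symm.trans hN)
    exact_mod_cast this
  have hγ := hE.neg_mem_roots (hs N' (by omega))
  have hαn : α ∈ nonisoRoots B H := hE.mem_nonisoRoots_iff.2 ⟨hα, by rwa [hl]⟩
  have hl' : hE.kform (-(α - N' • β)) (-(α - N' • β)) = hE.kform α α := by
    simp only [map_neg, LinearMap.neg_apply, map_sub, LinearMap.sub_apply, map_zsmul,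
      LinearMap.smul_apply, zsmul_eq_mul, hE.kform_symm β α]
    linear_combination -(N' : ℂ) * hN
  have := hE.cartanInt_le_four hγ hαn hl' (N := N' ^ 2 - 2) (by
    simp only [map_neg, LinearMap.neg_apply, map_sub, LinearMap.sub_apply, map_zsmul,
      LinearMap.smul_apply, zsmul_eq_mul, hE.kform_symm β α]
    push_cast
    linear_combination (N' : ℂ) * hN - (N' : ℂ) ^ 2 * hl)
  constructor <;> nlinarith

/-- The product of the two Cartan integers of a pair of non-isotropic roots lies between `0`
and `4`. -/
theorem cartanInt_mul_cartanInt (hE : IsExtendedAffine B H) {α β : Module.Dual ℂ H}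
    (hα : α ∈ nonisoRoots B H) (hβ : β ∈ nonisoRoots B H) {M N : ℤ}
    (hM : 2 * hE.kform β α = M * hE.kform α α) (hN : 2 * hE.kform α β = N * hE.kform β β) :
    0 ≤ M * N ∧ M * N ≤ 4 := by
  have h0 : hE.kform α α ≠ 0 := hα.2
  obtain ⟨M', hM', hs⟩ := hE.exists_cartanInt hα hβ.1
  obtain rfl : M' = M := by
    have := mul_right_cancel₀ h0 (hM'.symm.trans hM)
    exact_mod_cast this
  have hγ := hs M' (by omega)
  -- The reflection of `β` in `α` has the length of `β` and Cartan integer `2 - MN` with it, so `-2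
  -- ≤ 2 - MN ≤ 2`.
  have hl' : hE.kform (β - M' • α) (β - M' • α) = hE.kform β β := by
    simp only [map_sub, LinearMap.sub_apply, map_zsmul,
      LinearMap.smul_apply, zsmul_eq_mul, hE.kform_symm α β]
    linear_combination -(M' : ℂ) * hM
  have := hE.abs_cartanInt_le_two hγ hβ hl' (N := 2 - M' * N) (by
    simp only [map_sub, LinearMap.sub_apply, map_zsmul, LinearMap.smul_apply, zsmul_eq_mul]
    push_cast
    linear_combination -(M' : ℂ) * hN)
  constructor <;> linarith

/-- If the product is non-zero, both Cartan integers are non-zero with product at most `4`, so each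
is at most `4` in absolute value. The bound is uniform in `β`; it later yields ad-nilpotency of
vectors that are not root vectors. -/
theorem norm_kform_le (hE : IsExtendedAffine B H) {α β : Module.Dual ℂ H}
    (hα : α ∈ nonisoRoots B H) (hβ : β ∈ roots H) :
    ‖hE.kform β α‖ ≤ 2 * ‖hE.kform α α‖ := by
  by_cases hc : hE.kform β α = 0
  · rw [hc, norm_zero]; positivity
  have hβ' : β ∈ nonisoRoots B H :=
    hE.mem_nonisoRoots_of_kform_ne_zero hα.1 hβ (by rwa [hE.kform_symm])
  obtain ⟨M, hM, -⟩ := hE.exists_cartanInt hα hβ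
  obtain ⟨N, hN, -⟩ := hE.exists_cartanInt hβ' hα.1
  obtain ⟨h1, h2⟩ := hE.cartanInt_mul_cartanInt hα hβ' hM hN
  have hM0 : M ≠ 0 := by
    rintro rfl
    simp [hc] at hM
  have hN0 : N ≠ 0 := by
    rintro rfl
    simp [hE.kform_symm α β, hc] at hN
  have h3 : |M| ≤ 4 := by
    have h4 : |M| * |N| ≤ 4 := by rw [← abs_mul, abs_of_nonneg h1]; exact h2
    nlinarith [Int.one_le_abs hN0, abs_nonneg M]
  have h5 : 2 * ‖hE.kform β α‖ = |(M : ℝ)| * ‖hE.kform α α‖ := by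
    rw [← Complex.norm_intCast, ← norm_mul, ← hM, norm_mul, Complex.norm_ofNat]
  have h6 : |(M : ℝ)| ≤ 4 := by exact_mod_cast h3
  nlinarith [norm_nonneg (hE.kform α α)]

/-! ### The form is positive semidefinite on the root lattice, up to a scalar -/

/-- Non-orthogonal non-isotropic roots have non-zero Cartan integers of equal sign, so their norms
differ by a positive rational factor. Connectedness of `R^×` propagates this to all of it. -/
theorem exists_pos_mul (hE : IsExtendedAffine B H) {α₀ α : Module.Dual ℂ H}
    (h₀ : α₀ ∈ nonisoRoots B H) (hα : α ∈ nonisoRoots B H) :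
    ∃ q : ℝ, 0 < q ∧ hE.kform α α = q * hE.kform α₀ α₀ := by
  by_contra hc
  refine hE.connected ⟨{α ∈ nonisoRoots B H | ∃ q : ℝ, 0 < q ∧ hE.kform α α = q * hE.kform α₀ α₀},
    {α ∈ nonisoRoots B H | ¬ ∃ q : ℝ, 0 < q ∧ hE.kform α α = q * hE.kform α₀ α₀},
    ⟨α₀, h₀, 1, one_pos, by simp⟩, ⟨α, hα, hc⟩, ?_, ?_⟩
  · ext β
    exact ⟨fun h => (em _).imp (fun h' => ⟨h, h'⟩) (fun h' => ⟨h, h'⟩),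
      fun h => h.elim And.left And.left⟩
  · rintro β ⟨hβ, q, hq, hβq⟩ γ ⟨hγ, hγq⟩
    change hE.kform β γ = 0
    by_contra hne
    apply hγq
    obtain ⟨M, hM, -⟩ := hE.exists_cartanInt hβ hγ.1
    obtain ⟨N, hN, -⟩ := hE.exists_cartanInt hγ hβ.1
    obtain ⟨h1, -⟩ := hE.cartanInt_mul_cartanInt hβ hγ hM hN
    have hM0 : M ≠ 0 := by
      rintro rfl
      simp [hE.kform_symm γ β, hne] at hM
    have hN0 : N ≠ 0 := by
      rintro rfl
      simp [hne] at hN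
    have h2 : (0 : ℝ) < M * N := by
      exact_mod_cast lt_of_le_of_ne h1 (mul_ne_zero hM0 hN0).symm
    have hNR : (N : ℝ) ≠ 0 := by exact_mod_cast hN0
    -- From `M (β, β) = 2(β, γ) = N (γ, γ)`.
    refine ⟨M / N * q, ?_, ?_⟩
    · have : (M : ℝ) / N = M * N / (N * N) := by field_simp
      rw [this]
      have : (0 : ℝ) < N * N := mul_self_pos.2 hNR
      positivity
    · have hNC : (N : ℂ) ≠ 0 := by exact_mod_cast hN0
      have h3 : (N : ℂ) * hE.kform γ γ = M * hE.kform β β := by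
        rw [← hN, ← hM, hE.kform_symm]
      push_cast
      rw [mul_assoc, ← hβq]
      field_simp
      linear_combination h3

/-- The form `(·,·) / (α₀, α₀)`, whose values on roots are real. -/
def rform (hE : IsExtendedAffine B H) (α₀ α β : Module.Dual ℂ H) : ℝ :=
  (hE.kform α β / hE.kform α₀ α₀).re

theorem rform_add_left (hE : IsExtendedAffine B H) (α₀ α α' β : Module.Dual ℂ H) :
    hE.rform α₀ (α + α') β = hE.rform α₀ α β + hE.rform α₀ α' β := by
  simp [rform, add_div]

theorem rform_symm (hE : IsExtendedAffine B H) (α₀ α β : Module.Dual ℂ H) :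
    hE.rform α₀ α β = hE.rform α₀ β α := by
  rw [rform, hE.kform_symm, rform]

theorem rform_add_right (hE : IsExtendedAffine B H) (α₀ α β β' : Module.Dual ℂ H) :
    hE.rform α₀ α (β + β') = hE.rform α₀ α β + hE.rform α₀ α β' := by
  rw [rform_symm, rform_add_left, rform_symm, hE.rform_symm _ β']

theorem rform_zero_right (hE : IsExtendedAffine B H) (α₀ α : Module.Dual ℂ H) :
    hE.rform α₀ α 0 = 0 := by
  simp [rform]

theorem rform_sum_right {ι : Type*} (hE : IsExtendedAffine B H) (α₀ α : Module.Dual ℂ H)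
    (s : Finset ι) (f : ι → Module.Dual ℂ H) :
    hE.rform α₀ α (∑ i ∈ s, f i) = ∑ i ∈ s, hE.rform α₀ α (f i) := by
  simp [rform, Finset.sum_div]

/-- Norms are real multiples of `(α₀, α₀)` and Cartan integers are integers, so taking the real part
in `rform` loses nothing on roots. -/
theorem kform_eq_rform (hE : IsExtendedAffine B H) {α₀ α β : Module.Dual ℂ H}
    (h₀ : α₀ ∈ nonisoRoots B H) (hα : α ∈ roots H) (hβ : β ∈ roots H) :
    hE.kform α β = hE.rform α₀ α β * hE.kform α₀ α₀ := by
  have h0 : hE.kform α₀ α₀ ≠ 0 := h₀.2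
  by_cases hc : hE.kform α β = 0
  · simp [rform, hc]
  have hβ' := hE.mem_nonisoRoots_of_kform_ne_zero hα hβ hc
  obtain ⟨q, -, hq⟩ := hE.exists_pos_mul h₀ hβ'
  obtain ⟨N, hN, -⟩ := hE.exists_cartanInt hβ' hα
  have h1 : hE.kform α β = ((N / 2 * q : ℝ) : ℂ) * hE.kform α₀ α₀ := by
    push_cast
    linear_combination hN / 2 + N / 2 * hq
  rw [rform, h1, mul_div_cancel_right₀ _ h0, Complex.ofReal_re]

theorem rform_self_pos (hE : IsExtendedAffine B H) {α₀ α : Module.Dual ℂ H}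
    (h₀ : α₀ ∈ nonisoRoots B H) (hα : α ∈ nonisoRoots B H) : 0 < hE.rform α₀ α α := by
  obtain ⟨q, hq, h⟩ := hE.exists_pos_mul h₀ hα
  have h0 : hE.kform α₀ α₀ ≠ 0 := h₀.2
  rwa [rform, h, mul_div_cancel_right₀ _ h0, Complex.ofReal_re]

theorem rform_self_nonneg (hE : IsExtendedAffine B H) {α₀ α : Module.Dual ℂ H}
    (h₀ : α₀ ∈ nonisoRoots B H) (hα : α ∈ roots H) : 0 ≤ hE.rform α₀ α α := by
  by_cases h : hE.kform α α = 0
  · simp [rform, h]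
  · exact (hE.rform_self_pos h₀ (hE.mem_nonisoRoots_iff.2 ⟨hα, h⟩)).le

/-- If `(α, β) > 0`, then `2(α,β)/(β,β)` is a positive integer and `α - β` is a root. -/
theorem cartanInt_pos (hE : IsExtendedAffine B H) {α₀ α β : Module.Dual ℂ H}
    (h₀ : α₀ ∈ nonisoRoots B H) (hα : α ∈ roots H) (hβ : β ∈ roots H)
    (h : 0 < hE.rform α₀ α β) : β ∈ nonisoRoots B H ∧ α - β ∈ roots H ∧
      ∃ N : ℤ, 0 < N ∧ 2 * hE.kform α β = N * hE.kform β β := by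
  have hβ' : β ∈ nonisoRoots B H := by
    refine hE.mem_nonisoRoots_of_kform_ne_zero hα hβ fun h0 => ?_
    simp [rform, h0] at h
  obtain ⟨N, hN, hs⟩ := hE.exists_cartanInt hβ' hα
  have hNpos : 0 < N := by
    rw [hE.kform_eq_rform h₀ hα hβ, hE.kform_eq_rform h₀ hβ hβ, ← mul_assoc, ← mul_assoc] at hN
    have h1 := mul_right_cancel₀ (h₀.2 : hE.kform α₀ α₀ ≠ 0) hN
    have h2 : 2 * hE.rform α₀ α β = N * hE.rform α₀ β β := by exact_mod_cast h1
    have h3 := hE.rform_self_pos h₀ hβ'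
    have : (0 : ℝ) < N := by
      by_contra hc
      push Not at hc
      nlinarith
    exact_mod_cast this
  refine ⟨hβ', ?_, N, hNpos, hN⟩
  simpa using hs 1 (by omega)

/-- Induction on the number of summands. If the sum had negative norm, some summand `γ` would be
negative against it; since `(γ, γ) ≥ 0`, also against another summand `γ'`. Then `γ + γ'` is a root,
and merging the two shortens the sum without changing it. Sums with multiplicity require multisets.
-/
theorem rform_multiset_nonneg (hE : IsExtendedAffine B H) {α₀ : Module.Dual ℂ H}
    (h₀ : α₀ ∈ nonisoRoots B H) (n : ℕ) : ∀ s : Multiset (Module.Dual ℂ H), s.card = n →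
      (∀ α ∈ s, α ∈ roots H) → 0 ≤ hE.rform α₀ s.sum s.sum := by
  have hsum : ∀ (s : Multiset (Module.Dual ℂ H)) (v : Module.Dual ℂ H),
      (∀ α ∈ s, 0 ≤ hE.rform α₀ v α) → 0 ≤ hE.rform α₀ v s.sum := by
    intro s v
    induction s using Multiset.induction_on with
    | empty => intro _; rw [Multiset.sum_zero, rform_zero_right]
    | cons a s ih =>
      intro h
      rw [Multiset.sum_cons, rform_add_right]
      exact add_nonneg (h a (Multiset.mem_cons_self _ _))
        (ih fun α hα => h α (Multiset.mem_cons_of_mem hα))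
  induction n with
  | zero =>
    intro s hs _
    rw [Multiset.card_eq_zero.1 hs, Multiset.sum_zero, rform_zero_right]
  | succ n ih =>
    intro s hs hR
    by_contra hneg
    obtain ⟨γ, hγ, hγneg⟩ : ∃ γ ∈ s, hE.rform α₀ s.sum γ < 0 := by
      by_contra hc
      push Not at hc
      exact hneg (hsum s _ hc)
    obtain ⟨s', rfl⟩ := Multiset.exists_cons_of_mem hγ
    obtain ⟨γ', hγ', hγγ'⟩ : ∃ γ' ∈ s', hE.rform α₀ γ γ' < 0 := by
      by_contra hc
      push Not at hc
      have := hsum s' _ hc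
      rw [Multiset.sum_cons, rform_add_left, hE.rform_symm _ s'.sum] at hγneg
      linarith [hE.rform_self_nonneg h₀ (hR γ hγ)]
    obtain ⟨s'', rfl⟩ := Multiset.exists_cons_of_mem hγ'
    have hroot : γ + γ' ∈ roots H := by
      have h1 := hE.neg_mem_roots (hR γ' (by simp))
      have := (hE.cartanInt_pos h₀ (hR γ (by simp)) h1 (by
        simp only [rform, map_neg, neg_div, Complex.neg_re] at hγγ' ⊢
        linarith)).2.1
      rwa [sub_neg_eq_add] at this
    apply hneg
    have := ih ((γ + γ') ::ₘ s'') (by simpa using hs) (by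
      intro α hα
      rcases Multiset.mem_cons.1 hα with rfl | hα
      · exact hroot
      · exact hR α (by simp [hα]))
    simpa only [Multiset.sum_cons, add_assoc] using this

theorem rform_sum_nonneg {ι : Type*} (hE : IsExtendedAffine B H) {α₀ : Module.Dual ℂ H}
    (h₀ : α₀ ∈ nonisoRoots B H) (s : Finset ι) (f : ι → Module.Dual ℂ H)
    (hf : ∀ i ∈ s, f i ∈ roots H) : 0 ≤ hE.rform α₀ (∑ i ∈ s, f i) (∑ i ∈ s, f i) := by
  refine hE.rform_multiset_nonneg h₀ _ (s.1.map f) rfl ?_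
  intro α hα
  obtain ⟨i, hi, rfl⟩ := Multiset.mem_map.1 hα
  exact hf i hi

/-- An isotropic sum of roots is orthogonal to every root. -/
theorem rform_sum_eq_zero {ι : Type*} (hE : IsExtendedAffine B H) {α₀ β : Module.Dual ℂ H}
    (h₀ : α₀ ∈ nonisoRoots B H) (s : Finset ι) (f : ι → Module.Dual ℂ H)
    (hf : ∀ i ∈ s, f i ∈ roots H) (h0 : hE.rform α₀ (∑ i ∈ s, f i) (∑ i ∈ s, f i) = 0)
    (hβ : β ∈ roots H) : hE.rform α₀ (∑ i ∈ s, f i) β = 0 := by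
  set u := ∑ i ∈ s, f i with hu
  -- Semidefiniteness of `n u + β` for all `n`: the term `n²(u, u)` vanishes, so the linear term in
  -- `n` cannot be negative. Applying this to `-β` as well gives equality.
  have key : ∀ β ∈ roots H, ∀ n : ℕ, 0 ≤ 2 * n * hE.rform α₀ u β + hE.rform α₀ β β := by
    intro β hβ n
    have := hE.rform_multiset_nonneg h₀ _ (β ::ₘ n • s.1.map f) rfl (by
      intro α hα
      rcases Multiset.mem_cons.1 hα with rfl | hα
      · exact hβ
      · obtain ⟨i, hi, rfl⟩ := Multiset.mem_map.1 (Multiset.mem_of_mem_nsmul hα)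
        exact hf i hi)
    rw [Multiset.sum_cons, Multiset.sum_nsmul] at this
    have hsum : (s.1.map f).sum = u := rfl
    rw [hsum] at this
    have e : ∀ v, hE.rform α₀ (n • u) v = n * hE.rform α₀ u v := by
      intro v
      simp [rform, mul_div_assoc]
    rw [rform_add_left, rform_add_right, rform_add_right, e, e, hE.rform_symm _ u (n • u), e,
      hE.rform_symm _ β (n • u), e, h0] at this
    linarith
  have hge : ∀ β ∈ roots H, 0 ≤ hE.rform α₀ u β := by
    intro β hβ
    by_contra hc
    push Not at hc
    obtain ⟨n, hn⟩ := exists_nat_gt (hE.rform α₀ β β / (-2 * hE.rform α₀ u β))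
    rw [div_lt_iff₀ (by linarith)] at hn
    linarith [key β hβ n]
  have h1 := hge β hβ
  have h2 := hge _ (hE.neg_mem_roots hβ)
  simp only [rform, map_neg, neg_div, Complex.neg_re] at h1 h2 ⊢
  linarith

end IsExtendedAffine

end ExtAff

namespace ExtAff

/-! ### The projections attached to an endomorphism of finite order -/

section CyclicProj

variable {V : Type*} [AddCommGroup V] [Module ℂ V] {m : ℕ} {ω : ℂ} {T : Module.End ℂ V}

theorem cyclicProj_apply (j : ℤ) (x : V) : cyclicProj m ω T j x =
    (m : ℂ)⁻¹ • ∑ i ∈ Finset.range m, ω ^ (-((i : ℤ) * j)) • (T ^ i) x := by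
  simp [cyclicProj]

theorem map_cyclicProj {V' : Type*} [AddCommGroup V'] [Module ℂ V'] {T' : Module.End ℂ V'}
    (f : V →ₗ[ℂ] V') (hf : ∀ x, f (T x) = T' (f x)) (j : ℤ) (x : V) :
    f (cyclicProj m ω T j x) = cyclicProj m ω T' j (f x) := by
  have h : ∀ i : ℕ, f ((T ^ i) x) = (T' ^ i) (f x) := by
    intro i
    induction i with
    | zero => rfl
    | succ i ih => rw [pow_succ', pow_succ', Module.End.mul_apply, Module.End.mul_apply, hf, ih]
  simp only [cyclicProj_apply, map_smul, map_sum, h]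

theorem cyclicProj_apply_self (hω : IsPrimitiveRoot ω m) (hm : 0 < m) (hT : T ^ m = 1) (j : ℤ)
    (x : V) : cyclicProj m ω T j (T x) = ω ^ j • cyclicProj m ω T j x := by
  have h0 : ω ≠ 0 := hω.ne_zero hm.ne'
  rw [cyclicProj_apply, cyclicProj_apply, smul_comm (ω ^ j)]
  congr 1
  rw [Finset.smul_sum]
  have h1 : ∀ i : ℕ, ω ^ (-((i : ℤ) * j)) • (T ^ i) (T x) =
      ω ^ j • (ω ^ (-(((i + 1 : ℕ) : ℤ) * j)) • (T ^ (i + 1)) x) := by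
    intro i
    rw [smul_smul, ← zpow_add₀ h0, pow_succ, Module.End.mul_apply]
    congr 2
    push_cast
    ring
  rw [Finset.sum_congr rfl fun i _ => h1 i]
  have h2 := Finset.sum_range_succ' (fun i : ℕ => ω ^ j • (ω ^ (-((i : ℤ) * j)) • (T ^ i) x)) m
  rw [Finset.sum_range_succ] at h2
  -- After reindexing, the term `i = m` replaces the term `i = 0`; they agree because `ω^m = 1` and
  -- `T^m = 1`.
  have h3 : ω ^ (-((m : ℤ) * j)) = 1 := by
    rw [zpow_neg, zpow_mul, zpow_natCast, hω.pow_eq_one, one_zpow, inv_one]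
  simp only [h3, hT, one_smul, Nat.cast_zero, zero_mul, neg_zero, zpow_zero, pow_zero] at h2
  exact (add_right_cancel h2).symm

theorem self_apply_cyclicProj (hω : IsPrimitiveRoot ω m) (hm : 0 < m) (hT : T ^ m = 1) (j : ℤ)
    (x : V) : T (cyclicProj m ω T j x) = ω ^ j • cyclicProj m ω T j x := by
  rw [map_cyclicProj T (fun _ => rfl), cyclicProj_apply_self hω hm hT]

theorem cyclicProj_eq_self (hω : IsPrimitiveRoot ω m) (hm : 0 < m) {j : ℤ} {x : V}
    (hx : T x = ω ^ j • x) : cyclicProj m ω T j x = x := by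
  have h0 : ω ≠ 0 := hω.ne_zero hm.ne'
  have h : ∀ i : ℕ, (T ^ i) x = ω ^ ((i : ℤ) * j) • x := by
    intro i
    induction i with
    | zero => simp
    | succ i ih =>
      rw [pow_succ', Module.End.mul_apply, ih, map_smul, hx, smul_smul, ← zpow_add₀ h0]
      congr 2
      push_cast
      ring
  rw [cyclicProj_apply, Finset.sum_congr rfl (g := fun _ => x)]
  · rw [Finset.sum_const, Finset.card_range, ← Nat.cast_smul_eq_nsmul ℂ, smul_smul,
      inv_mul_cancel₀ (by exact_mod_cast hm.ne'), one_smul]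
  · intro i _
    rw [h, smul_smul, ← zpow_add₀ h0, neg_add_cancel, zpow_zero, one_smul]

theorem sum_cyclicProj (hω : IsPrimitiveRoot ω m) (hm : 0 < m) (x : V) :
    ∑ j ∈ Finset.range m, cyclicProj m ω T j x = x := by
  simp only [cyclicProj_apply]
  rw [← Finset.smul_sum, Finset.sum_comm]
  have h1 : ∀ i ∈ Finset.range m, ∑ j ∈ Finset.range m, ω ^ (-((i : ℤ) * (j : ℤ))) • (T ^ i) x =
      if i = 0 then (m : ℂ) • x else 0 := by
    intro i hi
    rw [← Finset.sum_smul]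
    split_ifs with h
    · subst h
      simp
    · have h2 : ∀ j ∈ Finset.range m, ω ^ (-((i : ℤ) * (j : ℤ))) = ((ω ^ i)⁻¹) ^ j := by
        intro j _
        rw [zpow_neg, zpow_mul, zpow_natCast, zpow_natCast, inv_pow]
      rw [Finset.sum_congr rfl h2]
      have h3 : (ω ^ i)⁻¹ ≠ 1 := by
        rw [Ne, inv_eq_one]
        exact hω.pow_ne_one_of_pos_of_lt h (Finset.mem_range.1 hi)
      -- Orthogonality of characters: a geometric sum over the powers of a non-trivial `m`-th root
      -- of unity vanishes.
      have h4 := mul_geom_sum (ω ^ i)⁻¹ m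
      rw [inv_pow, ← pow_mul, mul_comm i, pow_mul, hω.pow_eq_one, one_pow, inv_one, sub_self] at h4
      rw [(mul_eq_zero.1 h4).resolve_left (sub_ne_zero.2 h3), zero_smul]
  rw [Finset.sum_congr rfl h1, Finset.sum_ite_eq', if_pos (Finset.mem_range.2 hm), smul_smul,
    inv_mul_cancel₀ (by exact_mod_cast hm.ne'), one_smul]

end CyclicProj

end ExtAff

namespace EALA

namespace Twist

variable {𝔤 : Type*} [LieRing 𝔤] [LieAlgebra ℂ 𝔤] {E : EALA 𝔤} {m : ℕ} {ω : ℂ}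

/-! ### The action of `σ` on root spaces -/

theorem omega_ne_zero (τ : E.Twist m ω) : ω ≠ 0 := τ.primitive.ne_zero τ.pos.ne'

theorem omega_zpow_add_mul (τ : E.Twist m ω) (r n : ℤ) : ω ^ (r + m * n) = ω ^ r := by
  rw [zpow_add₀ τ.omega_ne_zero, zpow_mul, zpow_natCast, τ.primitive.pow_eq_one, one_zpow, mul_one]

theorem sigma_apply (τ : E.Twist m ω) (x : 𝔤) : τ.sigma x = τ.σ x := rfl

theorem sigma_pow_apply (τ : E.Twist m ω) (i : ℕ) (x : 𝔤) : (τ.sigma ^ i) x = τ.σ^[i] x := by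
  rw [Module.End.pow_apply]; rfl

theorem sigma_pow_eq_one (τ : E.Twist m ω) : τ.sigma ^ m = 1 := by
  ext x
  rw [sigma_pow_apply, τ.iterate_eq]; rfl

theorem sigma_mem_cartan (τ : E.Twist m ω) {x : 𝔤} (hx : x ∈ E.cartan) : τ.σ x ∈ E.cartan := by
  have : τ.σ x ∈ E.cartan.toSubmodule.map (τ.σ.toLinearEquiv : 𝔤 →ₗ[ℂ] 𝔤) := ⟨x, hx, rfl⟩
  rwa [τ.map_cartan] at this

theorem coe_cartanEquiv (τ : E.Twist m ω) (h : E.cartan.toSubmodule) :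
    (τ.cartanEquiv h : 𝔤) = τ.σ h := rfl

theorem dualSigma_apply_cartanEquiv (τ : E.Twist m ω) (α : Module.Dual ℂ E.cartan)
    (h : E.cartan.toSubmodule) : τ.dualSigma α (τ.cartanEquiv h) = α h := by
  change α (τ.cartanEquiv.symm (τ.cartanEquiv h)) = α h
  rw [LinearEquiv.symm_apply_apply]

theorem sigma_mem_rootSpace (τ : E.Twist m ω) {α : Module.Dual ℂ E.cartan} {x : 𝔤}
    (hx : x ∈ rootSpace E.cartan α) : τ.σ x ∈ rootSpace E.cartan (τ.dualSigma α) := by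
  intro h
  obtain ⟨k, rfl⟩ := τ.cartanEquiv.surjective h
  have h1 := τ.dualSigma_apply_cartanEquiv α k
  change ⁅τ.σ (k : 𝔤), τ.σ x⁆ = _
  rw [h1, ← LieEquiv.map_lie, ← map_smul]
  exact congrArg _ (hx k)

theorem sigma_pow_mem_rootSpace (τ : E.Twist m ω) {α : Module.Dual ℂ E.cartan} {x : 𝔤}
    (hx : x ∈ rootSpace E.cartan α) (i : ℕ) :
    (τ.sigma ^ i) x ∈ rootSpace E.cartan ((τ.dualSigma ^ i) α) := by
  induction i with
  | zero => exact hx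
  | succ i ih =>
    rw [pow_succ', pow_succ']
    exact τ.sigma_mem_rootSpace ih

theorem dualSigma_pow_mem_roots (τ : E.Twist m ω) {α : Module.Dual ℂ E.cartan}
    (hα : α ∈ roots E.cartan) (i : ℕ) : (τ.dualSigma ^ i) α ∈ roots E.cartan := by
  obtain ⟨x, hx, h0⟩ := exists_ne_zero_of_mem_roots hα
  refine mem_roots_of_ne_zero (τ.sigma_pow_mem_rootSpace hx i) ?_
  induction i with
  | zero => exact h0
  | succ i ih =>
    rw [pow_succ', Module.End.mul_apply, sigma_apply]
    exact (map_ne_zero_iff _ τ.σ.injective).2 ih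

/-- The linear map `𝔥* → 𝔤`, `α ↦ t_α`. -/
def tvec (_τ : E.Twist m ω) : Module.Dual ℂ E.cartan →ₗ[ℂ] 𝔤 :=
  E.cartan.toSubmodule.subtype ∘ₗ E.isExtendedAffine.dualVecLin

theorem tvec_apply (τ : E.Twist m ω) (α : Module.Dual ℂ E.cartan) :
    τ.tvec α = (dualVec E.form E.cartan α : 𝔤) := rfl

theorem tvec_injective (τ : E.Twist m ω) : Function.Injective τ.tvec := fun _ _ h =>
  E.isExtendedAffine.dualVecLin_injective (Subtype.ext h)

theorem tvec_dualSigma (τ : E.Twist m ω) (α : Module.Dual ℂ E.cartan) :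
    τ.tvec (τ.dualSigma α) = τ.sigma (τ.tvec α) := by
  refine congrArg Subtype.val (E.isExtendedAffine.dualVec_eq
    (t := ⟨τ.σ (τ.tvec α), τ.sigma_mem_cartan (dualVec E.form E.cartan α).2⟩) fun h => ?_)
  obtain ⟨k, rfl⟩ := τ.cartanEquiv.surjective h
  refine (τ.dualSigma_apply_cartanEquiv α k).trans ?_
  rw [coe_cartanEquiv, τ.form_eq]
  exact E.isExtendedAffine.apply_eq α k

theorem tvec_dualSigma_pow (τ : E.Twist m ω) (α : Module.Dual ℂ E.cartan) (i : ℕ) :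
    τ.tvec ((τ.dualSigma ^ i) α) = (τ.sigma ^ i) (τ.tvec α) := by
  induction i with
  | zero => rfl
  | succ i ih => rw [pow_succ', pow_succ', Module.End.mul_apply, tvec_dualSigma, ih]; rfl

theorem dualSigma_pow_eq_one (τ : E.Twist m ω) : τ.dualSigma ^ m = 1 := by
  refine LinearMap.ext fun α => τ.tvec_injective ?_
  rw [tvec_dualSigma_pow, sigma_pow_eq_one]; rfl

theorem tvec_dualProj (τ : E.Twist m ω) (k : ℤ) (α : Module.Dual ℂ E.cartan) :
    τ.tvec (τ.dualProj k α) = τ.proj k (τ.tvec α) :=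
  map_cyclicProj _ τ.tvec_dualSigma _ _

theorem sigma_proj (τ : E.Twist m ω) (j : ℤ) (x : 𝔤) : τ.σ (τ.proj j x) = ω ^ j • τ.proj j x :=
  self_apply_cyclicProj τ.primitive τ.pos τ.sigma_pow_eq_one j x

theorem proj_eq_self (τ : E.Twist m ω) {j : ℤ} {x : 𝔤} (hx : τ.σ x = ω ^ j • x) :
    τ.proj j x = x :=
  cyclicProj_eq_self τ.primitive τ.pos hx

theorem sum_proj (τ : E.Twist m ω) (x : 𝔤) : ∑ j ∈ Finset.range m, τ.proj j x = x :=
  sum_cyclicProj τ.primitive τ.pos x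

theorem dualProj_dualSigma_pow (τ : E.Twist m ω) (k : ℤ) (α : Module.Dual ℂ E.cartan) (i : ℕ) :
    τ.dualProj k ((τ.dualSigma ^ i) α) = (ω ^ k) ^ i • τ.dualProj k α := by
  induction i with
  | zero => simp
  | succ i ih =>
    rw [pow_succ', Module.End.mul_apply, dualProj,
      cyclicProj_apply_self τ.primitive τ.pos τ.dualSigma_pow_eq_one, pow_succ', mul_smul]
    exact congrArg _ ih

theorem proj_mem_cartan (τ : E.Twist m ω) {x : 𝔤} (hx : x ∈ E.cartan) (j : ℤ) :
    τ.proj j x ∈ E.cartan := by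
  have h : ∀ i : ℕ, (τ.sigma ^ i) x ∈ E.cartan := by
    intro i
    induction i with
    | zero => exact hx
    | succ i ih => rw [pow_succ']; exact τ.sigma_mem_cartan ih
  rw [proj, cyclicProj_apply]
  exact E.cartan.smul_mem _ (sum_mem fun i _ => E.cartan.smul_mem _ (h i))

theorem form_sigma_pow (τ : E.Twist m ω) (i : ℕ) (x y : 𝔤) :
    E.form ((τ.sigma ^ i) x) ((τ.sigma ^ i) y) = E.form x y := by
  induction i with
  | zero => rfl
  | succ i ih =>
    rw [pow_succ', Module.End.mul_apply, Module.End.mul_apply, sigma_apply, sigma_apply,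
      τ.form_eq, ih]

theorem sigma_pow_eq_smul (τ : E.Twist m ω) {s : ℤ} {y : 𝔤} (hy : τ.σ y = ω ^ s • y) (i : ℕ) :
    (τ.sigma ^ i) y = (ω ^ s) ^ i • y := by
  induction i with
  | zero => simp
  | succ i ih =>
    rw [pow_succ', Module.End.mul_apply, ih, map_smul, sigma_apply, hy, smul_smul, pow_succ]

/-- Invariance under `σ` makes every term of the average equal to `(x, y)`, since the scalar from
`σ^i y` cancels the character. -/
theorem form_proj (τ : E.Twist m ω) {j s : ℤ} (hjs : j + s = 0) (x : 𝔤) {y : 𝔤}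
    (hy : τ.σ y = ω ^ s • y) : E.form (τ.proj j x) y = E.form x y := by
  have h0 := τ.omega_ne_zero
  have h : ∀ i : ℕ, ω ^ (-((i : ℤ) * j)) * E.form ((τ.sigma ^ i) x) y = E.form x y := by
    intro i
    rw [← τ.form_sigma_pow i x y, τ.sigma_pow_eq_smul hy, map_smul, smul_eq_mul]
    congr 1
    rw [← zpow_natCast, ← zpow_mul]
    congr 1
    linear_combination (-i : ℤ) * hjs
  rw [proj, cyclicProj_apply, map_smul, LinearMap.smul_apply, map_sum, LinearMap.sum_apply]
  simp only [map_smul, LinearMap.smul_apply, smul_eq_mul, h]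
  rw [Finset.sum_const, Finset.card_range, nsmul_eq_mul, ← mul_assoc,
    inv_mul_cancel₀ (by exact_mod_cast τ.pos.ne'), one_mul]

/-- The factor that `σ^i` produces on `y` converts the degree `k` projection into the degree `r`
one. Brackets of eigenvectors can thus be computed from single root vectors. -/
theorem lie_proj (τ : E.Twist m ω) {k r s : ℤ} (hk : r + s = k) (x : 𝔤) {y : 𝔤}
    (hy : τ.σ y = ω ^ s • y) : τ.proj k ⁅x, y⁆ = ⁅τ.proj r x, y⁆ := by
  have h0 := τ.omega_ne_zero
  have hlie : ∀ i : ℕ, (τ.sigma ^ i) ⁅x, y⁆ = ⁅(τ.sigma ^ i) x, (τ.sigma ^ i) y⁆ := by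
    intro i
    induction i with
    | zero => rfl
    | succ i ih =>
      rw [pow_succ', Module.End.mul_apply, Module.End.mul_apply, Module.End.mul_apply, ih,
        sigma_apply, LieEquiv.map_lie]; rfl
  rw [proj, cyclicProj_apply, proj, cyclicProj_apply, smul_lie, sum_lie]
  congr 1
  refine Finset.sum_congr rfl fun i _ => ?_
  rw [hlie, τ.sigma_pow_eq_smul hy, lie_smul, smul_smul, smul_lie, ← zpow_natCast, ← zpow_mul,
    ← zpow_add₀ h0]
  congr 2
  linear_combination (i : ℤ) * hk

/-- `π` is self-adjoint for the form. This lets `π(α)` be handled as the restriction of `α` to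
`𝔥^σ`. -/
theorem proj_zero_apply (τ : E.Twist m ω) (α : Module.Dual ℂ E.cartan) (h : E.cartan) :
    τ.dualProj 0 α h = α ⟨τ.proj 0 h, τ.proj_mem_cartan h.2 0⟩ := by
  have h1 := τ.form_proj (add_zero 0) (h : 𝔤) (by simpa using τ.sigma_proj 0 (τ.tvec α))
  have h2 := τ.form_proj (add_zero 0) (τ.tvec α) (by simpa using τ.sigma_proj 0 (h : 𝔤))
  rw [E.isExtendedAffine.apply_eq, E.isExtendedAffine.apply_eq α, ← τ.tvec_apply, ← τ.tvec_apply,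
    tvec_dualProj, ← h1, E.isExtendedAffine.symm, h2, E.isExtendedAffine.symm]

theorem proj_zero_apply_of_fixed (τ : E.Twist m ω) (α : Module.Dual ℂ E.cartan) {h : E.cartan}
    (hh : τ.σ h = h) : τ.dualProj 0 α h = α h := by
  rw [proj_zero_apply]
  congr 1
  exact Subtype.ext (τ.proj_eq_self (by simpa using hh))

/-- `α` and `β` agree on `𝔥^σ`. -/
def SameRestriction (τ : E.Twist m ω) (α β : Module.Dual ℂ E.cartan) : Prop :=
  ∀ h : E.cartan, τ.σ h = h → α h = β h

theorem dualProj_eq_iff (τ : E.Twist m ω) {α β : Module.Dual ℂ E.cartan} :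
    τ.dualProj 0 α = τ.dualProj 0 β ↔ τ.SameRestriction α β := by
  constructor
  · intro h x hx
    rw [← τ.proj_zero_apply_of_fixed α hx, h, τ.proj_zero_apply_of_fixed β hx]
  · intro h
    ext x
    rw [proj_zero_apply, proj_zero_apply]
    exact h _ (by simpa using τ.sigma_proj 0 (x : 𝔤))

theorem sameRestriction_dualProj (τ : E.Twist m ω) (α : Module.Dual ℂ E.cartan) :
    τ.SameRestriction (τ.dualProj 0 α) α := fun _ hh => τ.proj_zero_apply_of_fixed α hh

theorem SameRestriction.symm {τ : E.Twist m ω} {α β : Module.Dual ℂ E.cartan}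
    (h : τ.SameRestriction α β) : τ.SameRestriction β α := fun x hx => (h x hx).symm

theorem SameRestriction.trans {τ : E.Twist m ω} {α β γ : Module.Dual ℂ E.cartan}
    (h : τ.SameRestriction α β) (h' : τ.SameRestriction β γ) : τ.SameRestriction α γ :=
  fun x hx => (h x hx).trans (h' x hx)

theorem SameRestriction.neg {τ : E.Twist m ω} {α β : Module.Dual ℂ E.cartan}
    (h : τ.SameRestriction α β) : τ.SameRestriction (-α) (-β) :=
  fun x hx => congrArg Neg.neg (h x hx)

/-! ### The form on `π(𝔥*)` -/

/-- The transferred form on `𝔥*`. -/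
def kform (_τ : E.Twist m ω) : LinearMap.BilinForm ℂ (Module.Dual ℂ E.cartan) :=
  E.isExtendedAffine.kform

theorem kform_apply (τ : E.Twist m ω) (α β : Module.Dual ℂ E.cartan) :
    τ.kform α β = dualForm E.form E.cartan α β := rfl

theorem kform_eq_form (τ : E.Twist m ω) (α β : Module.Dual ℂ E.cartan) :
    τ.kform α β = E.form (τ.tvec α) (τ.tvec β) := rfl

theorem kform_symm (τ : E.Twist m ω) (α β : Module.Dual ℂ E.cartan) :
    τ.kform α β = τ.kform β α := E.isExtendedAffine.kform_symm α β

theorem kform_dualProj (τ : E.Twist m ω) (α β : Module.Dual ℂ E.cartan) :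
    τ.kform (τ.dualProj 0 α) (τ.dualProj 0 β) = τ.kform α (τ.dualProj 0 β) := by
  rw [kform_eq_form, kform_eq_form, tvec_dualProj, tvec_dualProj]
  exact τ.form_proj (add_zero 0) _ (by simpa using τ.sigma_proj 0 (τ.tvec β))

theorem kform_dualSigma_pow (τ : E.Twist m ω) (α β : Module.Dual ℂ E.cartan) (i : ℕ) :
    τ.kform ((τ.dualSigma ^ i) α) ((τ.dualSigma ^ i) β) = τ.kform α β := by
  rw [kform_eq_form, kform_eq_form, tvec_dualSigma_pow, tvec_dualSigma_pow, form_sigma_pow]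

theorem smul_dualProj_zero (τ : E.Twist m ω) (α : Module.Dual ℂ E.cartan) :
    (m : ℂ) • τ.dualProj 0 α = ∑ i ∈ Finset.range m, (τ.dualSigma ^ i) α := by
  rw [dualProj, cyclicProj_apply, smul_smul, mul_inv_cancel₀ (by exact_mod_cast τ.pos.ne'),
    one_smul]
  simp

theorem mem_piRoots_iff (τ : E.Twist m ω) {α : Module.Dual ℂ E.cartan} : α ∈ τ.piRoots ↔
    α ∈ roots E.cartan ∧ τ.kform (τ.dualProj 0 α) (τ.dualProj 0 α) ≠ 0 := by
  constructor
  · rintro ⟨h1, h2⟩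
    exact ⟨h1.1, h2⟩
  · rintro ⟨h1, h2⟩
    refine ⟨E.isExtendedAffine.mem_nonisoRoots_iff.2 ⟨h1, fun h0 => h2 ?_⟩, h2⟩
    rw [kform_dualProj, kform_symm]
    -- An isotropic root is orthogonal to all its conjugates, whose sum is `m π(α)`; hence `π(α)` is
    -- isotropic too.
    apply mul_left_cancel₀ (by exact_mod_cast τ.pos.ne' : (m : ℂ) ≠ 0)
    rw [mul_zero, ← smul_eq_mul, ← LinearMap.smul_apply, ← map_smul, smul_dualProj_zero, map_sum,
      LinearMap.sum_apply]
    exact Finset.sum_eq_zero fun i _ =>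
      E.isExtendedAffine.kform_eq_zero_of_isotropic h1 h0 (τ.dualSigma_pow_mem_roots h1 i)

theorem mem_piRoots_of_sameRestriction (τ : E.Twist m ω) {α β : Module.Dual ℂ E.cartan}
    (hα : α ∈ τ.piRoots) (hβ : β ∈ roots E.cartan) (h : τ.SameRestriction β α) :
    β ∈ τ.piRoots := by
  rw [mem_piRoots_iff] at hα ⊢
  rw [τ.dualProj_eq_iff.2 h]
  exact ⟨hβ, hα.2⟩

theorem neg_mem_piRoots (τ : E.Twist m ω) {α : Module.Dual ℂ E.cartan}
    (hα : α ∈ τ.piRoots) : -α ∈ τ.piRoots := by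
  rw [mem_piRoots_iff] at hα ⊢
  exact ⟨E.isExtendedAffine.neg_mem_roots hα.1, by simpa using hα.2⟩

theorem dualSigma_pow_mem_piRoots (τ : E.Twist m ω) {α : Module.Dual ℂ E.cartan}
    (hα : α ∈ τ.piRoots) (i : ℕ) : (τ.dualSigma ^ i) α ∈ τ.piRoots := by
  rw [mem_piRoots_iff] at hα ⊢
  refine ⟨τ.dualSigma_pow_mem_roots hα.1 i, ?_⟩
  rw [dualProj_dualSigma_pow]
  simpa using hα.2

theorem sameRestriction_dualSigma_pow (τ : E.Twist m ω) (α : Module.Dual ℂ E.cartan) (i : ℕ) :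
    τ.SameRestriction ((τ.dualSigma ^ i) α) α := by
  rw [← dualProj_eq_iff, dualProj_dualSigma_pow, zpow_zero, one_pow, one_smul]

theorem norm_kform_dualProj_le (τ : E.Twist m ω) {α β : Module.Dual ℂ E.cartan}
    (hα : α ∈ nonisoRoots E.form E.cartan) (hβ : β ∈ roots E.cartan) :
    ‖τ.kform β (τ.dualProj 0 α)‖ ≤ 2 * ‖τ.kform α α‖ := by
  have hm : (0 : ℝ) < m := by exact_mod_cast τ.pos
  apply le_of_mul_le_mul_left _ hm
  have h1 : (m : ℝ) * ‖τ.kform β (τ.dualProj 0 α)‖ =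
      ‖∑ i ∈ Finset.range m, τ.kform β ((τ.dualSigma ^ i) α)‖ := by
    rw [← map_sum, ← smul_dualProj_zero, map_smul, smul_eq_mul, norm_mul, Complex.norm_natCast]
  rw [h1]
  refine (norm_sum_le _ _).trans ?_
  refine (Finset.sum_le_sum (g := fun _ => 2 * ‖τ.kform α α‖) fun i _ => ?_).trans ?_
  · have h2 : (τ.dualSigma ^ i) α ∈ nonisoRoots E.form E.cartan := by
      refine ⟨τ.dualSigma_pow_mem_roots hα.1 i, ?_⟩
      rw [← τ.kform_apply, kform_dualSigma_pow]
      exact hα.2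
    have := E.isExtendedAffine.norm_kform_le h2 hβ
    rwa [show E.isExtendedAffine.kform ((τ.dualSigma ^ i) α) ((τ.dualSigma ^ i) α) =
      τ.kform α α from τ.kform_dualSigma_pow α α i] at this
  · rw [Finset.sum_const, Finset.card_range, nsmul_eq_mul]

/-! ### Simultaneous eigenspaces for `σ` and `𝔥^σ` -/

/-- The vectors of weight `a` under `𝔥^σ` in the eigenspace of `σ` for `ω ^ r`. -/
def eigWeight (τ : E.Twist m ω) (a : Module.Dual ℂ E.cartan) (r : ℤ) : Submodule ℂ 𝔤 where
  carrier := {x | τ.σ x = ω ^ r • x ∧ ∀ h : E.cartan, τ.σ h = h → ⁅(h : 𝔤), x⁆ = a h • x}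
  zero_mem' := by simp
  add_mem' := by
    rintro x y ⟨hx, hx'⟩ ⟨hy, hy'⟩
    refine ⟨by rw [map_add, hx, hy, smul_add], fun h hh => ?_⟩
    rw [lie_add, hx' h hh, hy' h hh, smul_add]
  smul_mem' := by
    rintro c x ⟨hx, hx'⟩
    refine ⟨by rw [map_smul, hx, smul_comm], fun h hh => ?_⟩
    rw [lie_smul, hx' h hh, smul_comm]

theorem eigWeight_congr (τ : E.Twist m ω) {a b : Module.Dual ℂ E.cartan} {r s : ℤ} {x : 𝔤}
    (hx : x ∈ τ.eigWeight a r) (hab : τ.SameRestriction a b) (hrs : ω ^ r = ω ^ s) :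
    x ∈ τ.eigWeight b s :=
  ⟨by rw [hx.1, hrs], fun h hh => by rw [hx.2 h hh, hab h hh]⟩

theorem lie_mem_eigWeight (τ : E.Twist m ω) {a b : Module.Dual ℂ E.cartan} {r s : ℤ} {x y : 𝔤}
    (hx : x ∈ τ.eigWeight a r) (hy : y ∈ τ.eigWeight b s) :
    ⁅x, y⁆ ∈ τ.eigWeight (a + b) (r + s) := by
  refine ⟨?_, fun h hh => ?_⟩
  · rw [LieEquiv.map_lie, hx.1, hy.1, zpow_add₀ τ.omega_ne_zero, smul_lie, lie_smul, smul_smul]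
  · rw [leibniz_lie, hx.2 h hh, hy.2 h hh, smul_lie, lie_smul, LinearMap.add_apply, add_smul]

theorem ad_pow_mem_eigWeight (τ : E.Twist m ω) {a b : Module.Dual ℂ E.cartan} {r s : ℤ} {x y : 𝔤}
    (hx : x ∈ τ.eigWeight a r) (hy : y ∈ τ.eigWeight b s) (n : ℕ) :
    ((LieAlgebra.ad ℂ 𝔤 x) ^ n) y ∈ τ.eigWeight (b + n • a) (s + n * r) := by
  induction n with
  | zero => simpa using hy
  | succ n ih =>
    rw [ad_pow_succ_apply]
    have := τ.lie_mem_eigWeight hx ih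
    rwa [show a + (b + n • a) = b + (n + 1) • a by rw [succ_nsmul]; abel,
      show r + (s + n * r) = s + ((n + 1 : ℕ) : ℤ) * r by push_cast; ring] at this

theorem proj_mem_eigWeight (τ : E.Twist m ω) {a β : Module.Dual ℂ E.cartan} {x : 𝔤}
    (hx : x ∈ rootSpace E.cartan β) (hβ : τ.SameRestriction β a) (r : ℤ) :
    τ.proj r x ∈ τ.eigWeight a r := by
  refine ⟨τ.sigma_proj r x, fun h hh => ?_⟩
  have h1 := τ.lie_proj (add_zero r) x (y := (h : 𝔤)) (by simpa using hh)
  rw [← lie_skew, ← h1, ← lie_skew, hx h, map_neg, neg_neg, map_smul, hβ h hh]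

theorem mem_cartan_of_mem_eigWeight_zero (τ : E.Twist m ω) {x : 𝔤} (hx : x ∈ τ.eigWeight 0 0) :
    x ∈ E.cartan ∧ τ.σ x = x := by
  have h1 : τ.σ x = x := by simpa using hx.1
  have : x ∈ {x : 𝔤 | x ∈ E.cartan ∧ τ.σ x = x} := by
    rw [← τ.centralizer_eq]
    exact ⟨h1, fun h hh hs => by simpa using hx.2 ⟨h, hh⟩ hs⟩
  exact this

/-- A non-zero `x` pairs non-trivially with some root space; testing invariance against `h ∈ 𝔥^σ`
forces the weight of that space to restrict to `-a`. -/
theorem exists_root_of_mem_eigWeight (τ : E.Twist m ω) {a : Module.Dual ℂ E.cartan} {r : ℤ}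
    {x : 𝔤} (hx : x ∈ τ.eigWeight a r) (h0 : x ≠ 0) : ∃ γ ∈ roots E.cartan,
      τ.SameRestriction γ a ∧ ∃ y ∈ rootSpace E.cartan (-γ), E.form x y ≠ 0 := by
  have hE := E.isExtendedAffine
  obtain ⟨β, y, hy, hxy⟩ : ∃ β, ∃ y ∈ rootSpace E.cartan β, E.form x y ≠ 0 := by
    by_contra hc
    push Not at hc
    exact h0 (hE.eq_zero_of_forall_rootSpace hc)
  have hβ : β ∈ roots E.cartan := mem_roots_of_ne_zero hy (by rintro rfl; simp at hxy)
  refine ⟨-β, hE.neg_mem_roots hβ, fun h hh => ?_, y, by rwa [neg_neg], hxy⟩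
  have h1 : E.form ⁅x, (h : 𝔤)⁆ y = E.form x ⁅(h : 𝔤), y⁆ := hE.invariant _ _ _
  rw [← lie_skew, hx.2 h hh, hy h, map_neg, LinearMap.neg_apply, map_smul, LinearMap.smul_apply,
    map_smul, smul_eq_mul, smul_eq_mul] at h1
  rw [LinearMap.neg_apply]
  apply mul_right_cancel₀ hxy
  linear_combination h1

/-- Split `x` into root components over `a` and the rest `x₂`. The rest also has `𝔥^σ`-weight `a`,
hence is orthogonal to root spaces not over `-a`; it is orthogonal to those over `-a` because its
components lie elsewhere. So `x₂ = 0`. -/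
theorem eigWeight_le_iSup (τ : E.Twist m ω) (a : Module.Dual ℂ E.cartan) (r : ℤ) :
    τ.eigWeight a r ≤ ⨆ γ ∈ {γ | τ.SameRestriction γ a}, rootSpace E.cartan γ := by
  intro x hx
  have hE := E.isExtendedAffine
  have hx' : x ∈ (⨆ γ ∈ {γ | τ.SameRestriction γ a}, rootSpace E.cartan γ) ⊔
      ⨆ γ ∈ {γ | ¬ τ.SameRestriction γ a}, rootSpace E.cartan γ := by
    have : x ∈ ⨆ γ : Module.Dual ℂ E.cartan, rootSpace E.cartan γ := by rw [hE.splitting]; trivial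
    suffices hle : ⨆ γ : Module.Dual ℂ E.cartan, rootSpace E.cartan γ ≤
        (⨆ γ ∈ {γ | τ.SameRestriction γ a}, rootSpace E.cartan γ) ⊔
          ⨆ γ ∈ {γ | ¬ τ.SameRestriction γ a}, rootSpace E.cartan γ from hle this
    refine iSup_le fun γ => ?_
    by_cases h : τ.SameRestriction γ a
    · exact (le_biSup (rootSpace E.cartan) (show γ ∈ {γ | τ.SameRestriction γ a} from h)).trans
        le_sup_left
    · exact (le_biSup (rootSpace E.cartan) (show γ ∈ {γ | ¬ τ.SameRestriction γ a} from h)).trans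
        le_sup_right
  obtain ⟨x₁, h₁, x₂, h₂, rfl⟩ := Submodule.mem_sup.1 hx'
  suffices x₂ = 0 by rwa [this, add_zero]
  have hw : ∀ h : E.cartan, τ.σ h = h → ⁅(h : 𝔤), x₂⁆ = a h • x₂ := by
    intro h hh
    have e1 : ⁅(h : 𝔤), x₁⁆ = a h • x₁ := by
      clear hx hx' h₂
      induction h₁ using Submodule.iSup_induction' with
      | mem γ y hy =>
        induction hy using Submodule.iSup_induction' with
        | mem hγ y hy => rw [hy h, hγ h hh]
        | zero => simp
        | add y z _ _ hy hz => rw [lie_add, hy, hz, smul_add]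
      | zero => simp
      | add y z _ _ hy hz => rw [lie_add, hy, hz, smul_add]
    have e2 := hx.2 h hh
    rw [lie_add, smul_add, e1] at e2
    exact add_left_cancel e2
  refine hE.eq_zero_of_forall_rootSpace fun β y hy => ?_
  by_cases hβ : τ.SameRestriction (-β) a
  · clear hx hx' hw
    induction h₂ using Submodule.iSup_induction' with
    | mem γ z hz =>
      induction hz using Submodule.iSup_induction' with
      | mem hγ z hz =>
        refine hE.form_eq_zero hz hy fun h => hγ ?_
        rwa [eq_neg_of_add_eq_zero_left h]
      | zero => simp
      | add y z _ _ hy hz => rw [map_add, LinearMap.add_apply, hy, hz, add_zero]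
    | zero => simp
    | add y z _ _ hy hz => rw [map_add, LinearMap.add_apply, hy, hz, add_zero]
  · by_contra hne
    apply hβ
    intro h hh
    have h1 : E.form ⁅x₂, (h : 𝔤)⁆ y = E.form x₂ ⁅(h : 𝔤), y⁆ := hE.invariant _ _ _
    rw [← lie_skew, hw h hh, hy h, map_neg, LinearMap.neg_apply, map_smul, LinearMap.smul_apply,
      map_smul, smul_eq_mul, smul_eq_mul] at h1
    rw [LinearMap.neg_apply]
    apply mul_right_cancel₀ hne
    linear_combination h1

theorem exists_form_eq_of_mem_eigWeight (τ : E.Twist m ω) {a : Module.Dual ℂ E.cartan} {r : ℤ}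
    {x : 𝔤} (hx : x ∈ τ.eigWeight a r) (h0 : x ≠ 0) (c : ℂ) :
    ∃ y ∈ τ.eigWeight (-a) (-r), E.form x y = c := by
  obtain ⟨γ, -, hγa, y, hy, hxy⟩ := τ.exists_root_of_mem_eigWeight hx h0
  have h1 : E.form x (τ.proj (-r) y) = E.form x y := by
    rw [E.isExtendedAffine.symm, τ.form_proj (neg_add_cancel r) y hx.1, E.isExtendedAffine.symm]
  refine ⟨(c / E.form x y) • τ.proj (-r) y,
    Submodule.smul_mem _ _ (τ.proj_mem_eigWeight hy hγa.neg _), ?_⟩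
  rw [map_smul, h1, smul_eq_mul, div_mul_cancel₀ _ hxy]

/-! ### Ad-nilpotency and `sl₂`-triples for `R_π^×` -/

theorem lie_eq_smul_tvec (τ : E.Twist m ω) {a : Module.Dual ℂ E.cartan} {r : ℤ} {x y : 𝔤}
    (hx : x ∈ τ.eigWeight a r) (hy : y ∈ τ.eigWeight (-a) (-r)) :
    ⁅x, y⁆ = E.form x y • τ.tvec (τ.dualProj 0 a) := by
  have hE := E.isExtendedAffine
  have h1 := τ.lie_mem_eigWeight hx hy
  rw [add_neg_cancel, add_neg_cancel] at h1
  obtain ⟨h2, h3⟩ := τ.mem_cartan_of_mem_eigWeight_zero h1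
  have h4 : τ.σ (τ.tvec (τ.dualProj 0 a)) = τ.tvec (τ.dualProj 0 a) := by
    rw [tvec_dualProj, sigma_proj, zpow_zero, one_smul]
  have h5 : τ.tvec (τ.dualProj 0 a) ∈ E.cartan := (dualVec E.form E.cartan (τ.dualProj 0 a)).2
  rw [← sub_eq_zero]
  refine hE.eq_zero_of_mem_cartan (sub_mem h2 (E.cartan.smul_mem _ h5)) fun k hk => ?_
  -- Both sides are fixed by `σ`, so the test vector `k ∈ 𝔥` may be replaced by `π(k) ∈ 𝔥^σ`, where
  -- the weight of `x` is known.
  rw [hE.symm, ← τ.form_proj (add_zero 0) k (by simp [h3, h4])]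
  have h6 : τ.σ (τ.proj 0 k) = τ.proj 0 k := by simpa using τ.sigma_proj 0 k
  have h7 := τ.proj_mem_cartan hk 0
  rw [map_sub, map_smul, ← hE.invariant, hx.2 ⟨_, h7⟩ h6, map_smul, LinearMap.smul_apply]
  have h8 := hE.apply_eq (τ.dualProj 0 a) ⟨_, h7⟩
  rw [τ.proj_zero_apply_of_fixed a h6] at h8
  rw [h8, smul_eq_mul, smul_eq_mul, mul_comm, tvec_apply, sub_self]

/-- As `x` is in general a sum of root vectors, local nilpotency of root vectors does not apply.
Instead, if all iterates were non-zero, there would be roots restricting to `b + nα` for every `n`;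
their values at `t_{π(α)}` are unbounded, against `norm_kform_dualProj_le`. -/
theorem exists_ad_pow_eq_zero (τ : E.Twist m ω) {α b : Module.Dual ℂ E.cartan}
    (hα : α ∈ τ.piRoots) {r s : ℤ} {x y : 𝔤} (hx : x ∈ τ.eigWeight α r)
    (hy : y ∈ τ.eigWeight b s) : ∃ n, ((LieAlgebra.ad ℂ 𝔤 x) ^ n) y = 0 := by
  by_contra hc
  push Not at hc
  set t := dualVec E.form E.cartan (τ.dualProj 0 α) with ht
  have hfix : τ.σ (t : 𝔤) = t := by
    change τ.σ (τ.tvec (τ.dualProj 0 α)) = τ.tvec (τ.dualProj 0 α)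
    rw [tvec_dualProj, sigma_proj, zpow_zero, one_smul]
  have hαt : α t ≠ 0 := by
    have := hα.2
    rwa [← τ.kform_apply, kform_dualProj, show τ.kform α (τ.dualProj 0 α) = α t from
      E.isExtendedAffine.kform_eq_apply _ _] at this
  have key : ∀ n : ℕ, ‖b t + n * α t‖ ≤ 2 * ‖τ.kform α α‖ := by
    intro n
    obtain ⟨γ, hγ, hγr, -⟩ := τ.exists_root_of_mem_eigWeight (τ.ad_pow_mem_eigWeight hx hy n) (hc n)
    have h1 := τ.norm_kform_dualProj_le hα.1 hγ
    rwa [show τ.kform γ (τ.dualProj 0 α) = γ t from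
      E.isExtendedAffine.kform_eq_apply _ _, hγr t hfix, LinearMap.add_apply, LinearMap.smul_apply,
      nsmul_eq_mul] at h1
  have hpos : 0 < ‖α t‖ := norm_pos_iff.2 hαt
  obtain ⟨n, hn⟩ := exists_nat_gt ((2 * ‖τ.kform α α‖ + ‖b t‖) / ‖α t‖)
  rw [div_lt_iff₀ hpos] at hn
  have h2 := norm_sub_le (b t + n * α t) (b t)
  rw [add_sub_cancel_left, norm_mul, Complex.norm_natCast] at h2
  linarith [key n]

/-- The element `2 t_{π(α)} / (π(α), π(α))`. -/
def coroot (τ : E.Twist m ω) (α : Module.Dual ℂ E.cartan) : 𝔤 :=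
  (2 / τ.kform (τ.dualProj 0 α) (τ.dualProj 0 α)) • τ.tvec (τ.dualProj 0 α)

theorem lie_coroot (τ : E.Twist m ω) (α : Module.Dual ℂ E.cartan) {b : Module.Dual ℂ E.cartan}
    {s : ℤ} {x : 𝔤} (hx : x ∈ τ.eigWeight b s) : ⁅τ.coroot α, x⁆ =
      (2 * τ.kform b (τ.dualProj 0 α) / τ.kform (τ.dualProj 0 α) (τ.dualProj 0 α)) • x := by
  have hfix : τ.σ (τ.tvec (τ.dualProj 0 α)) = τ.tvec (τ.dualProj 0 α) := by
    rw [tvec_dualProj, sigma_proj, zpow_zero, one_smul]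
  rw [coroot, smul_lie, tvec_apply, hx.2 (dualVec E.form E.cartan (τ.dualProj 0 α)) hfix, smul_smul, kform,
    E.isExtendedAffine.kform_eq_apply b]
  congr 1
  ring

theorem exists_sl2 (τ : E.Twist m ω) {α : Module.Dual ℂ E.cartan} (hα : α ∈ τ.piRoots) {r : ℤ}
    {x : 𝔤} (hx : x ∈ τ.eigWeight α r) (h0 : x ≠ 0) :
    ∃ y ∈ τ.eigWeight (-α) (-r), IsSl2Triple (τ.coroot α) x y := by
  have hc : τ.kform (τ.dualProj 0 α) (τ.dualProj 0 α) ≠ 0 := hα.2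
  obtain ⟨y, hy, hxy⟩ := τ.exists_form_eq_of_mem_eigWeight hx h0
    (2 / τ.kform (τ.dualProj 0 α) (τ.dualProj 0 α))
  have hx2 : ⁅τ.coroot α, x⁆ = (2 : ℂ) • x := by
    rw [τ.lie_coroot α hx, ← kform_dualProj, mul_div_cancel_right₀ _ hc]
  refine ⟨y, hy, ?_, ?_, ?_, ?_⟩
  · intro h
    rw [h, zero_lie, eq_comm] at hx2
    exact (smul_ne_zero two_ne_zero h0) hx2
  · rw [τ.lie_eq_smul_tvec hx hy, hxy, coroot]
  · rw [hx2, two_smul, two_smul]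
  · rw [τ.lie_coroot α hy, map_neg, LinearMap.neg_apply, ← kform_dualProj, mul_neg, neg_div,
      mul_div_cancel_right₀ _ hc, neg_smul, two_smul, two_smul]

theorem lie_coroot_self (τ : E.Twist m ω) {α : Module.Dual ℂ E.cartan} (hα : α ∈ τ.piRoots) {r : ℤ}
    {x : 𝔤} (hx : x ∈ τ.eigWeight α r) : ⁅τ.coroot α, x⁆ = (2 : ℂ) • x := by
  have hc : τ.kform (τ.dualProj 0 α) (τ.dualProj 0 α) ≠ 0 := hα.2
  rw [τ.lie_coroot α hx, ← kform_dualProj, mul_div_cancel_right₀ _ hc]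

/-- The eigenspaces of `σ` on the weight space of `𝔥^σ` for `α ∈ R_π^×` are at most
one-dimensional. -/
theorem exists_smul_eq (τ : E.Twist m ω) {α : Module.Dual ℂ E.cartan} (hα : α ∈ τ.piRoots) {r : ℤ}
    {x z : 𝔤} (hx : x ∈ τ.eigWeight α r) (h0 : x ≠ 0) (hz : z ∈ τ.eigWeight α r) :
    ∃ c : ℂ, z = c • x := by
  obtain ⟨y, hy, t⟩ := τ.exists_sl2 hα hx h0
  have hne : E.form x y ≠ 0 := by
    intro h
    have := τ.lie_eq_smul_tvec hx hy
    rw [h, zero_smul, t.lie_e_f] at this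
    exact t.h_ne_zero this
  -- With this coefficient `w = z - c x` is orthogonal to `y`, so `[y, w] = 0`; a vector of weight
  -- `2` killed by the lowering operator vanishes.
  refine ⟨E.form z y / E.form x y, ?_⟩
  rw [← sub_eq_zero]
  have hw : z - (E.form z y / E.form x y) • x ∈ τ.eigWeight α r :=
    sub_mem hz (Submodule.smul_mem _ _ hx)
  refine eq_zero_of_lie_lie_eq_zero t (τ.lie_coroot_self hα hw) ?_ (fun n => ?_)
    (τ.exists_ad_pow_eq_zero hα hx hw)
  · rw [← lie_skew y, τ.lie_eq_smul_tvec hw hy, map_sub, map_smul, LinearMap.sub_apply,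
      LinearMap.smul_apply, smul_eq_mul, div_mul_cancel₀ _ hne, sub_self, zero_smul, neg_zero,
      lie_zero]
  · exact_mod_cast (by omega : (2 : ℕ) + n ≠ 0)

/-- Elements of opposite degrees in the centralizer of `𝔥^σ` commute. -/
theorem lie_eq_zero_of_mem_eigWeight_zero (τ : E.Twist m ω) {j : ℤ} {x y : 𝔤}
    (hx : x ∈ τ.eigWeight 0 j) (hy : y ∈ τ.eigWeight 0 (-j)) : ⁅x, y⁆ = 0 := by
  rw [τ.lie_eq_smul_tvec hx (by rwa [neg_zero]), map_zero, map_zero, smul_zero]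

/-- Shifting operators between the eigenspaces of `σ` on a weight space. -/
theorem exists_shift (τ : E.Twist m ω) {α : Module.Dual ℂ E.cartan} (hα : α ∈ τ.piRoots)
    {r s : ℤ} {x z : 𝔤} (hx : x ∈ τ.eigWeight α r) (hx0 : x ≠ 0) (hz : z ∈ τ.eigWeight α s)
    (hz0 : z ≠ 0) : ∃ a ∈ τ.eigWeight 0 (s - r), ∃ b ∈ τ.eigWeight 0 (r - s),
      ∃ c d : ℂ, c ≠ 0 ∧ d ≠ 0 ∧ ⁅a, x⁆ = c • z ∧ ⁅b, z⁆ = d • x := by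
  have hE := E.isExtendedAffine
  obtain ⟨y, hy, t⟩ := τ.exists_sl2 hα hx hx0
  obtain ⟨w, hw, t'⟩ := τ.exists_sl2 hα hz hz0
  have ha : ⁅z, y⁆ ∈ τ.eigWeight 0 (s - r) := by
    simpa [sub_eq_add_neg] using τ.lie_mem_eigWeight hz hy
  have hb : ⁅x, w⁆ ∈ τ.eigWeight 0 (r - s) := by
    simpa [sub_eq_add_neg] using τ.lie_mem_eigWeight hx hw
  have hax : ⁅⁅z, y⁆, x⁆ ∈ τ.eigWeight α s := by
    simpa using τ.lie_mem_eigWeight ha hx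
  have hbz : ⁅⁅x, w⁆, z⁆ ∈ τ.eigWeight α r := by
    simpa using τ.lie_mem_eigWeight hb hz
  obtain ⟨c, hc⟩ := τ.exists_smul_eq hα hz hz0 hax
  obtain ⟨d, hd⟩ := τ.exists_smul_eq hα hx hx0 hbz
  -- Otherwise `(ad x)(ad y)` would kill `z`, which has positive weight.
  have hne : ⁅⁅z, y⁆, x⁆ ≠ 0 := by
    intro h0
    refine hz0 (eq_zero_of_lie_lie_eq_zero t (τ.lie_coroot_self hα hz) ?_ (fun n => ?_)
      (τ.exists_ad_pow_eq_zero hα hx hz))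
    · rw [← lie_skew y, lie_neg, neg_eq_zero, ← lie_skew, h0, neg_zero]
    · exact_mod_cast (by omega : (2 : ℕ) + n ≠ 0)
  have hc0 : c ≠ 0 := by
    rintro rfl
    exact hne (by rw [hc, zero_smul])
  have e1 : E.form ⁅⁅z, y⁆, x⁆ w = E.form ⁅z, y⁆ ⁅x, w⁆ := hE.invariant _ _ _
  have e2 : E.form ⁅⁅x, w⁆, z⁆ y = E.form ⁅x, w⁆ ⁅z, y⁆ := hE.invariant _ _ _
  have hzw : E.form z w ≠ 0 := by
    intro h
    have := τ.lie_eq_smul_tvec hz hw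
    rw [h, zero_smul, t'.lie_e_f] at this
    exact t'.h_ne_zero this
  -- By invariance `c (z, w)` and `d (x, y)` both equal `([z, y], [x, w])`.
  have hd0 : d ≠ 0 := by
    rintro rfl
    rw [hE.symm ⁅x, w⁆, ← e1, hc, hd] at e2
    simp [hc0, hzw] at e2
  exact ⟨_, ha, _, hb, c, d, hc0, hd0, hc, hd⟩

end Twist

end EALA

/-! ### Sets of integers closed under reflections in their points -/

namespace ExtAff

/-- A set of integers closed under `(a, b) ↦ 2a - b` that has two distinct elements is a coset of
a subgroup, provided that it contains `r₀ + m` for some period `m ≠ 0`. -/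
theorem exists_mem_iff_add_mul {S : Set ℤ} {r₀ : ℤ} (h₀ : r₀ ∈ S)
    (hS : ∀ a ∈ S, ∀ b ∈ S, 2 * a - b ∈ S) {m : ℤ} (hm : m ≠ 0) (hper : r₀ + m ∈ S) :
    ∃ g : ℤ, ∀ r, r ∈ S ↔ ∃ k : ℤ, r = r₀ + k * g := by
  set T : Set ℤ := {t | r₀ + t ∈ S} with hT
  have hT0 : (0 : ℤ) ∈ T := by simpa [hT] using h₀
  have hsub : ∀ a ∈ T, ∀ b ∈ T, 2 * a - b ∈ T := by
    intro a ha b hb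
    have := hS _ ha _ hb
    rwa [show 2 * (r₀ + a) - (r₀ + b) = r₀ + (2 * a - b) by ring] at this
  have hneg : ∀ b ∈ T, -b ∈ T := fun b hb => by simpa using hsub 0 hT0 b hb
  -- Two successive reflections are a translation, so `T` is stable under twice the group it
  -- generates.
  have hG : ∀ x ∈ AddSubgroup.closure T, ∀ b ∈ T, 2 * x + b ∈ T := by
    intro x hx
    induction hx using AddSubgroup.closure_induction with
    | mem x hx => exact fun b hb => by simpa using hsub x hx _ (hneg b hb)
    | zero => exact fun b hb => by simpa using hb
    | add x y _ _ hx hy =>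
      intro b hb
      rw [show 2 * (x + y) + b = 2 * x + (2 * y + b) by ring]
      exact hx _ (hy b hb)
    | neg x _ hx =>
      intro b hb
      rw [show 2 * -x + b = -(2 * x + -b) by ring]
      exact hneg _ (hx _ (hneg b hb))
  obtain ⟨g, hg⟩ := Int.subgroup_cyclic (AddSubgroup.closure T)
  have hmem : ∀ x, x ∈ AddSubgroup.closure T ↔ ∃ k : ℤ, k * g = x := by
    intro x
    rw [hg, AddSubgroup.mem_closure_singleton]
    simp
  have hg0 : g ≠ 0 := by
    rintro rfl
    obtain ⟨k, hk⟩ := (hmem m).1 (AddSubgroup.subset_closure hper)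
    exact hm (by simpa using hk.symm)
  -- If `T` had only even multiples of `g`, it could not generate `gℤ`. An odd multiple, translated
  -- by `2gℤ`, then gives `g ∈ T`.
  obtain ⟨k, hk⟩ : ∃ k : ℤ, (2 * k + 1) * g ∈ T := by
    by_contra hc
    push Not at hc
    have hle : AddSubgroup.closure T ≤ AddSubgroup.zmultiples (2 * g) := by
      rw [AddSubgroup.closure_le]
      intro x hx
      obtain ⟨k, rfl⟩ := (hmem x).1 (AddSubgroup.subset_closure hx)
      rcases Int.even_or_odd' k with ⟨l, rfl | rfl⟩
      · exact AddSubgroup.mem_zmultiples_iff.2 ⟨l, by simp; ring⟩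
      · exact absurd hx (hc l)
    obtain ⟨l, hl⟩ := AddSubgroup.mem_zmultiples_iff.1 (hle ((hmem g).2 ⟨1, one_mul g⟩))
    have : (2 * l - 1) * g = 0 := by rw [smul_eq_mul] at hl; linear_combination hl
    rcases mul_eq_zero.1 this with h | h
    · omega
    · exact hg0 h
  have hgT : g ∈ T := by
    have := hG (-k * g) ((hmem _).2 ⟨-k, rfl⟩) _ hk
    rwa [show 2 * (-k * g) + (2 * k + 1) * g = g by ring] at this
  refine ⟨g, fun r => ⟨fun hr => ?_, ?_⟩⟩
  · have hr' : r - r₀ ∈ T := by simpa [hT] using hr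
    obtain ⟨k, hk⟩ := (hmem _).1 (AddSubgroup.subset_closure hr')
    exact ⟨k, by rw [hk]; ring⟩
  · rintro ⟨k, rfl⟩
    change k * g ∈ T
    rcases Int.even_or_odd' k with ⟨l, rfl | rfl⟩
    · have := hG (l * g) ((hmem _).2 ⟨l, rfl⟩) 0 hT0
      rwa [show 2 * (l * g) + 0 = 2 * l * g by ring] at this
    · have := hG (l * g) ((hmem _).2 ⟨l, rfl⟩) g hgT
      rwa [show 2 * (l * g) + g = (2 * l + 1) * g by ring] at this

end ExtAff

namespace EALA

namespace Twist

variable {𝔤 : Type*} [LieRing 𝔤] [LieAlgebra ℂ 𝔤] {E : EALA 𝔤} {m : ℕ} {ω : ℂ}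

/-! ### The centralizer of `𝔥^σ` acts commutatively on the weight spaces for `R_π^×` -/

/-- The vectors `e n` come from the shift `a` and repeat every `m` steps up to the scalar `lam`.
Inductively `[z, a]` commutes with `a` on them, so it acts with a constant coefficient `s`. The
coefficients `w n` of `z` then grow linearly with slope `s`, and periodicity forces `s = 0`: thus
`[z, a]` acts as zero. -/
theorem lie_lie_comm_of_shift (τ : E.Twist m ω) {α : Module.Dual ℂ E.cartan} (hα : α ∈ τ.piRoots)
    {r g : ℤ} {a : 𝔤} (ha : a ∈ τ.eigWeight 0 g) {e : ℕ → 𝔤} (he : ∀ n, e (n + 1) = ⁅a, e n⁆)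
    (he0 : ∀ n, e n ≠ 0) (heW : ∀ n : ℕ, e n ∈ τ.eigWeight α (r + n * g)) {lam : ℂ}
    (hlam : lam ≠ 0) (hper : ∀ n, e (n + m) = lam • e n) (i : ℕ) :
    ∀ z ∈ τ.eigWeight 0 (-(i * g)), ∀ n, ⁅z, ⁅a, e n⁆⁆ = ⁅a, ⁅z, e n⁆⁆ := by
  have hper' : ∀ k n : ℕ, e (n + k * m) = lam ^ k • e n := by
    intro k n
    induction k with
    | zero => simp
    | succ k ih => rw [Nat.succ_mul, ← add_assoc, hper, ih, smul_smul, pow_succ']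
  have hshift : ∀ (j : ℕ) (z : 𝔤), z ∈ τ.eigWeight 0 (-(j * g)) → ∀ n : ℕ,
      ∃ c : ℂ, ⁅z, e (n + j)⁆ = c • e n := by
    intro j z hz n
    refine τ.exists_smul_eq hα (heW n) (he0 n) ?_
    have := τ.lie_mem_eigWeight hz (heW (n + j))
    rwa [zero_add, show -(j * g) + (r + ((n + j : ℕ) : ℤ) * g) = r + n * g by
      push_cast; ring] at this
  induction i with
  | zero =>
    intro z hz n
    have hz' : z ∈ τ.eigWeight 0 0 := by simpa using hz
    obtain ⟨hzH, hzσ⟩ := τ.mem_cartan_of_mem_eigWeight_zero hz'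
    have hza : ⁅z, a⁆ = 0 := by simpa using ha.2 ⟨z, hzH⟩ hzσ
    rw [leibniz_lie, hza, zero_lie, zero_add]
  | succ i ih =>
    intro z hz n
    have hy : ⁅z, a⁆ ∈ τ.eigWeight 0 (-(i * g)) := by
      have := τ.lie_mem_eigWeight hz ha
      rwa [add_zero, show -(((i + 1 : ℕ) : ℤ) * g) + g = -(i * g) by push_cast; ring] at this
    obtain ⟨s, hs⟩ := hshift i _ hy 0
    have hs' : ∀ n, ⁅⁅z, a⁆, e (n + i)⁆ = s • e n := by
      intro n
      induction n with
      | zero => exact hs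
      | succ n ihn =>
        rw [show n + 1 + i = (n + i) + 1 by ring, he, ih _ hy, ihn, lie_smul, he]
    choose w hw using hshift (i + 1) z hz
    have hstep : ∀ n, w (n + 1) - w n = s := by
      intro n
      have h1 := hs' (n + 1)
      rw [lie_lie, show n + 1 + i = n + (i + 1) by ring, hw, ← he,
        show n + (i + 1) + 1 = (n + 1) + (i + 1) by ring, hw, lie_smul, ← he, ← sub_smul] at h1
      exact smul_left_injective ℂ (he0 (n + 1)) h1
    have hlin : ∀ n : ℕ, w n = w 0 + n * s := by
      intro n
      induction n with
      | zero => simp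
      | succ n ihn =>
        push_cast
        linear_combination hstep n + ihn
    have hwm : w (0 + m) = w 0 := by
      have h1 := hw (0 + m)
      rw [show 0 + m + (i + 1) = 0 + (i + 1) + m by ring, hper, hper, lie_smul, hw, smul_comm] at h1
      exact (smul_left_injective ℂ (smul_ne_zero hlam (he0 0)) h1).symm
    have hs0 : s = 0 := by
      rw [zero_add, hlin m] at hwm
      have : (m : ℂ) * s = 0 := by linear_combination hwm
      exact (mul_eq_zero.1 this).resolve_left (by exact_mod_cast τ.pos.ne')
    have hzero : ⁅⁅z, a⁆, e n⁆ = 0 := by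
      -- Adding `i` periods keeps the natural subtraction exact and changes `e n` only by `lam ^ i`.
      have h1 := hs' (n + i * m - i)
      have hle : i ≤ i * m := Nat.le_mul_of_pos_right i τ.pos
      rw [show n + i * m - i + i = n + i * m by omega, hper', lie_smul, hs0, zero_smul] at h1
      exact (smul_eq_zero.1 h1).resolve_left (pow_ne_zero _ hlam)
    rw [leibniz_lie, hzero, zero_add]

/-- The occupied degrees form a coset `r + gℤ`. An element of the centralizer whose degree is not in
`gℤ` acts as zero, since its image would lie in an empty degree; the others act as scalar multiples
of powers of one shift. All these operators commute. -/
theorem lie_lie_eq_zero_of_mem_eigWeight (τ : E.Twist m ω) {α : Module.Dual ℂ E.cartan}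
    (hα : α ∈ τ.piRoots) {i j r : ℤ} {x y v : 𝔤} (hx : x ∈ τ.eigWeight 0 i)
    (hy : y ∈ τ.eigWeight 0 j) (hv : v ∈ τ.eigWeight α r) : ⁅⁅x, y⁆, v⁆ = 0 := by
  by_cases hv0 : v = 0
  · rw [hv0, lie_zero]
  have hm0 : (m : ℤ) ≠ 0 := by exact_mod_cast τ.pos.ne'
  set S : Set ℤ := {s | ∃ z ∈ τ.eigWeight α s, z ≠ 0} with hS
  have hrS : r ∈ S := ⟨v, hv, hv0⟩
  -- The shift `a` from degree `s'` to `s` and its reverse `b` commute, so `b a z = a b z` is a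
  -- non-zero multiple of `z`; hence `a z ≠ 0`, in degree `2s - s'`.
  have hclosed : ∀ s ∈ S, ∀ s' ∈ S, 2 * s - s' ∈ S := by
    rintro s ⟨z, hz, hz0⟩ s' ⟨z', hz', hz0'⟩
    obtain ⟨a, ha, b, hb, c, d, hc, hd, haz, hbz⟩ := τ.exists_shift hα hz' hz0' hz hz0
    have hba : ⁅b, a⁆ = 0 :=
      τ.lie_eq_zero_of_mem_eigWeight_zero hb (by rwa [neg_sub])
    refine ⟨⁅a, z⁆, ?_, fun h => ?_⟩
    · have := τ.lie_mem_eigWeight ha hz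
      rwa [zero_add, show s - s' + s = 2 * s - s' by ring] at this
    · have h1 : ⁅b, ⁅a, z⁆⁆ = (d * c) • z := by
        rw [leibniz_lie, hba, zero_lie, zero_add, hbz, lie_smul, haz, smul_smul]
      rw [h, lie_zero, eq_comm, smul_eq_zero] at h1
      exact h1.elim (mul_ne_zero hd hc) hz0
  have hperS : r + m ∈ S := by
    refine ⟨v, τ.eigWeight_congr hv (fun _ _ => rfl) ?_, hv0⟩
    simpa using (τ.omega_zpow_add_mul r 1).symm
  obtain ⟨g, hg⟩ := exists_mem_iff_add_mul hrS hclosed hm0 hperS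
  obtain ⟨z, hz, hz0⟩ := (hg (r + g)).2 ⟨1, by ring⟩
  obtain ⟨a, ha, b, hb, c, d, hc, hd, hav, hbz⟩ := τ.exists_shift hα hv hv0 hz hz0
  rw [add_sub_cancel_left] at ha
  rw [sub_add_cancel_left] at hb
  have hba : ⁅b, a⁆ = 0 := τ.lie_eq_zero_of_mem_eigWeight_zero hb (by rwa [neg_neg])
  set e : ℕ → 𝔤 := fun n => ((LieAlgebra.ad ℂ 𝔤 a) ^ n) v with hedef
  have hes : ∀ n, e (n + 1) = ⁅a, e n⁆ := fun n => ad_pow_succ_apply a v n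
  have heW : ∀ n : ℕ, e n ∈ τ.eigWeight α (r + n * g) := by
    intro n
    simpa using τ.ad_pow_mem_eigWeight ha hv n
  have hbe : ∀ n, ⁅b, e (n + 1)⁆ = (c * d) • e n := by
    intro n
    induction n with
    | zero =>
      rw [hes]
      change ⁅b, ⁅a, v⁆⁆ = (c * d) • v
      rw [hav, lie_smul, hbz, smul_smul]
    | succ n ih =>
      rw [hes (n + 1), leibniz_lie, hba, zero_lie, zero_add, ih, lie_smul, ← hes]
  have he0 : ∀ n, e n ≠ 0 := by
    intro n
    induction n with
    | zero => exact hv0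
    | succ n ih =>
      intro h
      have := hbe n
      rw [h, lie_zero, eq_comm, smul_eq_zero] at this
      exact this.elim (mul_ne_zero hc hd) ih
  obtain ⟨lam, hl⟩ := τ.exists_smul_eq hα hv hv0
    (τ.eigWeight_congr (heW m) (fun _ _ => rfl) (τ.omega_zpow_add_mul r g))
  have hlam : lam ≠ 0 := by
    rintro rfl
    exact he0 m (by rw [hl, zero_smul])
  have hper : ∀ n, e (n + m) = lam • e n := by
    intro n
    simp only [hedef] at hl ⊢
    rw [pow_add, Module.End.mul_apply, hl, map_smul]
  have hcomm := τ.lie_lie_comm_of_shift hα ha hes he0 heW hlam hper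
  have hzero : ∀ (l : ℤ) (q : 𝔤), q ∈ τ.eigWeight 0 l → (¬ ∃ k : ℤ, l = k * g) → ∀ (k : ℤ) (u : 𝔤),
      u ∈ τ.eigWeight α (r + k * g) → ⁅q, u⁆ = 0 := by
    intro l q hq hl k u hu
    by_contra hne
    have h1 := τ.lie_mem_eigWeight hq hu
    rw [zero_add] at h1
    obtain ⟨k', hk'⟩ := (hg _).1 ⟨_, h1, hne⟩
    exact hl ⟨k' - k, by linear_combination hk'⟩
  have hvW : v ∈ τ.eigWeight α (r + 0 * g) := by simpa using hv
  have hmove : ∀ (k : ℤ) (q : 𝔤), q ∈ τ.eigWeight 0 (k * g) → ⁅q, v⁆ ∈ τ.eigWeight α (r + k * g) := by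
    intro k q hq
    have := τ.lie_mem_eigWeight hq hv
    rwa [zero_add, add_comm] at this
  have hact : ∀ (k : ℤ) (q : 𝔤), q ∈ τ.eigWeight 0 (k * g) → ∃ (l : ℕ) (s : ℂ), ∀ n,
      ⁅q, e (n + l)⁆ = s • e n := by
    intro k q hq
    -- Degrees matter only modulo `m`, so degree `k g` can be written as `-(l g)` with `l` natural.
    have hl : (((-k) % m).toNat : ℤ) = (-k) % m := Int.toNat_of_nonneg (Int.emod_nonneg _ hm0)
    set l := ((-k) % m).toNat
    have hq' : q ∈ τ.eigWeight 0 (-(l * g)) := by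
      refine τ.eigWeight_congr hq (fun _ _ => rfl) ?_
      rw [hl, ← τ.omega_zpow_add_mul (k * g) ((-k) / m * g)]
      congr 1
      have := Int.emod_add_mul_ediv (-k) m
      linear_combination g * this
    obtain ⟨s, hs⟩ : ∃ s : ℂ, ⁅q, e (0 + l)⁆ = s • e 0 := by
      refine τ.exists_smul_eq hα (heW 0) (he0 0) ?_
      have := τ.lie_mem_eigWeight hq' (heW (0 + l))
      rwa [zero_add, show -(l * g) + (r + ((0 + l : ℕ) : ℤ) * g) = r + (0 : ℕ) * g by
        push_cast; ring] at this
    refine ⟨l, s, fun n => ?_⟩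
    induction n with
    | zero => exact hs
    | succ n ih =>
      rw [show n + 1 + l = (n + l) + 1 by ring, hes, hcomm l q hq', ih, lie_smul, hes]
  rw [lie_lie]
  by_cases hi : ∃ k : ℤ, i = k * g
  · obtain ⟨k, rfl⟩ := hi
    by_cases hj : ∃ k : ℤ, j = k * g
    · obtain ⟨k', rfl⟩ := hj
      obtain ⟨l, s, hs⟩ := hact k x hx
      obtain ⟨l', s', hs'⟩ := hact k' y hy
      have hper' : ∀ N : ℕ, e (N * m) = lam ^ N • v := by
        intro N
        induction N with
        | zero => simp [hedef]
        | succ N ih => rw [Nat.succ_mul, hper, ih, smul_smul, pow_succ']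
      have h1 : ⁅x, ⁅y, e ((l + l') * m)⁆⁆ - ⁅y, ⁅x, e ((l + l') * m)⁆⁆ = 0 := by
        -- The index `(l + l') m` is at least `l + l'`, leaving room to lower twice, and is a
        -- multiple of the period, so its vector is a non-zero multiple of `v`.
        obtain ⟨n, hn⟩ := Nat.exists_eq_add_of_le' (Nat.le_mul_of_pos_right (l + l') τ.pos)
        have h2 : ⁅x, ⁅y, e (n + l + l')⁆⁆ = (s' * s) • e n := by
          rw [hs', lie_smul, hs, smul_smul]
        have h3 : ⁅y, ⁅x, e (n + l' + l)⁆⁆ = (s' * s) • e n := by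
          rw [hs, lie_smul, hs', smul_smul, mul_comm]
        rw [add_assoc] at h2 h3
        rw [hn, h2, add_comm l l', h3, sub_self]
      rw [hper', lie_smul, lie_smul, lie_smul, lie_smul, ← smul_sub] at h1
      exact (smul_eq_zero.1 h1).resolve_left (pow_ne_zero _ hlam)
    · rw [hzero j y hy hj 0 v hvW, hzero j y hy hj k _ (hmove k x hx), lie_zero, sub_zero]
  · rw [hzero i x hx hi 0 v hvW, lie_zero, sub_zero]
    by_cases hj : ∃ k : ℤ, j = k * g
    · obtain ⟨k', rfl⟩ := hj
      exact hzero i x hx hi k' _ (hmove k' y hy)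
    · rw [hzero j y hy hj 0 v hvW, lie_zero]

/-- Since `𝔥` itself centralizes `𝔥^σ` and `[h, x] = μ(h) x` with `μ(h) ≠ 0`, the vector `x` is a
commutator in the centralizer, and commutators act as zero. -/
theorem lie_eq_zero_of_sameRestriction_zero (τ : E.Twist m ω) {α β μ : Module.Dual ℂ E.cartan}
    (hα : α ∈ τ.piRoots) (hβ : τ.SameRestriction β α) (hμ : μ ≠ 0)
    (hμ0 : τ.SameRestriction μ 0) {x v : 𝔤} (hx : x ∈ rootSpace E.cartan μ)
    (hv : v ∈ rootSpace E.cartan β) : ⁅x, v⁆ = 0 := by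
  obtain ⟨h, hh⟩ : ∃ h, μ h ≠ 0 := by
    by_contra hc
    push Not at hc
    exact hμ (LinearMap.ext hc)
  have hh0 : (h : 𝔤) ∈ rootSpace E.cartan 0 := E.isExtendedAffine.mem_cartan_iff.2 h.2
  have h1 : ⁅⁅(h : 𝔤), x⁆, v⁆ = 0 := by
    rw [← τ.sum_proj (h : 𝔤), ← τ.sum_proj x, ← τ.sum_proj v]
    simp only [sum_lie, lie_sum]
    refine Finset.sum_eq_zero fun i _ => Finset.sum_eq_zero fun j _ =>
      Finset.sum_eq_zero fun k _ => ?_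
    exact τ.lie_lie_eq_zero_of_mem_eigWeight hα (τ.proj_mem_eigWeight hh0 (fun _ _ => rfl) _)
      (τ.proj_mem_eigWeight hx hμ0 _) (τ.proj_mem_eigWeight hv hβ _)
  rw [hx h, smul_lie, smul_eq_zero] at h1
  exact h1.resolve_left hh

/-! ### Positivity of orbit sums and separation of the orbits -/

theorem kform_dualProj_eq_zero_of_rform (τ : E.Twist m ω) {α₀ ν γ : Module.Dual ℂ E.cartan}
    (h₀ : α₀ ∈ nonisoRoots E.form E.cartan) (hν : ν ∈ roots E.cartan)
    (h : E.isExtendedAffine.rform α₀ (∑ i ∈ Finset.range m, (τ.dualSigma ^ i) ν)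
      (∑ i ∈ Finset.range m, (τ.dualSigma ^ i) ν) = 0) (hγ : γ ∈ roots E.cartan) :
    τ.kform (τ.dualProj 0 ν) γ = 0 := by
  have hE := E.isExtendedAffine
  have hm : (m : ℂ) ≠ 0 := by exact_mod_cast τ.pos.ne'
  have hR : ∀ i ∈ Finset.range m, (τ.dualSigma ^ i) ν ∈ roots E.cartan :=
    fun i _ => τ.dualSigma_pow_mem_roots hν i
  have h2 := hE.rform_sum_eq_zero h₀ _ _ hR h hγ
  rw [hE.rform_symm, hE.rform_sum_right] at h2
  apply mul_left_cancel₀ hm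
  rw [mul_zero, kform_symm, ← smul_eq_mul, ← map_smul, smul_dualProj_zero, map_sum]
  refine (Finset.sum_congr rfl fun i hi => hE.kform_eq_rform h₀ hγ (hR i hi)).trans ?_
  rw [← Finset.sum_mul, ← Complex.ofReal_sum, h2, Complex.ofReal_zero, zero_mul]

/-- The orbit sum `m π(α)` is a sum of roots, so its norm is non-negative. Norm zero would make it
orthogonal to `α`, hence `π(α)` isotropic. -/
theorem rform_dualProj_pos (τ : E.Twist m ω) {α₀ α : Module.Dual ℂ E.cartan}
    (h₀ : α₀ ∈ nonisoRoots E.form E.cartan) (hα : α ∈ τ.piRoots) :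
    0 < E.isExtendedAffine.rform α₀ (∑ i ∈ Finset.range m, (τ.dualSigma ^ i) α)
      (∑ i ∈ Finset.range m, (τ.dualSigma ^ i) α) := by
  refine lt_of_le_of_ne (E.isExtendedAffine.rform_sum_nonneg h₀ _ _
    fun i _ => τ.dualSigma_pow_mem_roots hα.1.1 i) fun h => hα.2 ?_
  rw [← kform_apply, kform_dualProj, kform_symm]
  exact τ.kform_dualProj_eq_zero_of_rform h₀ hα.1.1 h.symm hα.1.1

/-- The projection `π` separates the `⟨σ⟩`-orbits on `R_π^×`. -/
theorem separatesOrbits (τ : E.Twist m ω) : τ.SeparatesOrbits := by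
  intro γ hγ β hβ hγβ
  have hE := E.isExtendedAffine
  have h₀ := hβ.1
  set u := fun α => ∑ i ∈ Finset.range m, (τ.dualSigma ^ i) α with hu
  have huu : u γ = u β := by
    rw [hu]
    simp only [← smul_dualProj_zero, hγβ]
  have hpos := τ.rform_dualProj_pos h₀ hβ
  -- The two orbit sums coincide and have positive norm, so some conjugate of `β` and some conjugate
  -- of `γ` have positive product.
  obtain ⟨j, -, hj⟩ : ∃ j ∈ Finset.range m, 0 < hE.rform β (u γ) ((τ.dualSigma ^ j) β) := by
    by_contra hc
    push Not at hc
    have := Finset.sum_nonpos hc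
    rw [← hE.rform_sum_right, huu] at this
    exact absurd hpos (not_lt.2 this)
  obtain ⟨i, -, hi⟩ : ∃ i ∈ Finset.range m,
      0 < hE.rform β ((τ.dualSigma ^ j) β) ((τ.dualSigma ^ i) γ) := by
    by_contra hc
    push Not at hc
    have := Finset.sum_nonpos hc
    rw [← hE.rform_sum_right, hE.rform_symm] at this
    exact absurd hj (not_lt.2 this)
  set β' := (τ.dualSigma ^ j) β with hβ'
  set γ' := (τ.dualSigma ^ i) γ with hγ'
  have hβ'R : β' ∈ τ.piRoots := τ.dualSigma_pow_mem_piRoots hβ j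
  have hγ'R : γ' ∈ τ.piRoots := τ.dualSigma_pow_mem_piRoots hγ i
  have hsame : τ.SameRestriction γ' β' :=
    (τ.sameRestriction_dualSigma_pow γ i).trans
      ((τ.dualProj_eq_iff.1 hγβ).trans (τ.sameRestriction_dualSigma_pow β j).symm)
  have heq : γ' = β' := by
    by_contra hne
    obtain ⟨hγn, -, N, hN, hNk⟩ := hE.cartanInt_pos h₀ hβ'R.1.1 hγ'R.1.1 hi
    have hγ0 : hE.kform γ' γ' ≠ 0 := hγn.2
    obtain ⟨e, he, he0⟩ := exists_ne_zero_of_mem_roots hγ'R.1.1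
    obtain ⟨f, hf, t⟩ := hE.exists_sl2 hγn.2 he he0
    obtain ⟨v, hv, hv0⟩ := exists_ne_zero_of_mem_roots (hE.neg_mem_roots hβ'R.1.1)
    -- The coroot of `γ'` has the negative eigenvalue `-N` on `v`, so the raising operator `e`
    -- cannot kill `v`.
    have hev : ⁅e, v⁆ ≠ 0 := by
      intro h
      refine hv0 (eq_zero_of_lie_lie_eq_zero t.symm (c := N) ?_ (by rw [h, lie_zero]) ?_
        (hE.locally_nilpotent _ (hE.neg_mem_nonisoRoots hγn) f hf v))
      · rw [neg_lie, hE.lie_h_eq hv, ← neg_smul]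
        congr 1
        rw [map_neg, LinearMap.neg_apply, mul_neg, hNk, neg_div, mul_div_cancel_right₀ _ hγ0,
          neg_neg]
      · intro n
        exact_mod_cast (by omega : N + n ≠ 0)
    have hμ : ⁅e, v⁆ ∈ rootSpace E.cartan (γ' + -β') := lie_mem_rootSpace he hv
    obtain ⟨y, hy, hyne⟩ := hE.exists_form_ne_zero hμ hev
    apply hyne
    -- Invariance turns `([e, v], y)` into a pairing of `v` with `[e, y]`, and `y` belongs to the
    -- non-zero root `-(γ' - β')`, which restricts to `0`.
    rw [← lie_skew, map_neg, LinearMap.neg_apply, hE.invariant, ← lie_skew,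
      τ.lie_eq_zero_of_sameRestriction_zero hβ'R hsame (neg_ne_zero.2 fun h => hne ?_) ?_ hy he,
      neg_zero, map_zero, neg_zero]
    · intro h hh
      simp [hsame h hh]
    · rwa [← sub_eq_add_neg, sub_eq_zero] at h
  -- `σ^N` is an inverse of `σ^j` with a natural exponent, as `SameOrbit` requires.
  obtain ⟨N, hN⟩ : ∃ N : ℕ, m ∣ N + j := ⟨m * j - j, ⟨j, by
    rw [Nat.sub_add_cancel (Nat.le_mul_of_pos_left j τ.pos)]⟩⟩
  refine ⟨N + i, ?_⟩
  obtain ⟨l, hl⟩ := hN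
  rw [pow_add, Module.End.mul_apply, ← hγ', heq, hβ', ← Module.End.mul_apply, ← pow_add, hl, pow_mul,
    dualSigma_pow_eq_one, one_pow]
  rfl

end Twist

end EALA

namespace ExtAff

/-! ### Homogeneous parts of the core -/

section Core

variable {L : Type*} [LieRing L] [LieAlgebra ℂ L] {B : LinearMap.BilinForm ℂ L}
  {H : LieSubalgebra ℂ L}

theorem lie_mem_bracketSpan {X Y : Submodule ℂ L} {x y : L} (hx : x ∈ X) (hy : y ∈ Y) :
    ⁅x, y⁆ ∈ bracketSpan X Y := Submodule.subset_span ⟨x, hx, y, hy, rfl⟩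

theorem bracketSpan_le_rootSpace (α β : Module.Dual ℂ H) :
    bracketSpan (rootSpace H α) (rootSpace H β) ≤ rootSpace H (α + β) := by
  refine Submodule.span_le.2 ?_
  rintro _ ⟨x, hx, y, hy, rfl⟩
  exact lie_mem_rootSpace hx hy

theorem rootSpace_le_core {α : Module.Dual ℂ H} (hα : α ∈ nonisoRoots B H) :
    rootSpace H α ≤ (core B H).toSubmodule := fun _ hx =>
  LieSubalgebra.subset_lieSpan ⟨α, hα, hx⟩

/-- The part of weight `ξ` of the sum of the non-isotropic root spaces and of their brackets. -/
def corePart (B : LinearMap.BilinForm ℂ L) (H : LieSubalgebra ℂ L) (ξ : Module.Dual ℂ H) :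
    Submodule ℂ L :=
  (⨆ _ : ξ ∈ nonisoRoots B H, rootSpace H ξ) ⊔
    ⨆ α ∈ nonisoRoots B H, ⨆ β ∈ nonisoRoots B H, ⨆ _ : α + β = ξ,
      bracketSpan (rootSpace H α) (rootSpace H β)

theorem corePart_le (ξ : Module.Dual ℂ H) : corePart B H ξ ≤ rootSpace H ξ := by
  refine sup_le (iSup_le fun _ => le_rfl) (iSup₂_le fun α _ => iSup₂_le fun β _ => iSup_le ?_)
  rintro rfl
  exact bracketSpan_le_rootSpace α β

theorem rootSpace_le_iSup_corePart {α : Module.Dual ℂ H} (hα : α ∈ nonisoRoots B H) :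
    rootSpace H α ≤ ⨆ ξ, corePart B H ξ :=
  le_iSup_of_le α (le_sup_of_le_left (le_iSup_of_le hα le_rfl))

theorem bracketSpan_le_iSup_corePart {α β : Module.Dual ℂ H} (hα : α ∈ nonisoRoots B H)
    (hβ : β ∈ nonisoRoots B H) :
    bracketSpan (rootSpace H α) (rootSpace H β) ≤ ⨆ ξ, corePart B H ξ :=
  le_iSup_of_le (α + β) (le_sup_of_le_right (le_iSup₂_of_le α hα (le_iSup₂_of_le β hβ
    (le_iSup_of_le rfl le_rfl))))

/-- It suffices that the sum is stable under bracketing with the generators. A triple bracket of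
non-isotropic weight is in a root space already present. Otherwise the Jacobi identity reduces to
`[[z, x], y]` and `[[z, y], x]`: the inner bracket, if of isotropic root weight, would by hypothesis
give a non-isotropic total weight or a zero bracket. So it is non-isotropic or the term vanishes. -/
theorem core_le_iSup_corePart
    (hiso : ∀ α ∈ nonisoRoots B H, ∀ β ∈ nonisoRoots B H, ∀ γ ∈ nonisoRoots B H,
      α + β ∈ roots H → α + β ∉ nonisoRoots B H → α + β + γ ∈ roots H →
        α + β + γ ∈ nonisoRoots B H) :
    (core B H).toSubmodule ≤ ⨆ ξ, corePart B H ξ := by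
  set I := ⨆ ξ, corePart B H ξ with hI
  have hlie : ∀ α ∈ nonisoRoots B H, ∀ β ∈ nonisoRoots B H, ∀ γ ∈ nonisoRoots B H,
      ∀ x ∈ rootSpace H α, ∀ y ∈ rootSpace H β, ∀ z ∈ rootSpace H γ,
      α + β + γ ∉ nonisoRoots B H → ⁅⁅x, y⁆, z⁆ ∈ I := by
    intro α hα β hβ γ hγ x hx y hy z hz hn
    by_cases h0 : ⁅x, y⁆ = 0
    · rw [h0, zero_lie]; exact zero_mem _
    have hxy := lie_mem_rootSpace hx hy
    have hr := mem_roots_of_ne_zero hxy h0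
    by_cases hn' : α + β ∈ nonisoRoots B H
    · exact bracketSpan_le_iSup_corePart hn' hγ (lie_mem_bracketSpan hxy hz)
    · by_contra hne
      exact hn (hiso α hα β hβ γ hγ hr hn' (mem_roots_of_ne_zero (lie_mem_rootSpace hxy hz)
        fun h => hne (h ▸ zero_mem _)))
  have hgen : ∀ γ ∈ nonisoRoots B H, ∀ z ∈ rootSpace H γ, ∀ u ∈ I, ⁅z, u⁆ ∈ I := by
    intro γ hγ z hz u hu
    have hle : I ≤ I.comap (LieAlgebra.ad ℂ L z : L →ₗ[ℂ] L) := by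
      refine iSup_le fun ξ => sup_le (iSup_le fun hξ => ?_) (iSup₂_le fun α hα =>
        iSup₂_le fun β hβ => iSup_le fun _ => Submodule.span_le.2 ?_)
      · intro u hu
        exact bracketSpan_le_iSup_corePart hγ hξ (lie_mem_bracketSpan hz hu)
      · rintro _ ⟨x, hx, y, hy, rfl⟩
        change ⁅z, ⁅x, y⁆⁆ ∈ I
        by_cases hn : γ + α + β ∈ nonisoRoots B H
        · refine rootSpace_le_iSup_corePart hn ?_
          rw [add_assoc]
          exact lie_mem_rootSpace hz (lie_mem_rootSpace hx hy)
        · rw [leibniz_lie, ← lie_skew x]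
          refine add_mem (hlie γ hγ α hα β hβ z hz x hx y hy hn) (neg_mem ?_)
          exact hlie γ hγ β hβ α hα z hz y hy x hx (by rwa [add_right_comm])
    exact hle hu
  intro x hx
  have key : x ∈ I ∧ ∀ u ∈ I, ⁅x, u⁆ ∈ I := by
    change x ∈ LieSubalgebra.lieSpan ℂ L _ at hx
    induction hx using LieSubalgebra.lieSpan_induction with
    | mem x hx =>
      obtain ⟨α, hα, hx⟩ := hx
      exact ⟨rootSpace_le_iSup_corePart hα hx, hgen α hα x hx⟩
    | zero => exact ⟨zero_mem _, fun u _ => by rw [zero_lie]; exact zero_mem _⟩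
    | add x y _ _ hx hy =>
      exact ⟨add_mem hx.1 hy.1, fun u hu => by
        rw [add_lie]; exact add_mem (hx.2 u hu) (hy.2 u hu)⟩
    | smul c x _ hx =>
      exact ⟨Submodule.smul_mem _ _ hx.1, fun u hu => by
        rw [smul_lie]; exact Submodule.smul_mem _ _ (hx.2 u hu)⟩
    | lie x y _ _ hx hy =>
      refine ⟨hx.2 y hy.1, fun u hu => ?_⟩
      rw [lie_lie]
      exact sub_mem (hx.2 _ (hy.2 u hu)) (hy.2 _ (hx.2 u hu))
  exact key.1

end Core

/-! ### Coefficients of elements of the loop algebra -/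

section Loop

variable {𝔤 : Type*} [LieRing 𝔤] [LieAlgebra ℂ 𝔤]

theorem coeff_degree (n : ℤ) (f : Loop 𝔤) : coeff n (degree f) = (n : ℂ) • coeff n f := by
  induction f using loop_induction with
  | h0 => simp
  | hm k x =>
    rw [degree_mono, map_smul, coeff_mono]
    split_ifs with h
    · rw [h]
    · rw [smul_zero, smul_zero]
  | ha f g hf hg => rw [map_add, map_add, hf, hg, map_add, smul_add]

theorem coeff_lie_mono_zero (n : ℤ) (h : 𝔤) (f : Loop 𝔤) :
    coeff n ⁅mono 0 h, f⁆ = ⁅h, coeff n f⁆ := by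
  induction f using loop_induction with
  | h0 => simp
  | hm k x =>
    rw [lie_mono, zero_add, coeff_mono, coeff_mono]
    split_ifs with h
    · rfl
    · rw [lie_zero]
  | ha f g hf hg => rw [lie_add, map_add, hf, hg, map_add, lie_add]

theorem loop_ext {f g : Loop 𝔤} (h : ∀ n, coeff n f = coeff n g) : f = g :=
  loopEquiv.injective (Finsupp.ext h)

theorem mono_injective (n : ℤ) : Function.Injective (mono n : 𝔤 → Loop 𝔤) := by
  intro x y h
  have := congrArg (coeff n) h
  rwa [coeff_mono, coeff_mono, if_pos rfl, if_pos rfl] at this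

end Loop

end ExtAff

/-! ### Homogeneous tensors in the ambient algebra -/

namespace EALA

theorem Full.lie_tens {𝔤 : Type*} [LieRing 𝔤] [LieAlgebra ℂ 𝔤] {E : EALA 𝔤} {r s : ℤ}
    (h : r + s ≠ 0) (x y : 𝔤) : ⁅Full.tens E r x, Full.tens E s y⁆ = Full.tens E (r + s) ⁅x, y⁆ := by
  ext1
  · simp [Full.tens, lie_mono]
  · simp [Full.tens, degree_mono, loopForm_mono, h]
  · simp [Full.tens]

theorem Full.tens_injective {𝔤 : Type*} [LieRing 𝔤] [LieAlgebra ℂ 𝔤] (E : EALA 𝔤) (k : ℤ) :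
    Function.Injective (Full.tens E k) :=
  fun _ _ h => mono_injective k (congrArg Full.loop h)

theorem Full.form_symm {𝔤 : Type*} [LieRing 𝔤] [LieAlgebra ℂ 𝔤] (E : EALA 𝔤) (X Y : E.Full) :
    Full.form E X Y = Full.form E Y X := by
  change loopForm E.form X.loop Y.loop + X.c * Y.d + Y.c * X.d =
    loopForm E.form Y.loop X.loop + Y.c * X.d + X.c * Y.d
  rw [loopForm_symm E.form E.isExtendedAffine.symm]
  ring

namespace Twist

variable {𝔤 : Type*} [LieRing 𝔤] [LieAlgebra ℂ 𝔤] {E : EALA 𝔤} {m : ℕ} {ω : ℂ}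

/-! ### Root spaces of the affinization -/

theorem sigma_coeff (τ : E.Twist m ω) {f : Loop 𝔤} (hf : f ∈ τ.twistedLoop) (n : ℤ) :
    τ.σ (coeff n f) = ω ^ n • coeff n f := by
  change f ∈ Submodule.span ℂ _ at hf
  induction hf using Submodule.span_induction with
  | zero => simp
  | add f g _ _ hf hg => rw [map_add, map_add, hf, hg, smul_add]
  | smul c f _ hf => rw [map_smul, map_smul, hf, smul_comm]
  | mem f hf =>
    obtain ⟨i, x, hx, rfl⟩ := hf
    rw [coeff_mono]
    split_ifs with h
    · rw [hx, h]
    · simp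

theorem affWeight_congr (τ : E.Twist m ω) {a b : Module.Dual ℂ E.cartan}
    (h : τ.SameRestriction a b) (r : ℤ) : τ.affWeight a r = τ.affWeight b r := by
  ext X
  have h1 : τ.σ (coeff 0 ((X : τ.aff) : E.Full).loop) = coeff 0 ((X : τ.aff) : E.Full).loop := by
    simpa using τ.sigma_coeff (X : τ.aff).2 0
  exact congrArg (· + (r : ℂ) * ((X : τ.aff) : E.Full).d)
    (h ⟨coeff 0 ((X : τ.aff) : E.Full).loop, τ.coeff_mem_cartan X⟩ h1)

theorem affWeight_add (τ : E.Twist m ω) (a b : Module.Dual ℂ E.cartan) (r s : ℤ) :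
    τ.affWeight a r + τ.affWeight b s = τ.affWeight (a + b) (r + s) := by
  ext X
  change (a _ + (r : ℂ) * _) + (b _ + (s : ℂ) * _) = (a + b) _ + ((r + s : ℤ) : ℂ) * _
  rw [LinearMap.add_apply, Int.cast_add]
  ring

/-- The element `h + xc + yd` of the Cartan subalgebra of `Aff(𝔤, σ)`. -/
def affElt (τ : E.Twist m ω) (h : E.cartan) (hh : τ.σ h = h) (x y : ℂ) : τ.affCartan :=
  ⟨⟨⟨mono 0 (h : 𝔤), x, y⟩, Submodule.subset_span ⟨0, h, by simpa using hh, rfl⟩⟩,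
    ⟨h, h.2, hh, rfl⟩⟩

theorem affWeight_affElt (τ : E.Twist m ω) (a : Module.Dual ℂ E.cartan) (r : ℤ) {h : E.cartan}
    (hh : τ.σ h = h) (x y : ℂ) : τ.affWeight a r (τ.affElt h hh x y) = a h + r * y := by
  change a _ + (r : ℂ) * y = _
  congr 2
  exact Subtype.ext (by simp [affElt, coeff_mono])

theorem exists_eq_affElt (τ : E.Twist m ω) (Z : τ.affCartan) :
    ∃ (h : E.cartan) (hh : τ.σ h = h) (x y : ℂ), Z = τ.affElt h hh x y := by
  obtain ⟨h, hH, hh, hZ⟩ := Z.2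
  refine ⟨⟨h, hH⟩, hh, ((Z : τ.aff) : E.Full).c, ((Z : τ.aff) : E.Full).d, ?_⟩
  refine Subtype.ext (Subtype.ext ?_)
  exact Full.ext hZ rfl rfl

theorem coeff_lie_affElt (τ : E.Twist m ω) {h : E.cartan} (hh : τ.σ h = h) (x y : ℂ) (X : τ.aff)
    (n : ℤ) : coeff n ((⁅(τ.affElt h hh x y : τ.aff), X⁆ : τ.aff) : E.Full).loop =
      ⁅(h : 𝔤), coeff n (X : E.Full).loop⁆ + (y * n) • coeff n (X : E.Full).loop := by
  change coeff n (⁅mono 0 (h : 𝔤), (X : E.Full).loop⁆ + y • degree (X : E.Full).loop -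
    (X : E.Full).d • degree (mono 0 (h : 𝔤))) = _
  rw [map_sub, map_add, coeff_lie_mono_zero, map_smul, coeff_degree, degree_mono]
  simp [smul_smul]

theorem lie_affElt_c (τ : E.Twist m ω) {h : E.cartan} (hh : τ.σ h = h) (x y : ℂ) (X : τ.aff) :
    ((⁅(τ.affElt h hh x y : τ.aff), X⁆ : τ.aff) : E.Full).c = 0 := by
  change loopForm E.form (degree (mono 0 (h : 𝔤))) (X : E.Full).loop = 0
  rw [degree_mono]
  simp

theorem lie_affElt_d (τ : E.Twist m ω) {h : E.cartan} (hh : τ.σ h = h) (x y : ℂ) (X : τ.aff) :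
    ((⁅(τ.affElt h hh x y : τ.aff), X⁆ : τ.aff) : E.Full).d = 0 := rfl

theorem mem_affRootSpace (τ : E.Twist m ω) {a : Module.Dual ℂ E.cartan} {r : ℤ} {x : 𝔤}
    (hx : x ∈ τ.eigWeight a r) {X : τ.aff} (hX : (X : E.Full) = Full.tens E r x) :
    X ∈ τ.affRootSpace a r := by
  intro Z
  obtain ⟨h, hh, u, v, rfl⟩ := τ.exists_eq_affElt Z
  rw [affWeight_affElt]
  refine Subtype.ext (Full.ext (loop_ext fun n => ?_) ?_ ?_)
  · rw [coeff_lie_affElt]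
    change _ = coeff n ((a h + r * v) • (X : E.Full).loop)
    have hl : (X : E.Full).loop = mono r x := by rw [hX]; rfl
    rw [hl, map_smul, coeff_mono]
    split_ifs with hn
    · rw [hx.2 h hh, ← add_smul, hn, mul_comm v]
    · simp
  · rw [lie_affElt_c]
    change 0 = _ * (X : E.Full).c
    rw [hX]
    exact (mul_zero _).symm
  · rw [lie_affElt_d]
    change 0 = _ * (X : E.Full).d
    rw [hX]
    exact (mul_zero _).symm

theorem exists_mem_affRootSpace (τ : E.Twist m ω) {a : Module.Dual ℂ E.cartan} {r : ℤ} {x : 𝔤}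
    (hx : x ∈ τ.eigWeight a r) : ∃ X ∈ τ.affRootSpace a r, (X : E.Full) = Full.tens E r x :=
  ⟨⟨Full.tens E r x, Submodule.subset_span ⟨r, x, hx.1, rfl⟩⟩, τ.mem_affRootSpace hx rfl, rfl⟩

/-- Bracketing with `d` isolates the degree `r`. The condition on `a` and `r` says that the weight
is non-zero, which kills the `c` and `d` coefficients. -/
theorem eq_tens_of_mem_affRootSpace (τ : E.Twist m ω) {a : Module.Dual ℂ E.cartan} {r : ℤ}
    (har : r ≠ 0 ∨ ∃ h : E.cartan, τ.σ h = h ∧ a h ≠ 0) {X : τ.aff}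
    (hX : X ∈ τ.affRootSpace a r) : ∃ x ∈ τ.eigWeight a r, (X : E.Full) = Full.tens E r x := by
  have hcoef : ∀ (h : E.cartan) (_ : τ.σ h = h) (y : ℂ) (n : ℤ), ⁅(h : 𝔤), coeff n (X : E.Full).loop⁆ +
      (y * n) • coeff n (X : E.Full).loop = (a h + r * y) • coeff n (X : E.Full).loop := by
    intro h hh y n
    rw [← τ.coeff_lie_affElt hh 0 y X n, hX, affWeight_affElt]
    exact map_smul (coeff n) _ _
  have h0 : τ.σ ((0 : E.cartan) : 𝔤) = ((0 : E.cartan) : 𝔤) := map_zero _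
  have hdeg : ∀ n, n ≠ r → coeff n (X : E.Full).loop = 0 := by
    intro n hn
    have := hcoef 0 h0 1 n
    simp only [ZeroMemClass.coe_zero, zero_lie, zero_add, one_mul, map_zero, mul_one] at this
    rw [← sub_eq_zero, ← sub_smul, smul_eq_zero, sub_eq_zero] at this
    exact this.resolve_left (by exact_mod_cast hn)
  have hc : (X : E.Full).c = 0 ∧ (X : E.Full).d = 0 := by
    obtain ⟨h, hh, y, hy⟩ : ∃ (h : E.cartan) (_ : τ.σ h = h) (y : ℂ), a h + r * y ≠ 0 := by
      rcases har with hr | ⟨h, hh, ha⟩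
      · exact ⟨0, h0, 1, by simpa using hr⟩
      · exact ⟨h, hh, 0, by simpa using ha⟩
    have h1 := hX (τ.affElt h hh 0 y)
    rw [affWeight_affElt] at h1
    have h2 := τ.lie_affElt_c hh 0 y X
    have h3 := τ.lie_affElt_d hh 0 y X
    rw [h1] at h2 h3
    exact ⟨(mul_eq_zero.1 h2).resolve_left hy, (mul_eq_zero.1 h3).resolve_left hy⟩
  refine ⟨coeff r (X : E.Full).loop, ⟨τ.sigma_coeff X.2 r, fun h hh => ?_⟩,
    Full.ext (loop_ext fun n => ?_) hc.1 hc.2⟩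
  · simpa using hcoef h hh 0 r
  · change _ = coeff n (mono r _)
    rw [coeff_mono]
    split_ifs with h
    · rw [h]
    · exact hdeg n (Ne.symm h)

/-- A root vector with zero loop part lies in `ℂc ⊕ ℂd` and has weight `0`. Otherwise a non-zero
coefficient pairs with some root space of `𝔤`, and the weight is read off from that root. -/
theorem exists_affWeight_eq (τ : E.Twist m ω) {ξ : Module.Dual ℂ τ.affCartan}
    (hξ : ξ ∈ roots τ.affCartan) :
    ξ = 0 ∨ ∃ α ∈ roots E.cartan, ∃ n : ℤ, ξ = τ.affWeight α n := by
  obtain ⟨X, hX, hX0⟩ := exists_ne_zero_of_mem_roots hξ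
  have hE := E.isExtendedAffine
  by_cases hl : (X : E.Full).loop = 0
  · left
    ext Z
    obtain ⟨h, hh, u, v, rfl⟩ := τ.exists_eq_affElt Z
    have h1 : ⁅(τ.affElt h hh u v : τ.aff), X⁆ = 0 := by
      refine Subtype.ext (Full.ext (loop_ext fun n => ?_) (τ.lie_affElt_c hh u v X)
        (τ.lie_affElt_d hh u v X))
      rw [coeff_lie_affElt, hl]
      simp
    rw [hX, smul_eq_zero] at h1
    exact h1.resolve_right hX0
  · right
    obtain ⟨n, hn⟩ : ∃ n, coeff n (X : E.Full).loop ≠ 0 := by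
      by_contra hc
      push Not at hc
      exact hl (loop_ext fun n => by rw [hc n, map_zero])
    obtain ⟨γ, y, hy, hxy⟩ : ∃ γ, ∃ y ∈ rootSpace E.cartan γ,
        E.form (coeff n (X : E.Full).loop) y ≠ 0 := by
      by_contra hc
      push Not at hc
      exact hn (hE.eq_zero_of_forall_rootSpace hc)
    have hγ : γ ∈ roots E.cartan := mem_roots_of_ne_zero hy (by rintro rfl; simp at hxy)
    refine ⟨-γ, hE.neg_mem_roots hγ, n, ?_⟩
    ext Z
    obtain ⟨h, hh, u, v, rfl⟩ := τ.exists_eq_affElt Z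
    rw [affWeight_affElt]
    have h1 := τ.coeff_lie_affElt hh u v X n
    have h2 : coeff n ((⁅(τ.affElt h hh u v : τ.aff), X⁆ : τ.aff) : E.Full).loop =
        ξ (τ.affElt h hh u v) • coeff n (X : E.Full).loop := by
      rw [hX]
      exact map_smul (coeff n) _ _
    rw [h2] at h1
    set x := coeff n (X : E.Full).loop
    have h3 : E.form ⁅x, (h : 𝔤)⁆ y = E.form x ⁅(h : 𝔤), y⁆ := hE.invariant _ _ _
    rw [← lie_skew, hy h, map_neg, LinearMap.neg_apply, map_smul, smul_eq_mul] at h3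
    have h4 := congrArg (fun w => E.form w y) h1
    simp only [map_add, map_smul, LinearMap.add_apply, LinearMap.smul_apply, smul_eq_mul] at h4
    rw [LinearMap.neg_apply]
    apply mul_right_cancel₀ hxy
    linear_combination h4 - h3

theorem dualForm_affWeight (τ : E.Twist m ω) (a b : Module.Dual ℂ E.cartan) (r s : ℤ) :
    dualForm τ.affForm τ.affCartan (τ.affWeight a r) (τ.affWeight b s) =
      τ.kform (τ.dualProj 0 a) (τ.dualProj 0 b) := by
  have hfix : ∀ a, τ.σ (τ.tvec (τ.dualProj 0 a)) = τ.tvec (τ.dualProj 0 a) := fun a => by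
    rw [tvec_dualProj, sigma_proj, zpow_zero, one_smul]
  -- The vector representing `a + rδ` is `t_{π(a)} + rc`, since `c` and `d` are dual under the form;
  -- `c` is isotropic, so `δ` does not contribute to norms.
  let t : Module.Dual ℂ E.cartan → ℤ → τ.affCartan := fun a r =>
    τ.affElt (dualVec E.form E.cartan (τ.dualProj 0 a)) (hfix a) r 0
  have ht : ∀ a r Z, τ.affWeight a r Z = τ.affForm (Z : τ.aff) (t a r : τ.aff) := by
    intro a r Z
    obtain ⟨h, hh, u, v, rfl⟩ := τ.exists_eq_affElt Z
    rw [affWeight_affElt]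
    change _ = loopForm E.form (mono 0 (h : 𝔤)) (mono 0 (τ.tvec (τ.dualProj 0 a))) + u * 0 + r * v
    rw [loopForm_mono, if_pos (add_zero 0), ← τ.proj_zero_apply_of_fixed a hh,
      E.isExtendedAffine.apply_eq, tvec_apply]
    ring
  have hspec : ∀ a r Z, τ.affWeight a r Z =
      τ.affForm (Z : τ.aff) (dualVec τ.affForm τ.affCartan (τ.affWeight a r) : τ.aff) := fun a r =>
    Classical.epsilon_spec (p := fun t : τ.affCartan => ∀ Z : τ.affCartan,
      τ.affWeight a r Z = τ.affForm (Z : τ.aff) (t : τ.aff)) ⟨t a r, ht a r⟩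
  have hsymm : ∀ X Y : τ.aff, τ.affForm X Y = τ.affForm Y X := fun X Y => Full.form_symm E X Y
  rw [dualForm, ← hspec, ht, hsymm, ← hspec]
  refine (τ.affWeight_affElt a r (hfix b) s 0).trans ?_
  rw [mul_zero, add_zero, ← τ.proj_zero_apply_of_fixed a (hfix b)]
  exact (E.isExtendedAffine.kform_eq_apply _ _).symm

theorem affWeight_mem_nonisoRoots_iff (τ : E.Twist m ω) {a : Module.Dual ℂ E.cartan} {r : ℤ} :
    τ.affWeight a r ∈ nonisoRoots τ.affForm τ.affCartan ↔
      τ.affWeight a r ∈ roots τ.affCartan ∧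
        τ.kform (τ.dualProj 0 a) (τ.dualProj 0 a) ≠ 0 := by
  rw [← τ.dualForm_affWeight a a r r]
  rfl

theorem exists_piRoot_of_mem_nonisoRoots (τ : E.Twist m ω) {ξ : Module.Dual ℂ τ.affCartan}
    (hξ : ξ ∈ nonisoRoots τ.affForm τ.affCartan) :
    ∃ α ∈ τ.piRoots, ∃ n : ℤ, ξ = τ.affWeight α n := by
  have hz : (0 : Module.Dual ℂ τ.affCartan) = τ.affWeight 0 0 := by
    ext Z
    obtain ⟨h, hh, u, v, rfl⟩ := τ.exists_eq_affElt Z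
    rw [affWeight_affElt]
    simp
  rcases τ.exists_affWeight_eq hξ.1 with rfl | ⟨α, hα, n, rfl⟩
  · rw [hz, affWeight_mem_nonisoRoots_iff] at hξ
    simp at hξ
  · rw [affWeight_mem_nonisoRoots_iff] at hξ
    exact ⟨α, τ.mem_piRoots_iff.2 ⟨hα, hξ.2⟩, n, rfl⟩

theorem exists_fixed_apply_ne_zero (τ : E.Twist m ω) {a : Module.Dual ℂ E.cartan}
    (ha : τ.kform (τ.dualProj 0 a) (τ.dualProj 0 a) ≠ 0) :
    ∃ h : E.cartan, τ.σ h = h ∧ a h ≠ 0 := by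
  have hfix : τ.σ (τ.tvec (τ.dualProj 0 a)) = τ.tvec (τ.dualProj 0 a) := by
    rw [tvec_dualProj, sigma_proj, zpow_zero, one_smul]
  refine ⟨dualVec E.form E.cartan (τ.dualProj 0 a), hfix, ?_⟩
  rw [kform_dualProj] at ha
  rwa [← E.isExtendedAffine.kform_eq_apply]

/-- If `π(ν)` is isotropic, then it is orthogonal to all roots. -/
theorem kform_dualProj_eq_zero (τ : E.Twist m ω) {ν γ : Module.Dual ℂ E.cartan}
    (hπ : τ.piRoots.Nonempty) (hν : ν ∈ roots E.cartan)
    (h0 : τ.kform (τ.dualProj 0 ν) (τ.dualProj 0 ν) = 0) (hγ : γ ∈ roots E.cartan) :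
    τ.kform (τ.dualProj 0 ν) γ = 0 := by
  obtain ⟨α₀, h₀⟩ := hπ
  refine τ.kform_dualProj_eq_zero_of_rform h₀.1 hν ?_ hγ
  rw [← smul_dualProj_zero, IsExtendedAffine.rform, map_smul, map_smul, LinearMap.smul_apply,
    show E.isExtendedAffine.kform (τ.dualProj 0 ν) (τ.dualProj 0 ν) = 0 from h0]
  simp

/-- By semidefiniteness an isotropic `π(ν)` is orthogonal to all roots, so adding it to `π(γ)`
leaves the norm unchanged. -/
theorem affCore_le (τ : E.Twist m ω) (hπ : τ.piRoots.Nonempty) :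
    (core τ.affForm τ.affCartan).toSubmodule ≤ ⨆ ξ, corePart τ.affForm τ.affCartan ξ := by
  refine core_le_iSup_corePart fun η _ ζ _ θ hθ hr hn hr' => ?_
  rcases τ.exists_affWeight_eq hr with h | ⟨ν, hν, n, h⟩
  · rwa [h, zero_add]
  · obtain ⟨γ, hγ, t, rfl⟩ := τ.exists_piRoot_of_mem_nonisoRoots hθ
    rw [h, affWeight_mem_nonisoRoots_iff, not_and_not_right] at hn
    rw [h, affWeight_add] at hr' ⊢
    rw [affWeight_mem_nonisoRoots_iff]
    refine ⟨hr', ?_⟩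
    have h0 := hn (h ▸ hr)
    have h1 := τ.kform_dualProj_eq_zero hπ hν h0 hγ.1.1
    rw [kform_symm, ← kform_dualProj] at h1
    rw [map_add, map_add, map_add, LinearMap.add_apply, LinearMap.add_apply, h0, h1,
      τ.kform_symm (τ.dualProj 0 ν), h1]
    simp only [zero_add, add_zero]
    exact hγ.2

/-! ### Brackets of opposite root spaces modulo the error space -/

theorem cartan_le_centralizer (τ : E.Twist m ω) {x : 𝔤} (hx : x ∈ E.cartan) :
    x ∈ τ.centralizer := by
  intro h hh _
  have := E.isExtendedAffine.mem_cartan_iff.2 hx ⟨h, hh⟩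
  simpa using this

/-- Decompose `y` into components in `𝔤_γ` with `γ` over `-β`. The component `γ = -β` contributes
`(x, y) t_β`; every other one contributes a vector of weight `β + γ ≠ 0` with `π(β + γ) = 0`, whose
projection belongs to the error space. -/
theorem lie_proj_sub_mem (τ : E.Twist m ω) {β : Module.Dual ℂ E.cartan} {k r s : ℤ}
    (hk : r + s = k) {x y : 𝔤} (hx : x ∈ rootSpace E.cartan β) (hy : y ∈ τ.eigWeight (-β) s) :
    Full.tens E k ⁅τ.proj r x, y⁆ - E.form x y • Full.tens E k (τ.proj k (τ.tvec β)) ∈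
      τ.errorSpace k := by
  have hE := E.isExtendedAffine
  rw [← map_smul, ← map_sub]
  refine Submodule.mem_map_of_mem ⟨?_, ?_⟩
  · refine sub_mem ?_ (Submodule.smul_mem _ _ (τ.cartan_le_centralizer
      (τ.proj_mem_cartan (dualVec E.form E.cartan β).2 k)))
    intro h hh hs
    have := τ.lie_mem_eigWeight (τ.proj_mem_eigWeight hx (fun _ _ => rfl) r) hy
    rw [add_neg_cancel] at this
    simpa using this.2 ⟨h, hh⟩ hs
  · rw [← τ.lie_proj hk x hy.1, ← map_smul, ← map_sub]
    suffices h : ⁅x, y⁆ - E.form x y • τ.tvec β ∈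
        ⨆ μ ∈ {μ | μ ∈ roots E.cartan ∧ μ ≠ 0 ∧ τ.dualProj 0 μ = 0}, rootSpace E.cartan μ by
      have := Submodule.mem_map_of_mem (f := τ.proj k) h
      simp only [Submodule.map_iSup] at this
      exact this
    have hy' := τ.eigWeight_le_iSup _ _ hy
    clear hy
    induction hy' using Submodule.iSup_induction' with
    | zero => simp
    | add y z _ _ hy hz =>
      rw [lie_add, map_add, add_smul, add_sub_add_comm]
      exact add_mem hy hz
    | mem γ y hy =>
      induction hy using Submodule.iSup_induction' with
      | zero => simp
      | add y z _ _ hy hz =>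
        rw [lie_add, map_add, add_smul, add_sub_add_comm]
        exact add_mem hy hz
      | mem hγ y hy =>
        by_cases hne : β + γ = 0
        · obtain rfl : γ = -β := (neg_eq_of_add_eq_zero_right hne).symm
          rw [hE.lie_eq_smul_dualVec hx hy, tvec_apply, sub_self]
          exact zero_mem _
        · rw [hE.form_eq_zero hx hy hne, zero_smul, sub_zero]
          by_cases h0 : ⁅x, y⁆ = 0
          · rw [h0]; exact zero_mem _
          have hxy := lie_mem_rootSpace hx hy
          refine Submodule.mem_iSup_of_mem (β + γ) (Submodule.mem_iSup_of_mem
            ⟨mem_roots_of_ne_zero hxy h0, hne, ?_⟩ hxy)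
          rw [map_add, τ.dualProj_eq_iff.2 hγ, map_neg, add_neg_cancel]

/-- Some `𝔤_γ` over `α` pairs with `y`; separation puts `β` in the orbit of `γ`, and the eigenvector
`y` pairs equally well with the image under `σ^i`. -/
theorem exists_form_eq_one (τ : E.Twist m ω) {α β : Module.Dual ℂ E.cartan} (hα : α ∈ τ.piRoots)
    (hβ : β ∈ τ.piRoots) (hβα : τ.SameRestriction β α) {s : ℤ} {y : 𝔤}
    (hy : y ∈ τ.eigWeight (-α) s) (h0 : y ≠ 0) : ∃ x ∈ rootSpace E.cartan β, E.form x y = 1 := by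
  have hE := E.isExtendedAffine
  obtain ⟨γ, hγ, hγr, x, hx, hxy⟩ := τ.exists_root_of_mem_eigWeight hy h0
  have hγα : τ.SameRestriction (-γ) α := by simpa using hγr.neg
  have hγ' := τ.mem_piRoots_of_sameRestriction hα (hE.neg_mem_roots hγ) hγα
  obtain ⟨i, hi⟩ := τ.separatesOrbits _ hγ' _ hβ
    (τ.dualProj_eq_iff.2 (hγα.trans hβα.symm))
  have hx' := τ.sigma_pow_mem_rootSpace hx i
  rw [hi] at hx'
  have hne : E.form ((τ.sigma ^ i) x) y ≠ 0 := by
    intro h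
    rw [hE.symm, ← τ.form_sigma_pow i, τ.sigma_pow_eq_smul hy.1, map_smul, h, smul_zero] at hxy
    exact hxy rfl
  exact ⟨(E.form ((τ.sigma ^ i) x) y)⁻¹ • (τ.sigma ^ i) x, Submodule.smul_mem _ _ hx', by
    rw [map_smul, LinearMap.smul_apply, smul_eq_mul, inv_mul_cancel₀ hne]⟩

/-- The bracket of opposite root spaces of the affinization, as a subspace of the ambient
algebra. -/
def oppBracket (τ : E.Twist m ω) (α : Module.Dual ℂ E.cartan) (r s : ℤ) : Submodule ℂ E.Full :=
  (bracketSpan (τ.affRootSpace α r) (τ.affRootSpace (-α) s)).map τ.aff.toSubmodule.subtype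

theorem tens_lie_mem_oppBracket (τ : E.Twist m ω) {α : Module.Dual ℂ E.cartan} {r s : ℤ}
    (hk : r + s ≠ 0) {x y : 𝔤} (hx : x ∈ τ.eigWeight α r) (hy : y ∈ τ.eigWeight (-α) s) :
    Full.tens E (r + s) ⁅x, y⁆ ∈ τ.oppBracket α r s := by
  obtain ⟨X, hX, hX'⟩ := τ.exists_mem_affRootSpace hx
  obtain ⟨Y, hY, hY'⟩ := τ.exists_mem_affRootSpace hy
  have hXY : ((⁅X, Y⁆ : τ.aff) : E.Full) = Full.tens E (r + s) ⁅x, y⁆ := by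
    rw [← Full.lie_tens hk, ← hX', ← hY']
    rfl
  rw [← hXY]
  exact Submodule.mem_map_of_mem (f := τ.aff.toSubmodule.subtype) (lie_mem_bracketSpan hX hY)

theorem tens_tvec_mem_oppBracket (τ : E.Twist m ω) {α β : Module.Dual ℂ E.cartan}
    (hα : α ∈ τ.piRoots) (hβ : β ∈ τ.piRoots) (hβα : τ.SameRestriction β α) {k r s : ℤ}
    (hrs : r + s = k) (hk : k ≠ 0) {y : 𝔤} (hy : y ∈ τ.eigWeight (-α) s) (h0 : y ≠ 0) :
    Full.tens E k (τ.proj k (τ.tvec β)) ∈ τ.oppBracket α r s ⊔ τ.errorSpace k := by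
  obtain ⟨x, hx, hxy⟩ := τ.exists_form_eq_one hα hβ hβα hy h0
  have h1 := τ.lie_proj_sub_mem hrs hx (τ.eigWeight_congr hy hβα.symm.neg rfl)
  rw [hxy, one_smul] at h1
  have h2 := τ.tens_lie_mem_oppBracket (by rwa [hrs]) (τ.proj_mem_eigWeight hx hβα r) hy
  rw [hrs] at h2
  have := sub_mem (Submodule.mem_sup_left (T := τ.errorSpace k) h2)
    (Submodule.mem_sup_right (S := τ.oppBracket α r s) h1)
  rwa [sub_sub_cancel] at this

theorem oppBracket_le (τ : E.Twist m ω) {α : Module.Dual ℂ E.cartan}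
    (hα : α ∈ τ.piRoots) {k r s : ℤ} (hrs : r + s = k) (hk : k ≠ 0) :
    τ.oppBracket α r s ≤ Submodule.span ℂ {X | ∃ β ∈ τ.piRoots, τ.dualProj 0 β = τ.dualProj 0 α ∧
      X = Full.tens E k (τ.proj k (dualVec E.form E.cartan β))} ⊔ τ.errorSpace k := by
  set S := Submodule.span ℂ {X | ∃ β ∈ τ.piRoots, τ.dualProj 0 β = τ.dualProj 0 α ∧
    X = Full.tens E k (τ.proj k (dualVec E.form E.cartan β))} with hS
  rw [oppBracket, Submodule.map_le_iff_le_comap]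
  refine Submodule.span_le.2 ?_
  rintro _ ⟨X, hX, Y, hY, rfl⟩
  obtain ⟨h, hh, hαh⟩ := τ.exists_fixed_apply_ne_zero hα.2
  obtain ⟨x, hx, hX'⟩ := τ.eq_tens_of_mem_affRootSpace (Or.inr ⟨h, hh, hαh⟩) hX
  obtain ⟨y, hy, hY'⟩ := τ.eq_tens_of_mem_affRootSpace
    (Or.inr ⟨h, hh, by simpa using hαh⟩) hY
  change ((⁅X, Y⁆ : τ.aff) : E.Full) ∈ S ⊔ τ.errorSpace k
  have hXY : ((⁅X, Y⁆ : τ.aff) : E.Full) = Full.tens E k ⁅x, y⁆ := by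
    rw [← hrs, ← Full.lie_tens (by rwa [hrs]), ← hX', ← hY']
    rfl
  rw [hXY, ← τ.proj_eq_self hx.1]
  have hx' := τ.eigWeight_le_iSup _ _ hx
  clear hx hX' hXY
  induction hx' using Submodule.iSup_induction' with
  | zero => simp
  | add x z _ _ hx hz => rw [map_add, add_lie, map_add]; exact add_mem hx hz
  | mem β x hx =>
    induction hx using Submodule.iSup_induction' with
    | zero => simp
    | add x z _ _ hx hz => rw [map_add, add_lie, map_add]; exact add_mem hx hz
    | mem hβ x hx =>
      by_cases h0 : x = 0
      · simp [h0]
      have hβ' := τ.mem_piRoots_of_sameRestriction hα (mem_roots_of_ne_zero hx h0) hβ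
      have h1 := τ.lie_proj_sub_mem hrs hx
        (τ.eigWeight_congr hy (SameRestriction.neg (SameRestriction.symm hβ)) rfl)
      have h2 : E.form x y • Full.tens E k (τ.proj k (τ.tvec β)) ∈ S :=
        Submodule.smul_mem _ _ (Submodule.subset_span ⟨β, hβ', τ.dualProj_eq_iff.2 hβ, rfl⟩)
      have := add_mem (Submodule.mem_sup_right (S := S) h1)
        (Submodule.mem_sup_left (T := τ.errorSpace k) h2)
      rwa [sub_add_cancel] at this

theorem oppBracket_sup (τ : E.Twist m ω) {α : Module.Dual ℂ E.cartan}
    (hα : α ∈ τ.piRoots) {k r s : ℤ} (hrs : r + s = k) (hk : k ≠ 0)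
    (hs : τ.affWeight (-α) s ∈ nonisoRoots τ.affForm τ.affCartan) :
    τ.oppBracket α r s ⊔ τ.errorSpace k =
      Submodule.span ℂ {X | ∃ β ∈ τ.piRoots, τ.dualProj 0 β = τ.dualProj 0 α ∧
        X = Full.tens E k (τ.proj k (dualVec E.form E.cartan β))} ⊔ τ.errorSpace k := by
  refine le_antisymm (sup_le (τ.oppBracket_le hα hrs hk) le_sup_right)
    (sup_le (Submodule.span_le.2 ?_) le_sup_right)
  rintro _ ⟨β, hβ, hβα, rfl⟩
  obtain ⟨Y, hY, hY0⟩ := exists_ne_zero_of_mem_roots hs.1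
  obtain ⟨h, hh, hαh⟩ := τ.exists_fixed_apply_ne_zero hα.2
  obtain ⟨y, hy, hY'⟩ := τ.eq_tens_of_mem_affRootSpace
    (Or.inr ⟨h, hh, by simpa using hαh⟩) hY
  refine τ.tens_tvec_mem_oppBracket hα hβ (τ.dualProj_eq_iff.1 hβα) hrs hk hy ?_
  rintro rfl
  exact hY0 (Subtype.ext (by rw [hY', map_zero]; rfl))

theorem mem_piRoots_of_affWeight_mem_nonisoRoots (τ : E.Twist m ω) {α : Module.Dual ℂ E.cartan}
    (hα : α ∈ roots E.cartan) {r : ℤ}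
    (hr : τ.affWeight (τ.dualProj 0 α) r ∈ nonisoRoots τ.affForm τ.affCartan) :
    α ∈ τ.piRoots := by
  rw [τ.affWeight_congr (τ.sameRestriction_dualProj α), affWeight_mem_nonisoRoots_iff] at hr
  exact τ.mem_piRoots_iff.2 ⟨hα, hr.2⟩

theorem bracketSpan_dualProj (τ : E.Twist m ω) (α : Module.Dual ℂ E.cartan) (r s : ℤ) :
    (bracketSpan (τ.affRootSpace (τ.dualProj 0 α) r)
      (τ.affRootSpace (-τ.dualProj 0 α) s)).map τ.aff.toSubmodule.subtype =
      τ.oppBracket α r s := by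
  rw [oppBracket, affRootSpace, affRootSpace, affRootSpace, affRootSpace,
    τ.affWeight_congr (τ.sameRestriction_dualProj α),
    τ.affWeight_congr (τ.sameRestriction_dualProj α).neg]

theorem tens_tvec_dualSigma_pow (τ : E.Twist m ω) (k : ℤ) (α : Module.Dual ℂ E.cartan) (i : ℕ) :
    Full.tens E k (τ.proj k (τ.tvec ((τ.dualSigma ^ i) α))) =
      (ω ^ k) ^ i • Full.tens E k (τ.proj k (τ.tvec α)) := by
  rw [← tvec_dualProj, dualProj_dualSigma_pow, map_smul, map_smul, tvec_dualProj]

theorem omega_pow_ne_zero (τ : E.Twist m ω) (k : ℤ) (i : ℕ) : (ω ^ k) ^ i ≠ 0 :=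
  pow_ne_zero _ (zpow_ne_zero _ τ.omega_ne_zero)

/-- All roots over `π(α)` are conjugate, and conjugation changes `π_k(t_α)` only by a power of
`ω^k`. -/
theorem oppBracket_sup_eq_span_singleton (τ : E.Twist m ω) {α : Module.Dual ℂ E.cartan}
    (hα : α ∈ τ.piRoots) {k r s : ℤ} (hrs : r + s = k) (hk : k ≠ 0)
    (hs : τ.affWeight (-α) s ∈ nonisoRoots τ.affForm τ.affCartan) :
    τ.oppBracket α r s ⊔ τ.errorSpace k =
      Submodule.span ℂ {Full.tens E k (τ.proj k (dualVec E.form E.cartan α))} ⊔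
        τ.errorSpace k := by
  rw [τ.oppBracket_sup hα hrs hk hs]
  congr 1
  refine le_antisymm (Submodule.span_le.2 ?_) (Submodule.span_mono ?_)
  · rintro _ ⟨β, hβ, hβα, rfl⟩
    obtain ⟨i, rfl⟩ := τ.separatesOrbits _ hα _ hβ hβα.symm
    exact Submodule.mem_span_singleton.2 ⟨_, (τ.tens_tvec_dualSigma_pow k α i).symm⟩
  · rintro _ rfl
    exact ⟨α, hα, rfl, rfl⟩

/-! ### The isotropic part of the core -/

theorem affRootSpace_le_core (τ : E.Twist m ω) {α : Module.Dual ℂ E.cartan}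
    (hα : α ∈ τ.piRoots) (r : ℤ) :
    τ.affRootSpace α r ≤ (core τ.affForm τ.affCartan).toSubmodule := by
  by_cases h : τ.affWeight α r ∈ roots τ.affCartan
  · exact rootSpace_le_core (τ.affWeight_mem_nonisoRoots_iff.2 ⟨h, hα.2⟩)
  · have : τ.affRootSpace α r = ⊥ := not_not.1 h
    rw [this]
    exact bot_le

theorem oppBracket_le_core (τ : E.Twist m ω) {α : Module.Dual ℂ E.cartan}
    (hα : α ∈ τ.piRoots) {k r s : ℤ} (hrs : r + s = k) :
    τ.oppBracket α r s ≤ (τ.affRootSpace 0 k ⊓ (core τ.affForm τ.affCartan).toSubmodule).map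
      τ.aff.toSubmodule.subtype := by
  refine Submodule.map_mono (le_inf ?_ (Submodule.span_le.2 ?_))
  · have := bracketSpan_le_rootSpace (τ.affWeight α r) (τ.affWeight (-α) s)
    rwa [affWeight_add, add_neg_cancel, hrs] at this
  · rintro _ ⟨X, hX, Y, hY, rfl⟩
    exact (core τ.affForm τ.affCartan).lie_mem (τ.affRootSpace_le_core hα r hX)
      (τ.affRootSpace_le_core (τ.neg_mem_piRoots hα) s hY)

/-- The weight `kδ` is isotropic, so the corresponding part of the core consists of brackets alone,
and two weights adding up to `kδ` are `π(α) + rδ` and `-π(α) + (k - r)δ`. -/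
theorem coreDegree_le (τ : E.Twist m ω) (hπ : τ.piRoots.Nonempty) {k : ℤ} {S : Submodule ℂ E.Full}
    (hS : ∀ α ∈ τ.piRoots, ∀ r s, r + s = k → τ.oppBracket α r s ≤ S) :
    (τ.affRootSpace 0 k ⊓ (core τ.affForm τ.affCartan).toSubmodule).map
      τ.aff.toSubmodule.subtype ≤ S := by
  rw [Submodule.map_le_iff_le_comap]
  rintro X ⟨hX, hXc⟩
  have h1 := mem_of_mem_iSup_of_mem_rootSpace _ corePart_le (τ.affCore_le hπ hXc) hX
  have hn : τ.affWeight 0 k ∉ nonisoRoots τ.affForm τ.affCartan := by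
    rw [affWeight_mem_nonisoRoots_iff]
    simp
  revert h1
  refine fun h1 => (sup_le (iSup_le fun h => absurd h hn) (iSup₂_le fun ξ hξ => iSup₂_le
    fun ζ _ => iSup_le fun h => ?_) : corePart τ.affForm τ.affCartan (τ.affWeight 0 k) ≤ _) h1
  obtain ⟨α, hα, r, rfl⟩ := τ.exists_piRoot_of_mem_nonisoRoots hξ
  have hζ : ζ = τ.affWeight (-α) (k - r) := by
    have h2 := τ.affWeight_add α (-α) r (k - r)
    rw [add_neg_cancel, add_sub_cancel] at h2
    exact add_left_cancel (h.trans h2.symm)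
  rw [← Submodule.map_le_iff_le_comap, hζ]
  exact hS α hα r (k - r) (add_sub_cancel r k)

theorem coreDegree_sup (τ : E.Twist m ω) (hπ : τ.piRoots.Nonempty) {k : ℤ} (hk : k ≠ 0)
    {O : Set (Module.Dual ℂ E.cartan)} (hO : τ.IsOrbitReps O) :
    (τ.affRootSpace 0 k ⊓ (core τ.affForm τ.affCartan).toSubmodule).map
        τ.aff.toSubmodule.subtype ⊔ τ.errorSpace k =
      Submodule.span ℂ {X | ∃ α ∈ O,
        X = Full.tens E k (dualVec E.form E.cartan (τ.dualProj k α))} ⊔ τ.errorSpace k := by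
  refine le_antisymm (sup_le (τ.coreDegree_le hπ fun α hα r s hrs => ?_) le_sup_right)
    (sup_le (Submodule.span_le.2 ?_) le_sup_right)
  · refine (τ.oppBracket_le hα hrs hk).trans (sup_le_sup_right (Submodule.span_le.2 ?_) _)
    rintro _ ⟨β, hβ, -, rfl⟩
    obtain ⟨γ, ⟨hγ, i, hi⟩, -⟩ := hO.2 β hβ
    have h1 : Full.tens E k (τ.tvec (τ.dualProj k γ)) ∈ Submodule.span ℂ {X | ∃ α ∈ O,
        X = Full.tens E k (dualVec E.form E.cartan (τ.dualProj k α))} :=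
      Submodule.subset_span ⟨γ, hγ, rfl⟩
    rw [tvec_dualProj, ← hi, tens_tvec_dualSigma_pow] at h1
    exact (Submodule.smul_mem_iff _ (τ.omega_pow_ne_zero k i)).1 h1
  · rintro _ ⟨α, hα, rfl⟩
    have hαR := hO.1 hα
    obtain ⟨y, hy, hy0⟩ := exists_ne_zero_of_mem_roots
      (E.isExtendedAffine.neg_mem_roots hαR.1.1)
    -- A non-zero vector has a non-zero projection in some degree `s`, so the complementary degree
    -- `r = k - s` realizes `π_k(t_α)`.
    obtain ⟨s, -, hs⟩ : ∃ s ∈ Finset.range m, τ.proj s y ≠ 0 := by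
      by_contra hc
      push Not at hc
      exact hy0 (by rw [← τ.sum_proj y, Finset.sum_eq_zero hc])
    have h1 := τ.tens_tvec_mem_oppBracket hαR hαR (fun _ _ => rfl) (sub_add_cancel k s) hk
      (τ.proj_mem_eigWeight hy (fun _ _ => rfl) s) hs
    rw [← tvec_dualProj] at h1
    exact sup_le_sup_right (τ.oppBracket_le_core hαR (sub_add_cancel k s)) _ h1

/-! ### Automorphisms of prime order -/

/-- If `π(μ) = 0`, then `π(x)` lies in `𝔥` for `x ∈ 𝔤_μ`, by the centralizer condition, and is
orthogonal to `𝔤_{-μ}`. But primality makes the `m` conjugates of `μ` distinct, so pairing `π(x)`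
with `y ∈ 𝔤_{-μ}` leaves only `(x, y)/m`. -/
theorem dualProj_zero_ne_zero_of_prime (τ : E.Twist m ω) (hm : m.Prime)
    {μ : Module.Dual ℂ E.cartan} (hμ : μ ∈ roots E.cartan) (h0 : μ ≠ 0) : τ.dualProj 0 μ ≠ 0 := by
  intro hπ
  have hE := E.isExtendedAffine
  have hσ : τ.dualSigma μ ≠ μ := by
    intro h
    apply h0
    rw [← hπ]
    exact (cyclicProj_eq_self τ.primitive τ.pos (by simpa using h)).symm
  have hne : ∀ i ∈ Finset.range m, i ≠ 0 → (τ.dualSigma ^ i) μ ≠ μ := by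
    intro i hi hi0 h
    have h1 : Function.IsPeriodicPt τ.dualSigma i μ := by
      rw [Module.End.pow_apply] at h
      exact h
    have h2 : Function.IsPeriodicPt τ.dualSigma m μ := by
      have := LinearMap.congr_fun τ.dualSigma_pow_eq_one μ
      rw [Module.End.pow_apply] at this
      exact this
    have h3 := h2.gcd h1
    rw [Nat.Coprime.gcd_eq_one ((Nat.coprime_of_lt_prime hi0 (Finset.mem_range.1 hi) hm))] at h3
    exact hσ h3
  obtain ⟨x, hx, hx0⟩ := exists_ne_zero_of_mem_roots hμ
  obtain ⟨y, hy, hxy⟩ := hE.exists_form_ne_zero hx hx0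
  have hx' : τ.proj 0 x ∈ τ.eigWeight 0 0 :=
    τ.proj_mem_eigWeight hx (τ.dualProj_eq_iff.1 (by rw [hπ, map_zero])) 0
  have h1 : E.form (τ.proj 0 x) y = 0 :=
    hE.form_eq_zero (hE.mem_cartan_iff.2 (τ.mem_cartan_of_mem_eigWeight_zero hx').1) hy
      (by simpa using h0)
  rw [proj, cyclicProj_apply, map_smul, LinearMap.smul_apply, map_sum, LinearMap.sum_apply,
    Finset.sum_eq_single_of_mem 0 (Finset.mem_range.2 τ.pos)] at h1
  · have hm0 : (m : ℂ) ≠ 0 := by exact_mod_cast τ.pos.ne'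
    simp [hm0, hxy] at h1
  · intro i hi hi0
    rw [map_smul, LinearMap.smul_apply, hE.form_eq_zero (τ.sigma_pow_mem_rootSpace hx i) hy,
      smul_zero]
    rw [← sub_eq_add_neg, sub_ne_zero]
    exact hne i hi hi0

theorem errorSpace_eq_bot_of_prime (τ : E.Twist m ω) (hm : m.Prime) (k : ℤ) :
    τ.errorSpace k = ⊥ := by
  have h : {μ | μ ∈ roots E.cartan ∧ μ ≠ 0 ∧ τ.dualProj 0 μ = 0} = ∅ :=
    Set.eq_empty_of_forall_notMem fun μ hμ => τ.dualProj_zero_ne_zero_of_prime hm hμ.1 hμ.2.1 hμ.2.2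
  rw [errorSpace, h]
  simp

/-! ### Dimension of the core in degree `k` for prime `m` -/

theorem tvec_mem_core (τ : E.Twist m ω) {α : Module.Dual ℂ E.cartan}
    (hα : α ∈ nonisoRoots E.form E.cartan) : τ.tvec α ∈ core E.form E.cartan := by
  have hE := E.isExtendedAffine
  obtain ⟨x, hx, hx0⟩ := exists_ne_zero_of_mem_roots hα.1
  obtain ⟨y, hy, hxy⟩ := hE.exists_form_eq hx hx0 1
  have h := hE.lie_eq_smul_dualVec hx hy
  rw [hxy, one_smul] at h
  rw [tvec_apply, ← h]
  exact (core E.form E.cartan).lie_mem (rootSpace_le_core hα hx)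
    (rootSpace_le_core (hE.neg_mem_nonisoRoots hα) hy)

theorem span_le_map_proj (τ : E.Twist m ω) {O : Set (Module.Dual ℂ E.cartan)}
    (hO : O ⊆ τ.piRoots) (k : ℤ) :
    (Submodule.span ℂ (τ.dualProj k '' {α ∈ O | τ.dualProj k α ≠ 0})).map τ.tvec ≤
      (E.cartan.toSubmodule ⊓ (core E.form E.cartan).toSubmodule).map (τ.proj k) := by
  rw [Submodule.map_le_iff_le_comap, Submodule.span_le]
  rintro _ ⟨α, ⟨hα, -⟩, rfl⟩
  exact ⟨τ.tvec α, ⟨(dualVec E.form E.cartan α).2, τ.tvec_mem_core (hO hα).1⟩,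
    (τ.tvec_dualProj k α).symm⟩

theorem map_coreDegree_eq (τ : E.Twist m ω) (hπ : τ.piRoots.Nonempty) (hm : m.Prime) {k : ℤ}
    (hk : k ≠ 0) {O : Set (Module.Dual ℂ E.cartan)} (hO : τ.IsOrbitReps O) :
    (τ.affRootSpace 0 k ⊓ (core τ.affForm τ.affCartan).toSubmodule).map
        τ.aff.toSubmodule.subtype =
      (Submodule.span ℂ (τ.dualProj k '' {α ∈ O | τ.dualProj k α ≠ 0})).map
        (Full.tens E k ∘ₗ τ.tvec) := by
  have h := τ.coreDegree_sup hπ hk hO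
  rw [τ.errorSpace_eq_bot_of_prime hm, sup_bot_eq, sup_bot_eq] at h
  rw [h, Submodule.map_span]
  refine le_antisymm (Submodule.span_le.2 ?_) (Submodule.span_mono ?_)
  · rintro _ ⟨α, hα, rfl⟩
    by_cases h0 : τ.dualProj k α = 0
    · have : Full.tens E k (τ.tvec (τ.dualProj k α)) = 0 := by rw [h0, map_zero, map_zero]
      rw [tvec_apply] at this
      rw [this]
      exact zero_mem _
    · exact Submodule.subset_span ⟨_, ⟨α, ⟨hα, h0⟩, rfl⟩, rfl⟩
  · rintro _ ⟨_, ⟨α, ⟨hα, -⟩, rfl⟩, rfl⟩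
    exact ⟨α, hα, rfl⟩

theorem rank_coreDegree (τ : E.Twist m ω) (hπ : τ.piRoots.Nonempty) (hm : m.Prime) {k : ℤ}
    (hk : k ≠ 0) {O : Set (Module.Dual ℂ E.cartan)} (hO : τ.IsOrbitReps O) :
    Module.rank ℂ ↥(τ.affRootSpace 0 k ⊓ (core τ.affForm τ.affCartan).toSubmodule) =
      Module.rank ℂ ↥(Submodule.span ℂ (τ.dualProj k '' {α ∈ O | τ.dualProj k α ≠ 0})) := by
  have h1 := (Submodule.equivMapOfInjective τ.aff.toSubmodule.subtype Subtype.val_injective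
    (τ.affRootSpace 0 k ⊓ (core τ.affForm τ.affCartan).toSubmodule)).rank_eq
  have h2 := (Submodule.equivMapOfInjective (Full.tens E k ∘ₗ τ.tvec)
    ((Full.tens_injective E k).comp τ.tvec_injective)
    (Submodule.span ℂ (τ.dualProj k '' {α ∈ O | τ.dualProj k α ≠ 0}))).rank_eq
  exact h1.trans ((congrArg (fun S : Submodule ℂ E.Full => Module.rank ℂ S)
    (τ.map_coreDegree_eq hπ hm hk hO)).trans h2.symm)

/-- The representative `β` of the orbit of `-α`. -/
theorem exists_opposite_rep (τ : E.Twist m ω) {O : Set (Module.Dual ℂ E.cartan)}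
    (hO : τ.IsOrbitReps O) (k : ℤ) {α : Module.Dual ℂ E.cartan} (hα : α ∈ O) :
    ∃ β ∈ O, τ.dualProj 0 β = -τ.dualProj 0 α ∧ ∃ c : ℂ, c ≠ 0 ∧
      τ.dualProj k α = c • τ.dualProj k β := by
  obtain ⟨β, ⟨hβ, i, hi⟩, -⟩ := hO.2 _ (τ.neg_mem_piRoots (hO.1 hα))
  have h1 : ∀ k, (ω ^ k) ^ i • τ.dualProj k (-α) = τ.dualProj k β := fun k => by
    rw [← hi, dualProj_dualSigma_pow]
  refine ⟨β, hβ, ?_, -((ω ^ k) ^ i)⁻¹, neg_ne_zero.2 (inv_ne_zero (τ.omega_pow_ne_zero k i)), ?_⟩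
  · simpa using (h1 0).symm
  · rw [← h1, map_neg, smul_neg, smul_neg, neg_smul, neg_neg, smul_smul,
      inv_mul_cancel₀ (τ.omega_pow_ne_zero k i), one_smul]

/-- Each vector of a basis chosen among the `π_k(α)` yields two representatives: one, `f v`, with
`π_k` equal to it, and the representative `g v` of the opposite orbit, whose `π_k` is proportional
to it. They are all distinct, which bounds twice the rank, also for infinite cardinals. -/
theorem two_mul_rank_le (τ : E.Twist m ω) {O : Set (Module.Dual ℂ E.cartan)}
    (hO : τ.IsOrbitReps O) (k : ℤ) :
    2 * Module.rank ℂ ↥(Submodule.span ℂ (τ.dualProj k '' {α ∈ O | τ.dualProj k α ≠ 0})) ≤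
      Cardinal.mk ↥{α ∈ O | τ.dualProj k α ≠ 0} := by
  classical
  obtain ⟨b, hb, hspan, hli⟩ := exists_linearIndependent ℂ
    (τ.dualProj k '' {α ∈ O | τ.dualProj k α ≠ 0})
  rw [← hspan, rank_span_set hli]
  choose f hf hfe using fun v : b => hb v.2
  choose g hg hg0 c hc hgc using fun v : b => τ.exists_opposite_rep hO k (hf v).1
  have hgne : ∀ v : b, τ.dualProj k (g v) ≠ 0 := by
    intro v h
    have := hgc v
    rw [h, smul_zero] at this
    exact (hf v).2 this
  -- Distinct members of a linearly independent set are not proportional.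
  have hline : ∀ v w : b, ∀ a : ℂ, (v : Module.Dual ℂ E.cartan) = a • (w : Module.Dual ℂ E.cartan) →
      v = w := by
    intro v w a h
    by_contra hne
    have h1 := linearIndependent_iff'.1 hli {v, w} (fun u => if u = v then 1 else -a) (by
      rw [Finset.sum_pair hne, if_pos rfl, if_neg (Ne.symm hne), h]
      simp) v (by simp)
    simp at h1
  have hgf : ∀ v w : b, f v ≠ g w := by
    intro v w h
    have h1 : v = w := by
      refine hline v w (c w)⁻¹ ?_
      rw [← hfe, ← hfe, hgc w, h, smul_smul, inv_mul_cancel₀ (hc w), one_smul]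
    subst h1
    have h2 := hg0 v
    rw [← h] at h2
    -- An orbit equal to its own negative has `π(α) = -π(α)`, hence `π(α) = 0`, which is impossible
    -- in `R_π^×`.
    have h3 : τ.dualProj 0 (f v) = 0 := by
      have h4 : (2 : ℂ) • τ.dualProj 0 (f v) = 0 := by
        rw [two_smul]
        exact add_eq_zero_iff_eq_neg.2 h2
      exact (smul_eq_zero.1 h4).resolve_left two_ne_zero
    apply (hO.1 (hf v).1).2
    rw [h3, ← τ.kform_apply, map_zero]
  have hinj : Function.Injective (Sum.elim (fun v : b => (⟨f v, hf v⟩ :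
      ↥{α ∈ O | τ.dualProj k α ≠ 0})) fun v : b => ⟨g v, hg v, hgne v⟩) := by
    refine Function.Injective.sumElim ?_ ?_ ?_
    · intro v w h
      have := congrArg (τ.dualProj k) (Subtype.ext_iff.1 h)
      exact Subtype.ext (by rwa [hfe, hfe] at this)
    · intro v w h
      have := congrArg (τ.dualProj k) (Subtype.ext_iff.1 h)
      refine hline v w (c v * (c w)⁻¹) ?_
      rw [← hfe, ← hfe, hgc v, hgc w, smul_smul, mul_assoc, inv_mul_cancel₀ (hc w), mul_one]
      exact congrArg _ this
    · intro v w h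
      exact hgf v w (Subtype.ext_iff.1 h)
  have := Cardinal.mk_le_of_injective hinj
  rwa [Cardinal.mk_sum, Cardinal.lift_id, ← two_mul] at this

end Twist

end EALA

end

theorem mainTheorem7 {𝔤 : Type*} [LieRing 𝔤] [LieAlgebra ℂ 𝔤] (E : EALA 𝔤) {m : ℕ} {ω : ℂ}
    (τ : E.Twist m ω) (hπ : τ.piRoots.Nonempty) (k : ℤ) (hk : k ≠ 0) :
    -- the brackets of opposite non-isotropic root spaces, modulo `A`
    (∀ α ∈ roots E.cartan, ∀ r s : ℤ, r + s = k →
      τ.affWeight (τ.dualProj 0 α) r ∈ nonisoRoots τ.affForm τ.affCartan →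
      τ.affWeight (-τ.dualProj 0 α) s ∈ nonisoRoots τ.affForm τ.affCartan →
      (bracketSpan (τ.affRootSpace (τ.dualProj 0 α) r)
          (τ.affRootSpace (-τ.dualProj 0 α) s)).map τ.aff.toSubmodule.subtype ⊔ τ.errorSpace k =
        Submodule.span ℂ {X | ∃ β ∈ τ.piRoots, τ.dualProj 0 β = τ.dualProj 0 α ∧
          X = EALA.Full.tens E k (τ.proj k (dualVec E.form E.cartan β))} ⊔ τ.errorSpace k) ∧
    -- the case in which `π` separates the orbits
    (τ.SeparatesOrbits →
      (∀ α ∈ roots E.cartan, ∀ r s : ℤ, r + s = k →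
        τ.affWeight (τ.dualProj 0 α) r ∈ nonisoRoots τ.affForm τ.affCartan →
        τ.affWeight (-τ.dualProj 0 α) s ∈ nonisoRoots τ.affForm τ.affCartan →
        (bracketSpan (τ.affRootSpace (τ.dualProj 0 α) r)
            (τ.affRootSpace (-τ.dualProj 0 α) s)).map τ.aff.toSubmodule.subtype ⊔
              τ.errorSpace k =
          Submodule.span ℂ {EALA.Full.tens E k (τ.proj k (dualVec E.form E.cartan α))} ⊔
            τ.errorSpace k) ∧
      ∀ O, τ.IsOrbitReps O →
        (τ.affRootSpace 0 k ⊓ (core τ.affForm τ.affCartan).toSubmodule).map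
            τ.aff.toSubmodule.subtype ⊔ τ.errorSpace k =
          Submodule.span ℂ {X | ∃ α ∈ O,
            X = EALA.Full.tens E k (dualVec E.form E.cartan (τ.dualProj k α))} ⊔
            τ.errorSpace k) ∧
    -- the case of prime `m`
    (m.Prime →
      τ.errorSpace k = ⊥ ∧
      ∀ O, τ.IsOrbitReps O →
        Module.rank ℂ ↥(τ.affRootSpace 0 k ⊓ (core τ.affForm τ.affCartan).toSubmodule) =
          Module.rank ℂ ↥(Submodule.span ℂ (τ.dualProj k '' {α ∈ O | τ.dualProj k α ≠ 0})) ∧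
        Module.rank ℂ ↥(τ.affRootSpace 0 k ⊓ (core τ.affForm τ.affCartan).toSubmodule) ≤
          Module.rank ℂ ↥((E.cartan.toSubmodule ⊓ (core E.form E.cartan).toSubmodule).map
            (τ.proj k)) ∧
        2 * Module.rank ℂ ↥(τ.affRootSpace 0 k ⊓ (core τ.affForm τ.affCartan).toSubmodule) ≤
          Cardinal.mk ↥{α ∈ O | τ.dualProj k α ≠ 0}) := by
  have hneg : ∀ (α : Module.Dual ℂ E.cartan) (s : ℤ),
      τ.affWeight (-τ.dualProj 0 α) s = τ.affWeight (-α) s := fun α s =>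
    τ.affWeight_congr (τ.sameRestriction_dualProj α).neg s
  refine ⟨?_, fun _ => ⟨?_, fun O hO => τ.coreDegree_sup hπ hk hO⟩, fun hm =>
    ⟨τ.errorSpace_eq_bot_of_prime hm k, fun O hO => ?_⟩⟩
  · intro α hα r s hrs hr hs
    rw [hneg] at hs
    rw [τ.bracketSpan_dualProj]
    exact τ.oppBracket_sup (τ.mem_piRoots_of_affWeight_mem_nonisoRoots hα hr) hrs hk hs
  · intro α hα r s hrs hr hs
    rw [hneg] at hs
    rw [τ.bracketSpan_dualProj]
    exact τ.oppBracket_sup_eq_span_singleton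
      (τ.mem_piRoots_of_affWeight_mem_nonisoRoots hα hr) hrs hk hs
  · have h := τ.rank_coreDegree hπ hm hk hO
    refine ⟨h, ?_, ?_⟩
    -- Through `α ↦ t_α` the span of the `π_k(α)` embeds into `π_k(𝔥_c)`, because each `t_α` is a
    -- bracket of root vectors for `α` and `-α`.
    · rw [h, (Submodule.equivMapOfInjective τ.tvec τ.tvec_injective _).rank_eq]
      exact Submodule.rank_mono (τ.span_le_map_proj hO.1 k)
    · rw [h]
      exact τ.two_mul_rank_le hO k
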